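/- Let $k$ be an algebraically closed field of characteristic $p>0$ and let $\mathfrak{sl}_2$ be the Lie algebra of trace zero $2\times 2$ matrices over $k$, with its standard basis $e,f,h$ and with the $p$-operation $x\mapsto x^p$ (matrix power). Let $x,y,z$ be the coordinates on $\mathfrak{sl}_2$ dual to $e,f,h$. The nullcone is the zero locus of $xy+z^2$; put $A=k[x,y,z]/(xy+z^2)$ with its standard grading and $\mathbb P(\mathfrak{sl}_2)=\operatorname{Proj}A$. For $n\in\mathbb Z$, $\mathcal O(n)$ is the sheaf associated to the shifted graded module $A[n]$. For a restricted $\mathfrak{sl}_2$-module $M$ (a module over the restricted enveloping algebra $u(\mathfrak{sl}_2)$) let $\widetilde M(n)$ be the sheaf on $\mathbb P(\mathfrak{sl}_2)$ associated to the graded module $(A\otimes_k M)[n]$, and write $\widetilde M=\widetilde M(0)$. Let $\Theta_M(n)\colon\widetilde M(n)\to\widetilde M(n+1)$ be the map induced by the action of $x\otimes e+y\otimes f+z\otimes h$ on $A\otimes_k M$. Let $\operatorname{Ker}_M\subseteq\widetilde M$ be the kernel of $\Theta_M=\Theta_M(0)$, let $\operatorname{Im}^j_M\subseteq\widetilde M$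 be the image of $\Theta_M(-1)\circ\cdots\circ\Theta_M(-j)\colon\widetilde M(-j)\to\widetilde M$ (with $\operatorname{Im}^0_M=\widetilde M$), and for $1\le i\le p$ put $$\mathscr F_i(M)=\frac{\operatorname{Ker}_M\cap\operatorname{Im}^{i-1}_M}{\operatorname{Ker}_M\cap\operatorname{Im}^{i}_M}.$$ Let $\iota\colon\mathbb P^1=\operatorname{Proj}k[s,t]\to\mathbb P(\mathfrak{sl}_2)$ be the isomorphism $[s:t]\mapsto[s^2:-t^2:st]$. For a sheaf $\mathcal G$ of $\mathcal O_{\mathbb P^1}$-modules write $\mathcal G(n)=\mathcal G\otimes\mathcal O_{\mathbb P^1}(n)$, where $\mathcal O_{\mathbb P^1}(n)$ is the sheaf associated to $k[s,t][n]$. Let $M$ be a restricted $\mathfrak{sl}_2$-module, let $P\to M$ be a projective cover of $M$ in the category of restricted $\mathfrak{sl}_2$-modules, and let $\Omega M$ be its kernel. Then for every integer $i$ with $1\le i<p$ there is an isomorphism of sheaves of $\mathcal O_{\mathbb P^1}$-modules $$\iota^*\mathscr F_i(M)\;\cong\;\bigl(\iota^*\mathscr F_{p-i}(\Omega M)\bigr)(2p-2i).$$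 -/

import Mathlib

universe u

open CategoryTheory

noncomputable section

section
open TopologicalSpace Opposite AlgebraicGeometry TopCat

namespace ProjModule

variable {k A : Type u} [Field k] [CommRing A] [Algebra k A]
variable (𝒜 : ℕ → Submodule k A) [GradedAlgebra 𝒜]

/-- A graded module over the graded ring `𝒜`, recorded by its module and its homogeneous pieces
(indexed by `ℤ`). This is all the data that enters the associated sheaf on `Proj 𝒜`. -/
structure GrMod where
  carrier : Type u
  [addCommGroup : AddCommGroup carrier]
  [module : Module A carrier]
  piece : ℤ → AddSubgroup carrier
  smul_mem : ∀ {i : ℕ} {j : ℤ} {a : A} {m : carrier},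
    a ∈ 𝒜 i → m ∈ piece j → a • m ∈ piece (i + j)

attribute [instance] GrMod.addCommGroup GrMod.module

variable {𝒜}

/-- A degree zero homomorphism of graded modules. -/
structure GrHom (N N' : GrMod 𝒜) where
  lin : N.carrier →ₗ[A] N'.carrier
  map_mem : ∀ {j : ℤ} {m : N.carrier}, m ∈ N.piece j → lin m ∈ N'.piece j

/-- The shifted module `N[n]`, with `N[n]_j = N_{n + j}`. -/
def GrMod.shift (N : GrMod 𝒜) (n : ℤ) : GrMod 𝒜 where
  carrier := N.carrier
  piece j := N.piece (n + j)
  smul_mem {i j a m} ha hm := by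
    have := N.smul_mem ha hm
    rwa [add_left_comm] at this

instance instPrimeTop (x : ProjectiveSpectrum.top 𝒜) :
    (HomogeneousIdeal.toIdeal (ProjectiveSpectrum.asHomogeneousIdeal x)).IsPrime := x.isPrime

/-- The localization `N_x` at a homogeneous prime `x`; the stalk of the associated sheaf is its
degree zero part. -/
abbrev Stalk (N : GrMod 𝒜) (x : ProjectiveSpectrum.top 𝒜) : Type u :=
  LocalizedModule x.asHomogeneousIdeal.toIdeal.primeCompl N.carrier

/-- `f` is given on `U` by one fraction `m / s` with `m` and `s` homogeneous of the same degree. -/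
def IsFraction (N : GrMod 𝒜) {U : Opens (ProjectiveSpectrum.top 𝒜)}
    (f : ∀ x : U, Stalk N x.1) : Prop :=
  ∃ (i : ℕ) (m : N.carrier) (s : A), m ∈ N.piece i ∧ s ∈ 𝒜 i ∧
    ∀ x : U, ∃ hs : s ∉ x.1.asHomogeneousIdeal.toIdeal, f x = LocalizedModule.mk m ⟨s, hs⟩

/-- Being a fraction passes to smaller open sets. -/
def isFractionPrelocal (N : GrMod 𝒜) : PrelocalPredicate (Stalk N) where
  pred f := IsFraction N f
  res := by
    rintro V U i f ⟨d, m, s, hm, hs, w⟩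
    exact ⟨d, m, s, hm, hs, fun x => w (i x)⟩

/-- `f` is locally a fraction of degree zero. -/
def isLocallyFraction (N : GrMod 𝒜) : LocalPredicate (Stalk N) :=
  (isFractionPrelocal N).sheafify

/-- Sections over `U` of the associated sheaf: families in `∏ N_x` that are locally a fraction
`m / s` with `m` and `s` homogeneous of the same degree. -/
def sections (N : GrMod 𝒜) (U : (Opens (ProjectiveSpectrum.top 𝒜))ᵒᵖ) :
    AddSubgroup (∀ x : U.unop, Stalk N x.1) where
  carrier := {f | (isLocallyFraction N).pred f}
  zero_mem' x := ⟨U.unop, x.2, 𝟙 _, 0, 0, 1, zero_mem _, SetLike.GradedOne.one_mem, fun y ↦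
    ⟨(Ideal.ne_top_iff_one _).mp y.1.isPrime.ne_top, by simp⟩⟩
  add_mem' {a b} ha hb x := by
    obtain ⟨Va, ma, ia, da, ra, sa, hra, hsa, wa⟩ := ha x
    obtain ⟨Vb, mb, ib, db, rb, sb, hrb, hsb, wb⟩ := hb x
    refine ⟨Va ⊓ Vb, ⟨ma, mb⟩, Opens.infLELeft _ _ ≫ ia, da + db, sb • ra + sa • rb, sa * sb,
      add_mem ?_ ?_, SetLike.GradedMul.mul_mem hsa hsb, fun y ↦ ?_⟩
    · have := N.smul_mem hsb hra
      rw [add_comm] at this; exact_mod_cast this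
    · exact_mod_cast N.smul_mem hsa hrb
    · obtain ⟨hya, ea⟩ := wa ⟨y.1, y.2.1⟩
      obtain ⟨hyb, eb⟩ := wb ⟨y.1, y.2.2⟩
      exact ⟨y.1.asHomogeneousIdeal.toIdeal.primeCompl.mul_mem hya hyb,
        congr($ea + $eb).trans (LocalizedModule.mk_add_mk ..)⟩
  neg_mem' {a} ha x := by
    obtain ⟨Va, ma, ia, da, ra, sa, hra, hsa, wa⟩ := ha x
    refine ⟨Va, ma, ia, da, -ra, sa, neg_mem hra, hsa, fun y ↦ ?_⟩
    obtain ⟨hya, ea⟩ := wa y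
    exact ⟨hya, congr(-$ea).trans LocalizedModule.mk_neg.symm⟩

/-- The sheaf of sets underlying the associated sheaf. -/
def sheafInType (N : GrMod 𝒜) : TopCat.Sheaf (Type u) (ProjectiveSpectrum.top 𝒜) :=
  subsheafToTypes (isLocallyFraction N)

instance (N : GrMod 𝒜) (U : (Opens (ProjectiveSpectrum.top 𝒜))ᵒᵖ) :
    AddCommGroup ((sheafInType N).1.obj U) :=
  (sections N U).toAddCommGroup

open ProjectiveSpectrum.StructureSheaf in
instance (N : GrMod 𝒜) (U : (Opens (ProjectiveSpectrum.top 𝒜))ᵒᵖ) :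
    Module ((structureSheafInType 𝒜).1.obj U) ((sheafInType N).1.obj U) where
  smul r f := ⟨fun x ↦ (r.1 x).val • f.1 x, fun x ↦ by
    obtain ⟨V, mV, iV, d, ⟨a, ha⟩, ⟨s, hs⟩, hn, w⟩ := r.2 x
    obtain ⟨W, mW, iW, e, m, t, hm, ht, w'⟩ := f.2 x
    refine ⟨V ⊓ W, ⟨mV, mW⟩, Opens.infLELeft _ _ ≫ iV, d + e, a • m, s * t, ?_,
      SetLike.GradedMul.mul_mem hs ht, fun y ↦ ?_⟩
    · exact_mod_cast N.smul_mem ha hm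
    · obtain ⟨hy, e'⟩ := w' ⟨y.1, y.2.2⟩
      refine ⟨y.1.asHomogeneousIdeal.toIdeal.primeCompl.mul_mem (hn ⟨y.1, y.2.1⟩) hy, ?_⟩
      have e1 := congrArg HomogeneousLocalization.val (w ⟨y.1, y.2.1⟩)
      exact (congr($e1 • $e')).trans (LocalizedModule.mk_smul_mk ..)⟩
  one_smul f := Subtype.ext <| funext fun x ↦ by
    exact (congrArg (· • f.1 x) HomogeneousLocalization.val_one).trans (one_smul _ _)
  mul_smul r s f := Subtype.ext <| funext fun x ↦ by
    exact (congrArg (· • f.1 x) (HomogeneousLocalization.val_mul _ _)).trans (mul_smul _ _ _)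
  smul_zero r := Subtype.ext <| funext fun x ↦ smul_zero _
  smul_add r f g := Subtype.ext <| funext fun x ↦ smul_add _ _ _
  add_smul r s f := Subtype.ext <| funext fun x ↦ by
    exact (congrArg (· • f.1 x) (HomogeneousLocalization.val_add _ _)).trans (add_smul _ _ _)
  zero_smul f := Subtype.ext <| funext fun x ↦ by
    exact (congrArg (· • f.1 x) HomogeneousLocalization.val_zero).trans (zero_smul _ _)

/-- The presheaf of abelian groups underlying the associated sheaf. -/
def presheafInAb (N : GrMod 𝒜) : TopCat.Presheaf Ab (ProjectiveSpectrum.top 𝒜) where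
  obj U := AddCommGrpCat.of ((sheafInType N).1.obj U)
  map i := AddCommGrpCat.ofHom
    { toFun := (sheafInType N).1.map i
      map_zero' := rfl
      map_add' _ _ := rfl }

open ProjectiveSpectrum.StructureSheaf in
/-- The associated presheaf of modules over the structure presheaf of `Proj 𝒜`. -/
def presheafOfModules (N : GrMod 𝒜) :
    PresheafOfModules (structurePresheafInCommRing 𝒜 ⋙ forget₂ CommRingCat RingCat) :=
  letI (W : (Opens (ProjectiveSpectrum.top 𝒜))ᵒᵖ) :
    Module ↑((structurePresheafInCommRing 𝒜 ⋙ forget₂ CommRingCat RingCat).obj W)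
      ↑((presheafInAb N).obj W) :=
    inferInstanceAs (Module ((structureSheafInType 𝒜).1.obj W) ((sheafInType N).1.obj W))
  .ofPresheaf (presheafInAb N) fun _ _ _ _ _ ↦ rfl

/-- The sheaf of `𝒪`-modules on `Proj 𝒜` associated to a graded module. -/
def assocSheaf (N : GrMod 𝒜) : (Proj 𝒜).Modules where
  val := presheafOfModules N
  isSheaf := (TopCat.Presheaf.isSheaf_iff_isSheaf_comp (forget AddCommGrpCat) _).2
    (sheafInType N).2


/-- The map of associated sheaves induced by a degree zero homomorphism, stalkwise its
localization. -/
def assocMap {N N' : GrMod 𝒜} (φ : GrHom N N') : assocSheaf N ⟶ assocSheaf N' where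
  val := PresheafOfModules.homMk (M₁ := presheafOfModules N) (M₂ := presheafOfModules N')
    { app U := AddCommGrpCat.ofHom
        { toFun f := ⟨fun x ↦ LocalizedModule.map _ φ.lin (f.1 x), fun x ↦ by
            obtain ⟨V, mV, iV, d, m, s, hm, hs, w⟩ := f.2 x
            refine ⟨V, mV, iV, d, φ.lin m, s, φ.map_mem hm, hs, fun y ↦ ?_⟩
            obtain ⟨hy, e⟩ := w y
            exact ⟨hy, (congrArg _ e).trans (LocalizedModule.map_mk ..)⟩⟩
          map_zero' := Subtype.ext <| funext fun x ↦ map_zero _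
          map_add' _ _ := Subtype.ext <| funext fun x ↦ map_add _ _ _ }
      naturality _ _ _ := rfl }
    fun _ r f ↦ Subtype.ext <| funext fun x ↦
      (LocalizedModule.map x.1.asHomogeneousIdeal.toIdeal.primeCompl φ.lin).map_smul
        (r.1 x).val (f.1 x)

/-- The grading of `A` extended to `ℤ` by zero in negative degrees. -/
def intPiece (𝒜 : ℕ → Submodule k A) : ℤ → Submodule k A
  | Int.ofNat n => 𝒜 n
  | Int.negSucc _ => ⊥

lemma intPiece_smul_mem {i : ℕ} {j : ℤ} {a b : A} (ha : a ∈ 𝒜 i) (hb : b ∈ intPiece 𝒜 j) :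
    a * b ∈ intPiece 𝒜 (i + j) := by
  cases j with
  | ofNat n => exact SetLike.GradedMul.mul_mem (A := 𝒜) ha (show b ∈ 𝒜 n from hb)
  | negSucc n =>
    obtain rfl : b = 0 := hb
    rw [mul_zero]; exact zero_mem _

variable (𝒜) in
/-- `A` as a graded module over itself. -/
def GrMod.self : GrMod 𝒜 where
  carrier := A
  piece j := (intPiece 𝒜 j).toAddSubgroup
  smul_mem ha hb := intPiece_smul_mem ha hb

open TensorProduct in
variable (𝒜) in
/-- The graded module `A ⊗ V`, with `V` in degree zero. -/
def GrMod.free (V : Type u) [AddCommGroup V] [Module k V] : GrMod 𝒜 where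
  carrier := A ⊗[k] V
  piece j := (LinearMap.range ((intPiece 𝒜 j).subtype.rTensor V)).toAddSubgroup
  smul_mem {i j a m} ha hm := by
    obtain ⟨t, rfl⟩ := hm
    induction t with
    | zero => rw [map_zero, smul_zero]; exact zero_mem _
    | add t t' h h' => rw [map_add, smul_add]; exact add_mem h h'
    | tmul b v =>
      exact ⟨(⟨a * b.1, intPiece_smul_mem ha b.2⟩ : intPiece 𝒜 (i + j)) ⊗ₜ v, rfl⟩

variable (𝒜) in
/-- The twisting sheaf `𝒪(n)`, the sheaf associated to `A[n]`. -/
def twistingSheaf (n : ℤ) : (Proj 𝒜).Modules := assocSheaf ((GrMod.self 𝒜).shift n)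

/-- The tensor product of two sheaves of `𝒪_X`-modules: the sheafification of
`U ↦ F(U) ⊗ G(U)`. -/
def tensorSheaf {X : Scheme.{u}} (F G : X.Modules) : X.Modules :=
  (PresheafOfModules.sheafification (𝟙 X.ringCatSheaf.obj)).obj
    (PresheafOfModules.Monoidal.tensorObj (R := X.presheaf) F.val G.val)

/-- The twist `F(n) = F ⊗ 𝒪(n)`. -/
def twist (F : (Proj 𝒜).Modules) (n : ℤ) : (Proj 𝒜).Modules := tensorSheaf F (twistingSheaf 𝒜 n)

end ProjModule


namespace ProjMap
open HomogeneousLocalization ProjectiveSpectrum.StructureSheaf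

variable {k A B : Type u} [Field k] [CommRing A] [Algebra k A] [CommRing B] [Algebra k B]
  {𝒜 : ℕ → Submodule k A} {ℬ : ℕ → Submodule k B} [GradedAlgebra 𝒜] [GradedAlgebra ℬ]
  {d : ℕ} (hd : 0 < d) (g : A →ₐ[k] B) (hg : ∀ (i : ℕ) (a : A), a ∈ 𝒜 i → g a ∈ ℬ (d * i))
  (hirr : (HomogeneousIdeal.irrelevant ℬ).toIdeal ≤
    ((HomogeneousIdeal.irrelevant 𝒜).toIdeal.map g).radical)

lemma comap_isHomogeneous {k A B : Type u} [Field k] [CommRing A] [Algebra k A] [CommRing B]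
    [Algebra k B] {𝒜 : ℕ → Submodule k A} {ℬ : ℕ → Submodule k B} [GradedAlgebra 𝒜]
    [GradedAlgebra ℬ] {d : ℕ} (hd : 0 < d) (g : A →ₐ[k] B)
    (hg : ∀ (i : ℕ) (a : A), a ∈ 𝒜 i → g a ∈ ℬ (d * i)) (I : HomogeneousIdeal ℬ) :
    (I.toIdeal.comap g).IsHomogeneous 𝒜 := by
  intro n a ha
  rw [Ideal.mem_comap] at ha ⊢
  have h1 := I.isHomogeneous (d * n) ha
  convert h1 using 1
  classical
  conv_rhs => rw [← DirectSum.sum_support_decompose 𝒜 a]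
  rw [map_sum, DirectSum.decompose_sum, DFinsupp.finsetSum_apply, AddSubmonoidClass.coe_finsetSum]
  rw [Finset.sum_eq_single n]
  · exact (DirectSum.decompose_of_mem_same ℬ (hg _ _ (SetLike.coe_mem _))).symm
  · intro i _ hi
    exact DirectSum.decompose_of_mem_ne ℬ (hg _ _ (SetLike.coe_mem _))
      fun h ↦ hi (Nat.eq_of_mul_eq_mul_left hd h)
  · intro hn
    rw [DFinsupp.notMem_support_iff.mp hn]
    simp

/-- The point `g⁻¹(p)` of `Proj 𝒜`. -/
def point (p : ProjectiveSpectrum ℬ) : ProjectiveSpectrum 𝒜 where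
  asHomogeneousIdeal :=
    { __ := p.asHomogeneousIdeal.toIdeal.comap g
      is_homogeneous' := comap_isHomogeneous hd g hg _ }
  isPrime := p.isPrime.comap g
  not_irrelevant_le le := p.not_irrelevant_le <| hirr.trans <|
    p.isPrime.radical_le_iff.mpr <| Ideal.map_le_iff_le_comap.mpr le

lemma point_toIdeal (p : ProjectiveSpectrum ℬ) :
    (point hd g hg hirr p).asHomogeneousIdeal.toIdeal =
      p.asHomogeneousIdeal.toIdeal.comap g.toRingHom := rfl

/-- The map on points `p ↦ g⁻¹(p)`. -/
def pointMap : C(ProjectiveSpectrum ℬ, ProjectiveSpectrum 𝒜) where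
  toFun := point hd g hg hirr
  continuous_toFun := by
    refine continuous_iff_isClosed.mpr fun Z hZ ↦ ?_
    obtain ⟨s, rfl⟩ := (ProjectiveSpectrum.isClosed_iff_zeroLocus 𝒜 Z).mp hZ
    refine (ProjectiveSpectrum.isClosed_iff_zeroLocus ℬ _).mpr ⟨g '' s, Set.ext fun p ↦ ?_⟩
    exact (Set.image_subset_iff (f := g) (s := s) (t := (p.asHomogeneousIdeal : Set B))).symm

instance instPrime (p : ProjectiveSpectrum ℬ) : p.asHomogeneousIdeal.toIdeal.IsPrime := p.isPrime

/-- The map of local rings `A_{g⁻¹(p)} → B_p`. -/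
abbrev locHom (p : ProjectiveSpectrum ℬ) :=
  Localization.localRingHom (point hd g hg hirr p).asHomogeneousIdeal.toIdeal
    p.asHomogeneousIdeal.toIdeal g.toRingHom (point_toIdeal hd g hg hirr p)

/-- The map `a / s ↦ g(a) / g(s)` on degree zero parts of the localizations. -/
def localFun (p : ProjectiveSpectrum ℬ)
    (x : AtPrime 𝒜 (point hd g hg hirr p).asHomogeneousIdeal.toIdeal) :
      AtPrime ℬ p.asHomogeneousIdeal.toIdeal :=
  Quotient.map'
    (fun x ↦ ⟨d * x.1, ⟨_, hg _ _ x.2.2⟩, ⟨_, hg _ _ x.3.2⟩, x.4⟩)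
    (fun x y (e : x.embedding = y.embedding) ↦ by
      have e' := congrArg (locHom hd g hg hirr p) e
      simp only [NumDenSameDeg.embedding] at e'
      rw [Localization.localRingHom_mk, Localization.localRingHom_mk] at e'
      exact e') x

lemma val_localFun (p : ProjectiveSpectrum ℬ)
    (x : AtPrime 𝒜 (point hd g hg hirr p).asHomogeneousIdeal.toIdeal) :
    (localFun hd g hg hirr p x).val = locHom hd g hg hirr p x.val := by
  obtain ⟨c, rfl⟩ := x.mk_surjective
  rw [val_mk, Localization.localRingHom_mk]
  rfl

/-- The map `a / s ↦ g(a) / g(s)` as a ring homomorphism. -/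
def localMap (p : ProjectiveSpectrum ℬ) :
    AtPrime 𝒜 (point hd g hg hirr p).asHomogeneousIdeal.toIdeal →+*
      AtPrime ℬ p.asHomogeneousIdeal.toIdeal where
  toFun := localFun hd g hg hirr p
  map_add' x y := val_injective _ (by simp [val_localFun])
  map_mul' x y := val_injective _ (by simp [val_localFun])
  map_zero' := val_injective _ (by simp [val_localFun])
  map_one' := val_injective _ (by simp [val_localFun])

lemma isUnit_of_isUnit_localMap (p : ProjectiveSpectrum ℬ)
    (x : AtPrime 𝒜 (point hd g hg hirr p).asHomogeneousIdeal.toIdeal)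
    (hx : IsUnit (localMap hd g hg hirr p x)) : IsUnit x := by
  rw [← isUnit_iff_isUnit_val] at hx ⊢
  have h2 : IsUnit (locHom hd g hg hirr p x.val) := by
    rw [← val_localFun]; exact hx
  have := Localization.isLocalHom_localRingHom _ _ g.toRingHom (point_toIdeal hd g hg hirr p)
  exact this.map_nonunit _ h2

/-- The comorphism on sections of the structure sheaves. -/
def sectionMap (U : Opens (ProjectiveSpectrum.top 𝒜)) (V : Opens (ProjectiveSpectrum.top ℬ))
    (hUV : V.1 ⊆ pointMap hd g hg hirr ⁻¹' U.1) :
    (ProjectiveSpectrum.Proj.structureSheaf 𝒜).1.obj (.op U) →+*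
      (ProjectiveSpectrum.Proj.structureSheaf ℬ).1.obj (.op V) where
  toFun s := ⟨fun y ↦ localMap hd g hg hirr y.1 (s.1 ⟨pointMap hd g hg hirr y.1, hUV y.2⟩), by
    rintro ⟨p, hpV⟩
    rcases s.2 ⟨pointMap hd g hg hirr p, hUV hpV⟩ with ⟨W, m, iWU, i, a, b, hb, h_frac⟩
    refine ⟨W.comap (pointMap hd g hg hirr) ⊓ V, ⟨m, hpV⟩, Opens.infLERight _ _, d * i,
      ⟨_, hg _ _ a.2⟩, ⟨_, hg _ _ b.2⟩, fun ⟨q, ⟨hqW, hqV⟩⟩ ↦ hb ⟨_, hqW⟩,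
      fun ⟨q, ⟨hqW, hqV⟩⟩ ↦ ?_⟩
    exact congrArg (localMap hd g hg hirr q) (h_frac ⟨_, hqW⟩)⟩
  map_one' := Subtype.ext <| funext fun y ↦ map_one (localMap hd g hg hirr y.1)
  map_zero' := Subtype.ext <| funext fun y ↦ map_zero (localMap hd g hg hirr y.1)
  map_add' s t := Subtype.ext <| funext fun y ↦ map_add (localMap hd g hg hirr y.1) _ _
  map_mul' s t := Subtype.ext <| funext fun y ↦ map_mul (localMap hd g hg hirr y.1) _ _

/-- The morphism of presheafed spaces. -/
def presheafedMap : (Proj.toSheafedSpace ℬ).toPresheafedSpace ⟶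
    (Proj.toSheafedSpace 𝒜).toPresheafedSpace where
  base := TopCat.ofHom (pointMap hd g hg hirr)
  c := { app U := CommRingCat.ofHom (R := (ProjectiveSpectrum.Proj.structureSheaf 𝒜).1.obj U)
           (S := (ProjectiveSpectrum.Proj.structureSheaf ℬ).1.obj
             (op (U.unop.comap (pointMap hd g hg hirr))))
           (sectionMap hd g hg hirr U.unop _ Set.Subset.rfl)
         naturality _ _ _ := rfl }

lemma stalkMap_spec (p : ProjectiveSpectrum.top ℬ)
    (x : (ProjectiveSpectrum.Proj.structureSheaf 𝒜).presheaf.stalk (pointMap hd g hg hirr p)) :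
    Proj.stalkIso' ℬ p (((presheafedMap hd g hg hirr).stalkMap p).hom x) =
      localMap hd g hg hirr p (Proj.stalkIso' 𝒜 (pointMap hd g hg hirr p) x) := by
  obtain ⟨U, hU, s, rfl⟩ :=
    (ProjectiveSpectrum.Proj.structureSheaf 𝒜).presheaf.exists_germ_eq x
  have h1 := congr($(PresheafedSpace.stalkMap_germ (presheafedMap hd g hg hirr) U p hU) s)
  refine (congrArg (Proj.stalkIso' ℬ p) h1).trans ?_
  exact (Proj.stalkIso'_germ ℬ _ p hU _).trans
    (congrArg (localMap hd g hg hirr p) (Proj.stalkIso'_germ 𝒜 U _ hU s)).symm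

/-- The morphism `Proj ℬ ⟶ Proj 𝒜` induced by a ring homomorphism `g : A → B` that multiplies
degrees by `d > 0`, provided that the radical of the ideal generated by `g(A₊)` contains `B₊`.
On points it is `p ↦ g⁻¹(p)`, on functions it is `a / s ↦ g(a) / g(s)`. -/
def map : Proj ℬ ⟶ Proj 𝒜 where
  __ := presheafedMap hd g hg hirr
  prop p := .mk fun x hx ↦ by
    have h1 := stalkMap_spec hd g hg hirr p x
    have h2 : IsUnit (Proj.stalkIso' ℬ p (((presheafedMap hd g hg hirr).stalkMap p).hom x)) :=
      IsUnit.map (Proj.stalkIso' ℬ p) hx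
    rw [h1] at h2
    have h3 := isUnit_of_isUnit_localMap hd g hg hirr p _ h2
    exact (MulEquiv.isUnit_map (Proj.stalkIso' 𝒜 (pointMap hd g hg hirr p))).mp h3

end ProjMap

namespace Sl2
open MvPolynomial TensorProduct ProjModule

variable (k : Type u) [Field k]

/-- The coordinate ring `k[x, y, z] / (x y + z²)` of the nullcone of `sl₂`, where `x, y, z` are the
coordinates dual to `e, f, h`. -/
abbrev NullconeRing := MvPolynomial (Fin 3) k ⧸
  Ideal.span {(X 0 * X 1 + X 2 ^ 2 : MvPolynomial (Fin 3) k)}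

/-- The quotient map `k[x, y, z] → k[x, y, z] / (x y + z²)`. -/
abbrev nullconeMk : MvPolynomial (Fin 3) k →ₐ[k] NullconeRing k := Ideal.Quotient.mkₐ k _

/-- The grading of the coordinate ring of the nullcone with `x, y, z` in degree one. -/
def nullconeGrading (i : ℕ) : Submodule k (NullconeRing k) :=
  (homogeneousSubmodule (Fin 3) k i).map (nullconeMk k).toLinearMap

section
attribute [local instance] MvPolynomial.gradedAlgebra

instance : SetLike.GradedMonoid (nullconeGrading k) where
  one_mem := ⟨1, SetLike.GradedOne.one_mem, map_one (nullconeMk k)⟩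
  mul_mem := by
    rintro i j _ _ ⟨a, ha, rfl⟩ ⟨b, hb, rfl⟩
    exact ⟨a * b, SetLike.GradedMul.mul_mem ha hb, map_mul (nullconeMk k) _ _⟩

/-- The quotient map on homogeneous pieces. -/
def nullconePiece (i : ℕ) : homogeneousSubmodule (Fin 3) k i →ₗ[k] nullconeGrading k i :=
  (nullconeMk k).toLinearMap.submoduleMap _

/-- The direct sum of the quotient maps on homogeneous pieces. -/
def nullconeDirectSumMap : (DirectSum ℕ fun i ↦ homogeneousSubmodule (Fin 3) k i) →ₐ[k]
    DirectSum ℕ fun i ↦ nullconeGrading k i :=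
  DirectSum.toAlgebra k (fun i ↦ homogeneousSubmodule (Fin 3) k i)
    (fun i ↦ (DirectSum.lof k ℕ (fun i ↦ nullconeGrading k i) i).comp (nullconePiece k i))
    rfl (fun {i j} a b ↦ by
      refine Eq.trans ?_ (DirectSum.of_mul_of _ _).symm
      exact congrArg (DirectSum.of (fun i ↦ nullconeGrading k i) (i + j))
        (Subtype.ext (map_mul (nullconeMk k) _ _)))

lemma nullconeDirectSumMap_of (i : ℕ) (q : homogeneousSubmodule (Fin 3) k i) :
    nullconeDirectSumMap k (DirectSum.of (fun i ↦ homogeneousSubmodule (Fin 3) k i) i q) =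
      DirectSum.of (fun i ↦ nullconeGrading k i) i (nullconePiece k i q) :=
  DirectSum.toAddMonoid_of (fun i ↦
    ((DirectSum.lof k ℕ (fun i ↦ nullconeGrading k i) i).comp (nullconePiece k i)).toAddMonoidHom)
    i q

/-- The decomposition into homogeneous components, on polynomials. -/
def nullconeDecomposeAux : MvPolynomial (Fin 3) k →ₐ[k] DirectSum ℕ fun i ↦ nullconeGrading k i :=
  (nullconeDirectSumMap k).comp
    (DirectSum.decomposeAlgEquiv (homogeneousSubmodule (Fin 3) k)).toAlgHom

lemma nullconeDecomposeAux_apply {i : ℕ} {q : MvPolynomial (Fin 3) k}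
    (hq : q ∈ homogeneousSubmodule (Fin 3) k i) :
    nullconeDecomposeAux k q =
      DirectSum.of (fun i ↦ nullconeGrading k i) i ⟨nullconeMk k q, q, hq, rfl⟩ := by
  have h : DirectSum.decompose (homogeneousSubmodule (Fin 3) k) q =
      DirectSum.of (fun i ↦ homogeneousSubmodule (Fin 3) k i) i ⟨q, hq⟩ :=
    DirectSum.decompose_of_mem _ hq
  exact (congrArg (nullconeDirectSumMap k) h).trans (nullconeDirectSumMap_of k i ⟨q, hq⟩)

lemma nullcone_relation_mem : (X 0 * X 1 + X 2 ^ 2 : MvPolynomial (Fin 3) k) ∈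
    homogeneousSubmodule (Fin 3) k 2 :=
  ((isHomogeneous_X k 0).mul (isHomogeneous_X k 1)).add ((isHomogeneous_X k 2).pow 2)

/-- The decomposition into homogeneous components. -/
def nullconeDecompose : NullconeRing k →ₐ[k] DirectSum ℕ fun i ↦ nullconeGrading k i :=
  Ideal.Quotient.liftₐ _ (nullconeDecomposeAux k) fun a ha ↦ by
    have : Ideal.span {(X 0 * X 1 + X 2 ^ 2 : MvPolynomial (Fin 3) k)} ≤
        RingHom.ker (nullconeDecomposeAux k) := by
      rw [Ideal.span_singleton_le_iff_mem, RingHom.mem_ker,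
        nullconeDecomposeAux_apply k (nullcone_relation_mem k)]
      refine Eq.trans (congrArg _ ?_) (map_zero (DirectSum.of (fun i ↦ nullconeGrading k i) 2))
      exact Subtype.ext (Ideal.Quotient.eq_zero_iff_mem.mpr (Ideal.mem_span_singleton_self _))
    exact this ha

instance : GradedAlgebra (nullconeGrading k) :=
  GradedAlgebra.ofAlgHom _ (nullconeDecompose k)
    (by
      apply Ideal.Quotient.algHom_ext
      ext i
      change DirectSum.coeAlgHom _ (nullconeDecomposeAux k (X i)) = nullconeMk k (X i)
      rw [nullconeDecomposeAux_apply k (isHomogeneous_X k i), DirectSum.coeAlgHom_of])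
    (by
      rintro i ⟨_, q, hq, rfl⟩
      exact nullconeDecomposeAux_apply k hq)

end

/-- The standard grading of `k[s, t]`. -/
def lineGrading (i : ℕ) : Submodule k (MvPolynomial (Fin 2) k) := homogeneousSubmodule (Fin 2) k i

instance : GradedAlgebra (lineGrading k) := MvPolynomial.gradedAlgebra

/-- The projective line `Proj k[s, t]`. -/
abbrev P1 : Scheme.{u} := Proj (lineGrading k)
/-- The projectivized nullcone of `sl₂`, the scheme `Proj k[x, y, z] / (x y + z²)`. -/
abbrev PNull : Scheme.{u} := Proj (nullconeGrading k)

/-- The homomorphism `(x, y, z) ↦ (s², -t², s t)`. -/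
def iotaRing : NullconeRing k →ₐ[k] MvPolynomial (Fin 2) k :=
  Ideal.Quotient.liftₐ _ (aeval ![X 0 ^ 2, -X 1 ^ 2, X 0 * X 1]) fun a ha ↦ by
    have : Ideal.span {(X 0 * X 1 + X 2 ^ 2 : MvPolynomial (Fin 3) k)} ≤
        RingHom.ker (aeval (R := k) ![(X 0 ^ 2 : MvPolynomial (Fin 2) k), -X 1 ^ 2, X 0 * X 1]) := by
      rw [Ideal.span_singleton_le_iff_mem, RingHom.mem_ker]
      simp; ring
    exact this ha

lemma iotaRing_mem (i : ℕ) (a : NullconeRing k) (ha : a ∈ nullconeGrading k i) :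
    iotaRing k a ∈ lineGrading k (2 * i) := by
  obtain ⟨q, hq, rfl⟩ := ha
  change aeval (R := k) ![(X 0 ^ 2 : MvPolynomial (Fin 2) k), -X 1 ^ 2, X 0 * X 1] q ∈ _
  refine IsHomogeneous.aeval (n := 2) hq _ fun j ↦ ?_
  fin_cases j
  · exact (isHomogeneous_X k 0).pow 2
  · exact ((isHomogeneous_X k 1).pow 2).neg
  · exact (isHomogeneous_X k 0).mul (isHomogeneous_X k 1)

lemma irrelevant_le : (HomogeneousIdeal.irrelevant (lineGrading k)).toIdeal ≤
    ((HomogeneousIdeal.irrelevant (nullconeGrading k)).toIdeal.map (iotaRing k)).radical := by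
  have hX (i : Fin 2) : (X i : MvPolynomial (Fin 2) k) ∈
      ((HomogeneousIdeal.irrelevant (nullconeGrading k)).toIdeal.map (iotaRing k)).radical := by
    have key (j : Fin 3) : iotaRing k (nullconeMk k (X j)) ∈
        (HomogeneousIdeal.irrelevant (nullconeGrading k)).toIdeal.map (iotaRing k) := by
      refine Ideal.mem_map_of_mem _ ?_
      refine (HomogeneousIdeal.mem_irrelevant_iff _ _).mpr ?_
      rw [GradedRing.proj_apply]
      exact DirectSum.decompose_of_mem_ne (nullconeGrading k) (i := 1) (j := 0)
        ⟨X j, isHomogeneous_X k j, rfl⟩ one_ne_zero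
    fin_cases i
    · refine ⟨2, ?_⟩
      have h0 := key 0
      have : iotaRing k (nullconeMk k (X 0)) = X 0 ^ 2 := by
        change aeval (R := k) ![(X 0 ^ 2 : MvPolynomial (Fin 2) k), -X 1 ^ 2, X 0 * X 1] (X 0) = _
        simp
      rwa [this] at h0
    · refine ⟨2, ?_⟩
      have h0 := key 1
      have : iotaRing k (nullconeMk k (X 1)) = -X 1 ^ 2 := by
        change aeval (R := k) ![(X 0 ^ 2 : MvPolynomial (Fin 2) k), -X 1 ^ 2, X 0 * X 1] (X 1) = _
        simp
      rw [this] at h0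
      exact neg_mem_iff.mp h0
  intro q hq
  have hq0 : coeff 0 q = 0 := by
    have h1 := (HomogeneousIdeal.mem_irrelevant_iff _ _).mp hq
    rw [GradedRing.proj_apply] at h1
    have h2 : homogeneousComponent 0 q = 0 :=
      (decomposition.decompose'_apply q 0).symm.trans h1
    rw [homogeneousComponent_zero] at h2
    exact C_eq_zero.mp h2
  have hspan : q ∈ Ideal.span (X '' (Set.univ : Set (Fin 2))) := by
    refine mem_ideal_span_X_image.mpr fun m hm ↦ ?_
    by_contra! hcon
    have : m = 0 := Finsupp.ext fun i ↦ hcon i (Set.mem_univ i)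
    subst this
    exact (mem_support_iff.mp hm) hq0
  refine Ideal.span_le.mpr ?_ hspan
  rintro _ ⟨i, -, rfl⟩
  exact hX i

/-- The morphism `ι : ℙ¹ ⟶ ℙ(sl₂)`, `[s : t] ↦ [s² : -t² : s t]`. -/
def iota : P1 k ⟶ PNull k :=
  ProjMap.map two_pos (iotaRing k) (iotaRing_mem k) (irrelevant_le k)

/-- The Lie algebra `sl₂` of trace zero matrices. -/
abbrev sl2 := LieAlgebra.SpecialLinear.sl (Fin 2) k

/-- The basis element `e`. -/
def sl2E : sl2 k :=
  ⟨!![0, 1; 0, 0], by simp [LieAlgebra.SpecialLinear.sl, Matrix.trace_fin_two]⟩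

/-- The basis element `f`. -/
def sl2F : sl2 k :=
  ⟨!![0, 0; 1, 0], by simp [LieAlgebra.SpecialLinear.sl, Matrix.trace_fin_two]⟩

/-- The basis element `h`. -/
def sl2H : sl2 k :=
  ⟨!![1, 0; 0, -1], by simp [LieAlgebra.SpecialLinear.sl, Matrix.trace_fin_two]⟩

/-- The relations `x ^ p = x^{[p]}` in the universal enveloping algebra of `sl₂`, where `x^{[p]}`
is the `p`-th power of the matrix `x`. -/
inductive RestrictedRel (p : ℕ) :
    UniversalEnvelopingAlgebra k (sl2 k) → UniversalEnvelopingAlgebra k (sl2 k) → Prop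
  | pow (x y : sl2 k)
      (hxy : (y : Matrix (Fin 2) (Fin 2) k) = (x : Matrix (Fin 2) (Fin 2) k) ^ p) :
      RestrictedRel p (UniversalEnvelopingAlgebra.ι k x ^ p) (UniversalEnvelopingAlgebra.ι k y)

/-- The restricted enveloping algebra `u(sl₂)`. Its modules are the restricted
representations of `sl₂`. -/
abbrev RestrictedEnveloping (p : ℕ) := RingQuot (RestrictedRel k p)

/-- The canonical map `sl₂ → u(sl₂)`. -/
def toRestricted (p : ℕ) (x : sl2 k) : RestrictedEnveloping k p :=
  RingQuot.mkAlgHom k (RestrictedRel k p) (UniversalEnvelopingAlgebra.ι k x)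

/-- `φ : P → M` is a projective cover: `P` is projective, and `φ` is surjective with superfluous
kernel. The Heller shift `Ω M` is the kernel of a projective cover of `M`. -/
structure IsProjectiveCover {R P M : Type*} [Ring R] [AddCommGroup P] [Module R P]
    [AddCommGroup M] [Module R M] (φ : P →ₗ[R] M) : Prop where
  projective : Module.Projective R P
  surjective : Function.Surjective φ
  superfluous : ∀ N : Submodule R P, N ⊔ LinearMap.ker φ = ⊤ → N = ⊤

section
variable (p : ℕ) (M : Type u) [AddCommGroup M] [Module k M] [Module (RestrictedEnveloping k p) M]
  [IsScalarTower k (RestrictedEnveloping k p) M]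

/-- The action of an element of `sl₂` on the module `M`. -/
def act (x : sl2 k) : M →ₗ[k] M := Algebra.lsmul k k M (toRestricted k p x)

/-- The operator `Θ = x ⊗ e + y ⊗ f + z ⊗ h` on `k[x, y, z] / (x y + z²) ⊗ M`. -/
def theta : NullconeRing k ⊗[k] M →ₗ[NullconeRing k] NullconeRing k ⊗[k] M :=
  nullconeMk k (X 0) • (act k p M (sl2E k)).baseChange (NullconeRing k) +
  nullconeMk k (X 1) • (act k p M (sl2F k)).baseChange (NullconeRing k) +
  nullconeMk k (X 2) • (act k p M (sl2H k)).baseChange (NullconeRing k)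

lemma smul_baseChange_mem (φ : M →ₗ[k] M) (i : Fin 3) {j : ℤ} {m : NullconeRing k ⊗[k] M}
    (hm : m ∈ (GrMod.free (nullconeGrading k) M).piece j) :
    nullconeMk k (X i) • φ.baseChange (NullconeRing k) m ∈
      (GrMod.free (nullconeGrading k) M).piece (1 + j) := by
  refine (GrMod.free (nullconeGrading k) M).smul_mem (i := 1)
    ⟨X i, isHomogeneous_X k i, rfl⟩ ?_
  obtain ⟨t, rfl⟩ := hm
  exact ⟨φ.lTensor _ t, by
    change (LinearMap.rTensor M _ ∘ₗ LinearMap.lTensor _ φ) t =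
      (LinearMap.lTensor _ φ ∘ₗ LinearMap.rTensor M _) t
    rw [LinearMap.rTensor_comp_lTensor, LinearMap.lTensor_comp_rTensor]⟩

lemma theta_mem {j : ℤ} {m : NullconeRing k ⊗[k] M}
    (hm : m ∈ (GrMod.free (nullconeGrading k) M).piece j) :
    theta k p M m ∈ (GrMod.free (nullconeGrading k) M).piece (1 + j) :=
  add_mem (add_mem (smul_baseChange_mem k M _ 0 hm) (smul_baseChange_mem k M _ 1 hm))
    (smul_baseChange_mem k M _ 2 hm)

/-- The sheaf `M̃(n)` on `ℙ(sl₂)`, where `M̃ = 𝒪 ⊗ M`. -/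
def tildeTwist (n : ℤ) : (PNull k).Modules :=
  assocSheaf ((GrMod.free (nullconeGrading k) M).shift n)

/-- The twist `Θ_M(n) : M̃(n) ⟶ M̃(n + 1)` of the global operator. -/
def globalOp (n n' : ℤ) (hn : n' = n + 1) : tildeTwist k M n ⟶ tildeTwist k M n' :=
  assocMap
    { lin := theta k p M
      map_mem := fun {j} {_} hm ↦ by
        subst hn
        have := theta_mem k p M hm
        rwa [show 1 + (n + j) = n + 1 + j by ring] at this }

/-- The composite `Θ_M(-1) ∘ ⋯ ∘ Θ_M(-j) : M̃(-j) ⟶ M̃`. -/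
def globalOpPow : ∀ j : ℕ, tildeTwist k M (-(j : ℤ)) ⟶ tildeTwist k M 0
  | 0 => 𝟙 _
  | j + 1 => globalOp k p M (-((j + 1 : ℕ) : ℤ)) (-(j : ℤ)) (by push_cast; ring) ≫ globalOpPow j

/-- The subsheaf `ker Θ_M` of `M̃`. -/
def kerTheta : Subobject (tildeTwist k M 0) :=
  Limits.kernelSubobject (globalOp k p M 0 1 rfl)

/-- The subsheaf `im Θ_M^j` of `M̃`. -/
def imTheta (j : ℕ) : Subobject (tildeTwist k M 0) :=
  Limits.imageSubobject (globalOpPow k p M j)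

lemma imTheta_le (i : ℕ) : imTheta k p M i ≤ imTheta k p M (i - 1) := by
  cases i with
  | zero => exact le_rfl
  | succ j => exact Limits.imageSubobject_comp_le _ _

/-- The sheaf `ℱ_i(M) = (ker Θ_M ∩ im Θ_M^{i-1}) / (ker Θ_M ∩ im Θ_M^i)` on `ℙ(sl₂)`. -/
def sheafF (i : ℕ) : (PNull k).Modules :=
  Limits.cokernel (Subobject.ofLE (kerTheta k p M ⊓ imTheta k p M i)
    (kerTheta k p M ⊓ imTheta k p M (i - 1)) (inf_le_inf_left _ (imTheta_le k p M i)))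

/-- The sheaf `ℱ_i(M)` regarded on `ℙ¹` through `ι`. -/
def sheafFP1 (i : ℕ) : (P1 k).Modules :=
  (Scheme.Modules.pullback (iota k)).obj (sheafF k p M i)

end

end Sl2

end

end

/-!
The sheaves `ℱ_i` measure the Jordan blocks of size `i` of `Θ`. On `A ⊗ P`, for `P` projective, all
Jordan blocks of `Θ` have size `p` locally on `Proj A`, so that in the exact sequence
`0 → A ⊗ Ω M → A ⊗ P → A ⊗ M → 0` a block of size `i` of `A ⊗ M` is matched with one of size `p - i`
of `A ⊗ Ω M`. Explicitly, let `v` in `A ⊗ P` lift `m` in `A ⊗ M` with `Θ^i m = 0`. Then `Θ^i v` lies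
in `A ⊗ Ω M`, and `Θ^{i-1} m ↦ Θ^{p-1} v = Θ^{p-i-1} (Θ^i v)` is a well defined map from the
subquotient for `M` to the one for `Ω M`, which raises degrees by `p - i`
(`NilpotentExtension.exists_hom`). It is an isomorphism of associated sheaves as soon as, locally,
`ker Θ^j = im Θ^{p-j}` on `A ⊗ P` for all `j ≤ p` (`NilpotentExtension.nonempty_iso`).

This local exactness is `exists_smul_mem_range_theta`. At a point of `Proj A` one of `x`, `y` is
invertible, and over the local ring the matrix `x e + y f + z h` is a unit times a conjugate of `e`.
Conjugation acts on `C ⊗ u(sl₂)` for every commutative `k`-algebra `C` (`conj`), because `p`-th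
powers of elements of `C ⊗ sl₂` are given by matrix powers (`thetaElem_pow`). A projective module
is a direct summand of a free one, so everything reduces to left multiplication by `e` on `u(sl₂)`,
where the claim is `exists_e_pow_mul_eq`. Only part of the Poincaré–Birkhoff–Witt theorem is needed
for this: the `e^i q(h) f^l` span, and `e^{p-1} q(h) f^{p-1} = 0` forces `q(h) = 0`, which is
checked in a representation on polynomials (`aeval_H_eq_zero`).

To apply this to the sheaves of the statement, which are defined by kernels, images and cokernels in
the category of sheaves of modules, these operations are carried out on graded modules
(`nonempty_sheafF_iso`); the point is that the kernels and images are homogeneous submodules.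
Finally, `ι` is induced by the inclusion of the even part of `k[s, t]`, so that it is an open
immersion (`ProjMap.isOpenImmersion_map`); pullback along it is restriction, and turns the shift
by `p - i` into the twist by `2 (p - i)` (`nonempty_pullback_shift_iso`), by means of the
multiplication pairing, which is perfect where a linear form is invertible.
-/

set_option linter.unusedSectionVars false

noncomputable section
open TopologicalSpace Opposite AlgebraicGeometry TopCat

/-! ### Tensor products of sheaves of modules and bilinear pairings -/

namespace ProjModule
open scoped TensorProduct

/-- If `N` is generated by `g` and pairing with `g` is bijective, then the pairing identifies
`M ⊗ N` with `Q`. -/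
lemma _root_.TensorProduct.lift_bijective_of_generator {R M N Q : Type*} [CommRing R]
    [AddCommGroup M] [Module R M] [AddCommGroup N] [Module R N] [AddCommGroup Q] [Module R Q]
    (μ : M →ₗ[R] N →ₗ[R] Q) (g : N) (hg : Function.Surjective fun r : R ↦ r • g)
    (hμ : Function.Bijective fun m : M ↦ μ m g) :
    Function.Bijective (TensorProduct.lift μ) := by
  have hs (t : TensorProduct R M N) : ∃ m : M, m ⊗ₜ[R] g = t := by
    induction t with
    | zero => exact ⟨0, TensorProduct.zero_tmul _ _⟩
    | add a b ha hb =>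
      obtain ⟨m, rfl⟩ := ha
      obtain ⟨m', rfl⟩ := hb
      exact ⟨m + m', TensorProduct.add_tmul _ _ _⟩
    | tmul m n =>
      obtain ⟨r, rfl⟩ := hg n
      exact ⟨r • m, TensorProduct.smul_tmul _ _ _⟩
  refine ⟨fun a b hab ↦ ?_, fun q ↦ ?_⟩
  · obtain ⟨m, rfl⟩ := hs a
    obtain ⟨m', rfl⟩ := hs b
    rw [TensorProduct.lift.tmul, TensorProduct.lift.tmul] at hab
    rw [hμ.1 hab]
  · obtain ⟨m, rfl⟩ := hμ.2 q
    exact ⟨m ⊗ₜ g, TensorProduct.lift.tmul _ _⟩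

/-- A bilinear pairing `F × L → G` of sheaves of modules: bilinear maps on the sections over each
open set, compatible with restriction. -/
structure Pairing {X : Scheme.{u}} (F L G : X.Modules) where
  toFun (U : X.Opens) : Γ(F, U) →ₗ[Γ(X, U)] Γ(L, U) →ₗ[Γ(X, U)] Γ(G, U)
  map_toFun : ∀ {U V : X.Opens} (i : U ⟶ V) (f : Γ(F, V)) (l : Γ(L, V)),
    G.presheaf.map i.op (toFun V f l) = toFun U (F.presheaf.map i.op f) (L.presheaf.map i.op l)

variable {X : Scheme.{u}} {F L G : X.Modules}

/-- The tensor product `U ↦ F(U) ⊗ L(U)` of presheaves of modules. -/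
abbrev presheafTensor (F L : X.Modules) : PresheafOfModules X.ringCatSheaf.obj :=
  PresheafOfModules.Monoidal.tensorObj (R := X.presheaf) F.val L.val

/-- The additive map `F(U) ⊗ L(U) → G(U)` induced by a pairing. -/
def Pairing.app (μ : Pairing F L G) (U : (X.Opens)ᵒᵖ) :
    (presheafTensor F L).presheaf.obj U ⟶ G.presheaf.obj U :=
  AddCommGrpCat.ofHom
    (TensorProduct.lift (R := Γ(X, U.unop)) (M := Γ(F, U.unop)) (N := Γ(L, U.unop))
      (P₂ := Γ(G, U.unop)) (μ.toFun U.unop)).toAddMonoidHom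

/-- The map of presheaves of abelian groups from the presheaf tensor product induced by a
pairing. -/
def Pairing.presheafHom (μ : Pairing F L G) :
    (presheafTensor F L).presheaf ⟶ G.presheaf where
  app U := μ.app U
  naturality U V i := by
    ext t
    induction (show TensorProduct Γ(X, U.unop) Γ(F, U.unop) Γ(L, U.unop) from t) with
    | zero => erw [map_zero, map_zero]
    | add a b ha hb => erw [map_add, map_add, ha, hb]
    | tmul a b => exact (μ.map_toFun i.unop a b).symm

/-- The map of presheaves of modules from the presheaf tensor product induced by a pairing. The
restriction of scalars along the identity is the form in which sheafification expects its target. -/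
def Pairing.hom (μ : Pairing F L G) :
    presheafTensor F L ⟶ (PresheafOfModules.restrictScalars (𝟙 X.ringCatSheaf.obj)).obj
      ((SheafOfModules.forget _).obj G) :=
  PresheafOfModules.homMk (M₂ := (PresheafOfModules.restrictScalars (𝟙 X.ringCatSheaf.obj)).obj
      ((SheafOfModules.forget _).obj G)) μ.presheafHom fun U r t ↦
    (TensorProduct.lift (R := Γ(X, U.unop)) (M := Γ(F, U.unop)) (N := Γ(L, U.unop))
      (P₂ := Γ(G, U.unop)) (μ.toFun U.unop)).map_smul r t

lemma isIso_sheafificationHomEquiv_symm {C : Type*} [Category* C] (J : GrothendieckTopology C)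
    {A : Type*} [Category* A] [HasWeakSheafify J A] (P : Cᵒᵖ ⥤ A)
    (G : CategoryTheory.Sheaf J A) (f : P ⟶ (sheafToPresheaf J A).obj G) (hf : J.W f) :
    IsIso (((sheafificationAdjunction J A).homEquiv P G).symm f) := by
  have h3 := (GrothendieckTopology.W_iff _ _).1 hf
  rw [Adjunction.homEquiv_counit]
  infer_instance

/-- The morphism `F ⊗ L ⟶ G` induced by a pairing. -/
def Pairing.desc (μ : Pairing F L G) : tensorSheaf F L ⟶ G :=
  (PresheafOfModules.sheafificationHomEquiv (𝟙 X.ringCatSheaf.obj)).symm μ.hom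

/-- A pairing that is locally perfect, in the sense that it identifies the presheaf tensor product
with `G` over small open sets, induces an isomorphism from the tensor product of sheaves. -/
lemma Pairing.isIso_desc (μ : Pairing F L G)
    (h : ∀ x : X, ∃ V : X.Opens, x ∈ V ∧ ∀ W : X.Opens, W ≤ V →
      Function.Bijective (TensorProduct.lift (μ.toFun W))) : IsIso μ.desc := by
  have hW : (Opens.grothendieckTopology X).W μ.presheafHom := by
    rw [GrothendieckTopology.W_iff_isLocallyBijective]
    constructor
    · refine ⟨fun {U} a b hab x hx ↦ ?_⟩
      obtain ⟨V, hxV, hV⟩ := h x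
      refine ⟨V ⊓ U.unop, Opens.infLERight _ _, ?_, hxV, hx⟩
      refine (hV _ inf_le_left).1 ?_
      have hnat := μ.presheafHom.naturality (Opens.infLERight V U.unop).op
      have e1 := ConcreteCategory.congr_hom hnat a
      have e2 := ConcreteCategory.congr_hom hnat b
      have e3 := congrArg (G.presheaf.map (Opens.infLERight V U.unop).op) hab
      exact (e1.trans e3).trans e2.symm
    · refine ⟨fun {U} s x hx ↦ ?_⟩
      obtain ⟨V, hxV, hV⟩ := h x
      exact ⟨V ⊓ U, Opens.infLERight _ _, (hV _ inf_le_left).2 _, hxV, hx⟩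
  have h2 : IsIso ((SheafOfModules.toSheaf _).map μ.desc) := by
    have e := PresheafOfModules.toSheaf_map_sheafificationHomEquiv_symm
      (𝟙 X.ringCatSheaf.obj) μ.hom
    exact e ▸ isIso_sheafificationHomEquiv_symm _ _ _ _ hW
  exact (isIso_iff_of_reflects_iso (C := SheafOfModules X.ringCatSheaf) μ.desc
    (SheafOfModules.toSheaf X.ringCatSheaf)).1 h2

end ProjModule

/-! ### Maps of sheaves associated to graded modules -/

namespace ProjModule

section Modules

variable {X : Scheme.{u}} {F G S T : X.Modules}

lemma section_eq_of_locally_eq {U : X.Opens} (a b : Γ(T, U))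
    (h : ∀ x ∈ U, ∃ (V : X.Opens) (i : V ⟶ U), x ∈ V ∧
      T.presheaf.map i.op a = T.presheaf.map i.op b) : a = b := by
  choose V i hV e using h
  refine TopCat.Sheaf.eq_of_locally_eq' ⟨T.presheaf, T.isSheaf⟩ (fun x : U ↦ V x.1 x.2) U
    (fun x ↦ i x.1 x.2) ?_ a b fun x ↦ e x.1 x.2
  exact fun x hx ↦ Opens.mem_iSup.2 ⟨⟨x, hx⟩, hV x hx⟩

lemma app_map (α : F ⟶ G) {U V : X.Opens} (i : U ⟶ V) (f : Γ(F, V)) :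
    α.app U (F.presheaf.map i.op f) = G.presheaf.map i.op (α.app V f) :=
  ConcreteCategory.congr_hom (α.mapPresheaf.naturality i.op) f

lemma epi_of_locally_surjective (α : F ⟶ G)
    (h : ∀ (U : X.Opens) (g : Γ(G, U)), ∀ x ∈ U, ∃ (V : X.Opens) (i : V ⟶ U) (f : Γ(F, V)),
      x ∈ V ∧ α.app V f = G.presheaf.map i.op g) : Epi α where
  left_cancellation {T} β γ e := by
    refine Scheme.Modules.hom_ext _ _ fun U ↦ ?_
    ext g
    refine section_eq_of_locally_eq _ _ fun x hx ↦ ?_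
    obtain ⟨V, i, f, hxV, hf⟩ := h U g x hx
    refine ⟨V, i, hxV, ?_⟩
    rw [← app_map, ← app_map, ← hf]
    exact congr(Scheme.Modules.Hom.app $e V f)

lemma mono_of_injective (α : F ⟶ G) (h : ∀ U, Function.Injective (α.app U)) : Mono α where
  right_cancellation {T} β γ e := by
    refine Scheme.Modules.hom_ext _ _ fun U ↦ ?_
    ext g
    exact h U (congr(Scheme.Modules.Hom.app $e U g))

/-- A morphism of sheaves of modules from an additive natural map that respects scalars. -/
def homOfSections (t : ∀ U : X.Opens, Γ(F, U) →+ Γ(G, U))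
    (ht : ∀ {U V : X.Opens} (i : U ⟶ V) (f : Γ(F, V)),
      t U (F.presheaf.map i.op f) = G.presheaf.map i.op (t V f))
    (hs : ∀ (U : X.Opens) (r : Γ(X, U)) (f : Γ(F, U)), t U (r • f) = r • t U f) : F ⟶ G where
  val := PresheafOfModules.homMk
    { app U := AddCommGrpCat.ofHom (t U.unop)
      naturality U V i := by
        ext f
        exact ht i.unop f } fun U r f ↦ hs U.unop r f

/-- A morphism whose sections lie in the image of an injective morphism factors through it. -/
lemma exists_lift_of_injective (α : F ⟶ G) (h : ∀ U, Function.Injective (α.app U)) (g : S ⟶ G)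
    (hg : ∀ U (s : Γ(S, U)), ∃ f : Γ(F, U), α.app U f = g.app U s) : ∃ l : S ⟶ F, l ≫ α = g := by
  choose t ht using hg
  refine ⟨homOfSections (fun U ↦
    { toFun := t U
      map_zero' := h U (by rw [ht, map_zero, map_zero])
      map_add' a b := h U (by rw [ht, map_add, map_add, ht, ht]) }) (fun {U V} i f ↦ h U ?_)
      (fun U r f ↦ h U ?_), ?_⟩
  · exact (ht _ _).trans ((app_map g i f).trans
      ((congrArg _ (ht _ _).symm).trans (app_map α i _).symm))
  · refine (ht _ _).trans ?_
    rw [Scheme.Modules.Hom.app_smul, Scheme.Modules.Hom.app_smul, ← ht]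
    rfl
  · refine Scheme.Modules.hom_ext _ _ fun U ↦ ?_
    ext f
    exact ht _ _

end Modules

variable {k A : Type u} [Field k] [CommRing A] [Algebra k A]
variable {𝒜 : ℕ → Submodule k A} [GradedAlgebra 𝒜]

/-- Composition of degree zero homomorphisms. -/
def GrHom.comp {N₁ N₂ N₃ : GrMod 𝒜} (ψ : GrHom N₂ N₃) (φ : GrHom N₁ N₂) : GrHom N₁ N₃ where
  lin := ψ.lin ∘ₗ φ.lin
  map_mem h := ψ.map_mem (φ.map_mem h)

lemma GrHom.ext {N N' : GrMod 𝒜} {φ ψ : GrHom N N'} (h : φ.lin = ψ.lin) : φ = ψ := by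
  obtain ⟨l, _⟩ := φ
  obtain ⟨l', _⟩ := ψ
  obtain rfl : l = l' := h
  rfl

/-- The value of a section in the localization at a point. -/
def germAt {N : GrMod 𝒜} {U : (Proj 𝒜).Opens} (f : Γ(assocSheaf N, U))
    (x : ProjectiveSpectrum.top 𝒜) (hx : x ∈ U) : Stalk N x :=
  (show (sheafInType N).1.obj (op U) from f).1 ⟨x, hx⟩

lemma section_ext {N : GrMod 𝒜} {U : (Proj 𝒜).Opens} {f g : Γ(assocSheaf N, U)}
    (h : ∀ x hx, germAt f x hx = germAt g x hx) : f = g :=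
  Subtype.ext (funext fun x ↦ h x.1 x.2)

lemma germAt_map {N : GrMod 𝒜} {U V : (Proj 𝒜).Opens} (i : U ⟶ V) (f : Γ(assocSheaf N, V)) (x hx) :
    germAt ((assocSheaf N).presheaf.map i.op f) x hx = germAt f x (i.le hx) := rfl

/-- The value of a function in the local ring at a point, as an element of the localization of
the coordinate ring. -/
def valAt {U : (Proj 𝒜).Opens} (r : Γ(Proj 𝒜, U))
    (x : ProjectiveSpectrum.top 𝒜) (hx : x ∈ U) :
    Localization x.asHomogeneousIdeal.toIdeal.primeCompl :=
  ((show (ProjectiveSpectrum.StructureSheaf.structureSheafInType 𝒜).1.obj (op U) from r).1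
    ⟨x, hx⟩).val

lemma germAt_assocMap {N N' : GrMod 𝒜} (φ : GrHom N N') {U : (Proj 𝒜).Opens}
    (f : Γ(assocSheaf N, U)) (x hx) :
    germAt ((assocMap φ).app U f) x hx = LocalizedModule.map _ φ.lin (germAt f x hx) := rfl

/-- Every section is locally a fraction. -/
lemma exists_fraction {N : GrMod 𝒜} {U : (Proj 𝒜).Opens} (f : Γ(assocSheaf N, U))
    (x : ProjectiveSpectrum.top 𝒜) (hx : x ∈ U) :
    ∃ (V : (Proj 𝒜).Opens) (hVU : V ≤ U) (_ : x ∈ V) (i : ℕ) (m : N.carrier) (s : A),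
      m ∈ N.piece i ∧ s ∈ 𝒜 i ∧ ∀ (y : ProjectiveSpectrum.top 𝒜) (hy : y ∈ V),
        ∃ hs : s ∉ y.asHomogeneousIdeal.toIdeal,
          germAt f y (hVU hy) = LocalizedModule.mk m ⟨s, hs⟩ := by
  obtain ⟨V, hxV, i, d, m, s, hm, hs, w⟩ :=
    (show (sheafInType N).1.obj (op U) from f).2 ⟨x, hx⟩
  exact ⟨V, i.le, hxV, d, m, s, hm, hs, fun y hy ↦ w ⟨y, hy⟩⟩

/-- A family of stalk elements which is locally a fraction is a section. -/
def mkSection (N : GrMod 𝒜) (U : (Proj 𝒜).Opens) (t : ∀ x (_ : x ∈ U), Stalk N x)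
    (h : ∀ x (_ : x ∈ U), ∃ (V : (Proj 𝒜).Opens) (hVU : V ≤ U) (_ : x ∈ V) (i : ℕ)
      (m : N.carrier) (s : A), m ∈ N.piece i ∧ s ∈ 𝒜 i ∧
      ∀ (y : ProjectiveSpectrum.top 𝒜) (hy : y ∈ V),
        ∃ hs : s ∉ y.asHomogeneousIdeal.toIdeal, t y (hVU hy) = LocalizedModule.mk m ⟨s, hs⟩) :
    Γ(assocSheaf N, U) :=
  show (sheafInType N).1.obj (op U) from ⟨fun x ↦ t x.1 x.2, fun x ↦ by
    obtain ⟨V, hVU, hxV, d, m, s, hm, hs, w⟩ := h x.1 x.2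
    exact ⟨V, hxV, homOfLE hVU, d, m, s, hm, hs, fun y ↦ w y.1 y.2⟩⟩

lemma assocMap_comp {N₁ N₂ N₃ : GrMod 𝒜} (φ : GrHom N₁ N₂) (ψ : GrHom N₂ N₃) :
    assocMap φ ≫ assocMap ψ = assocMap (ψ.comp φ) := by
  refine Scheme.Modules.hom_ext _ _ fun U ↦ ?_
  ext f
  refine section_ext fun x hx ↦ ?_
  change LocalizedModule.map _ ψ.lin (LocalizedModule.map _ φ.lin (germAt f x hx)) =
    LocalizedModule.map _ (ψ.lin ∘ₗ φ.lin) (germAt f x hx)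
  induction germAt f x hx using LocalizedModule.induction_on with
  | h m s => simp [LocalizedModule.map_mk]

/-- A homomorphism of graded modules all of whose localizations at points of `Proj` are
injective. -/
def GrHom.StalkInjective {N N' : GrMod 𝒜} (φ : GrHom N N') : Prop :=
  ∀ (x : ProjectiveSpectrum.top 𝒜) (m : N.carrier) (c : A), c ∉ x.asHomogeneousIdeal.toIdeal →
    c • φ.lin m = 0 → ∃ c' ∉ x.asHomogeneousIdeal.toIdeal, c' • m = 0

lemma mk_eq_zero_iff {N : GrMod 𝒜} {x : ProjectiveSpectrum.top 𝒜} (m : N.carrier)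
    (s : x.asHomogeneousIdeal.toIdeal.primeCompl) :
    (LocalizedModule.mk m s : Stalk N x) = 0 ↔
      ∃ c ∉ x.asHomogeneousIdeal.toIdeal, c • m = 0 := by
  rw [← LocalizedModule.zero_mk s, LocalizedModule.mk_eq]
  constructor
  · rintro ⟨u, hu⟩
    refine ⟨u * s, x.asHomogeneousIdeal.toIdeal.primeCompl.mul_mem u.2 s.2, ?_⟩
    rw [smul_zero, smul_zero] at hu
    rw [mul_smul]
    exact hu
  · rintro ⟨c, hc, e⟩
    refine ⟨⟨c, hc⟩, ?_⟩
    rw [smul_zero, smul_zero, smul_comm]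
    exact (congrArg (s • ·) e).trans (smul_zero _)

lemma GrHom.stalkInjective_of_injective {N N' : GrMod 𝒜} (φ : GrHom N N')
    (h : Function.Injective φ.lin) : φ.StalkInjective := fun x m c hc e ↦
  ⟨c, hc, h (by rw [map_smul, e, map_zero])⟩

lemma GrHom.StalkInjective.map_injective {N N' : GrMod 𝒜} {φ : GrHom N N'}
    (h : φ.StalkInjective) (x : ProjectiveSpectrum.top 𝒜) :
    Function.Injective (LocalizedModule.map x.asHomogeneousIdeal.toIdeal.primeCompl φ.lin) := by
  refine (injective_iff_map_eq_zero _).2 fun t ht ↦ ?_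
  induction t using LocalizedModule.induction_on with
  | h m s =>
    rw [LocalizedModule.map_mk] at ht
    obtain ⟨c, hc, e⟩ := (mk_eq_zero_iff (N := N') _ _).1 ht
    exact (mk_eq_zero_iff (N := N) _ _).2 (h x m c hc e)

lemma GrHom.StalkInjective.app_injective {N N' : GrMod 𝒜} {φ : GrHom N N'}
    (h : φ.StalkInjective) (U : (Proj 𝒜).Opens) : Function.Injective ((assocMap φ).app U) :=
  fun f g e ↦ section_ext fun x hx ↦ h.map_injective x (by
    rw [← germAt_assocMap, ← germAt_assocMap, e])

lemma GrHom.StalkInjective.mono {N N' : GrMod 𝒜} {φ : GrHom N N'}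
    (h : φ.StalkInjective) : Mono (assocMap φ) := mono_of_injective _ h.app_injective

/-- The section of the associated sheaf given by a fraction. -/
def fractionSection (N : GrMod 𝒜) {V : (Proj 𝒜).Opens} {d : ℕ} {m : N.carrier} {s : A}
    (hm : m ∈ N.piece d) (hs : s ∈ 𝒜 d)
    (hV : ∀ x ∈ V, s ∉ (show ProjectiveSpectrum 𝒜 from x).asHomogeneousIdeal.toIdeal) :
    Γ(assocSheaf N, V) :=
  mkSection N V (fun x hx ↦ LocalizedModule.mk m ⟨s, hV x hx⟩) fun _ hx ↦
    ⟨V, le_rfl, hx, d, m, s, hm, hs, fun y hy ↦ ⟨hV y hy, rfl⟩⟩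

/-- A homogeneous non-vanishing set, as an open subscheme. -/
def nonvanishing (𝒜 : ℕ → Submodule k A) [GradedAlgebra 𝒜] (c : A) : (Proj 𝒜).Opens :=
  ProjectiveSpectrum.basicOpen 𝒜 c

/-- Local surjectivity on homogeneous elements of degree at least zero: these are the only ones that
occur as numerators of sections. -/
def GrHom.LocallySurjective {N N' : GrMod 𝒜} (φ : GrHom N N') : Prop :=
  ∀ (x : ProjectiveSpectrum.top 𝒜) (d : ℕ) (n : N'.carrier), n ∈ N'.piece d →
    ∃ (e : ℕ) (c : A) (m : N.carrier), c ∈ 𝒜 e ∧ c ∉ x.asHomogeneousIdeal.toIdeal ∧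
      m ∈ N.piece (e + d) ∧ φ.lin m = c • n

/-- Extending a fraction by a homogeneous element that does not vanish. -/
lemma mk_eq_mk_smul {N : GrMod 𝒜} {x : ProjectiveSpectrum.top 𝒜} {m : N.carrier} {s c : A}
    (hs : s ∉ x.asHomogeneousIdeal.toIdeal) (hc : c ∉ x.asHomogeneousIdeal.toIdeal) :
    (LocalizedModule.mk m ⟨s, hs⟩ : Stalk N x) =
      LocalizedModule.mk (c • m) ⟨c * s, x.asHomogeneousIdeal.toIdeal.primeCompl.mul_mem hc hs⟩ :=
  (LocalizedModule.mk_cancel_common_left ⟨c, hc⟩ ⟨s, hs⟩ m).symm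

lemma GrHom.LocallySurjective.epi {N N' : GrMod 𝒜} {φ : GrHom N N'}
    (h : φ.LocallySurjective) : Epi (assocMap φ) := by
  refine epi_of_locally_surjective _ fun U g x hx ↦ ?_
  obtain ⟨V, hVU, hxV, d, n, s, hn, hs, w⟩ := exists_fraction g x hx
  obtain ⟨e, c, m, hc, hcx, hm, e1⟩ := h x d n hn
  have hm' : m ∈ N.piece ((e + d : ℕ) : ℤ) := by exact_mod_cast hm
  refine ⟨V ⊓ nonvanishing 𝒜 c, homOfLE (inf_le_left.trans hVU),
    fractionSection N hm' (SetLike.GradedMul.mul_mem hc hs) fun y hy ↦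
      (show ProjectiveSpectrum 𝒜 from y).asHomogeneousIdeal.toIdeal.primeCompl.mul_mem
        hy.2 (w y hy.1).1, ⟨hxV, hcx⟩, section_ext fun y hy ↦ ?_⟩
  obtain ⟨hsy, e2⟩ := w y hy.1
  rw [germAt_map, e2, mk_eq_mk_smul hsy hy.2, ← e1]
  exact LocalizedModule.map_mk ..

lemma isIso_assocMap {N N' : GrMod 𝒜} {φ : GrHom N N'}
    (h : φ.StalkInjective) (h' : φ.LocallySurjective) : IsIso (assocMap φ) :=
  have := h.mono
  have := h'.epi
  isIso_of_mono_of_epi _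

/-- Exactness of `N' → N → N''` on homogeneous elements, up to homogeneous denominators. -/
def GrHom.LocallyExact {N' N N'' : GrMod 𝒜} (φ : GrHom N' N) (ψ : GrHom N N'') : Prop :=
  ∀ (x : ProjectiveSpectrum.top 𝒜) (d : ℕ) (n : N.carrier) (c : A), n ∈ N.piece d →
    c ∉ x.asHomogeneousIdeal.toIdeal → c • ψ.lin n = 0 →
    ∃ (e : ℕ) (c' : A) (m : N'.carrier), c' ∈ 𝒜 e ∧ c' ∉ x.asHomogeneousIdeal.toIdeal ∧
      m ∈ N'.piece (e + d) ∧ φ.lin m = c' • n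

/-- A section of the target that is locally the image of a fraction lifts, since the local lifts are
unique and hence glue. -/
lemma GrHom.StalkInjective.exists_section {N N' : GrMod 𝒜} {φ : GrHom N N'}
    (h : φ.StalkInjective) {U : (Proj 𝒜).Opens} (g : Γ(assocSheaf N', U))
    (hg : ∀ x (_ : x ∈ U), ∃ (V : (Proj 𝒜).Opens) (hVU : V ≤ U) (_ : x ∈ V) (i : ℕ)
      (m : N.carrier) (s : A), m ∈ N.piece i ∧ s ∈ 𝒜 i ∧
      ∀ (y : ProjectiveSpectrum.top 𝒜) (hy : y ∈ V), ∃ hs : s ∉ y.asHomogeneousIdeal.toIdeal,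
        germAt g y (hVU hy) = LocalizedModule.mk (φ.lin m) ⟨s, hs⟩) :
    ∃ f : Γ(assocSheaf N, U), (assocMap φ).app U f = g := by
  have hex (x : ProjectiveSpectrum.top 𝒜) (hx : x ∈ U) :
      ∃ t : Stalk N x, LocalizedModule.map _ φ.lin t = germAt g x hx := by
    obtain ⟨V, hVU, hxV, d, m, s, hm, hs, w⟩ := hg x hx
    obtain ⟨hsx, e⟩ := w x hxV
    exact ⟨LocalizedModule.mk m ⟨s, hsx⟩, by rw [e, LocalizedModule.map_mk]⟩
  choose t ht using hex
  refine ⟨mkSection N U t fun x hx ↦ ?_, section_ext ht⟩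
  obtain ⟨V, hVU, hxV, d, m, s, hm, hs, w⟩ := hg x hx
  refine ⟨V, hVU, hxV, d, m, s, hm, hs, fun y hy ↦ ?_⟩
  obtain ⟨hsy, e⟩ := w y hy
  exact ⟨hsy, h.map_injective y (by rw [ht, e, LocalizedModule.map_mk])⟩

/-- The kernel property of `N'` among all sheaves of modules mapping to the sheaf of `N`. -/
lemma GrHom.LocallyExact.exists_lift {N' N N'' : GrMod 𝒜} {φ : GrHom N' N} {ψ : GrHom N N''}
    (h : φ.LocallyExact ψ) (hφ : φ.StalkInjective) {S : (Proj 𝒜).Modules} (g : S ⟶ assocSheaf N)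
    (hg : g ≫ assocMap ψ = 0) : ∃ l : S ⟶ assocSheaf N', l ≫ assocMap φ = g := by
  refine exists_lift_of_injective _ hφ.app_injective _ fun U s ↦
    hφ.exists_section _ fun x hx ↦ ?_
  obtain ⟨V, hVU, hxV, d, n, t, hn, ht, w⟩ := exists_fraction (g.app U s) x hx
  obtain ⟨htx, e1⟩ := w x hxV
  have e2 : LocalizedModule.map _ ψ.lin (germAt (g.app U s) x hx) = 0 :=
    congr(germAt (Scheme.Modules.Hom.app $hg U s) x hx)
  rw [e1] at e2
  obtain ⟨c, hc, e3⟩ := (mk_eq_zero_iff (N := N'') _ _).1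
    ((LocalizedModule.map_mk ..).symm.trans e2)
  obtain ⟨e, c', m, hc', hcx', hm, e4⟩ := h x d n c hn hc e3
  refine ⟨V ⊓ nonvanishing 𝒜 c', inf_le_left.trans hVU, ⟨hxV, hcx'⟩, e + d, m, c' * t,
    by exact_mod_cast hm, SetLike.GradedMul.mul_mem hc' ht, fun y hy ↦ ?_⟩
  obtain ⟨hty, e5⟩ := w y hy.1
  exact ⟨y.asHomogeneousIdeal.toIdeal.primeCompl.mul_mem hy.2 hty,
    by rw [e4, e5, mk_eq_mk_smul hty hy.2]⟩

lemma assocMap_eq_zero {N N' : GrMod 𝒜} {φ : GrHom N N'} (h : φ.lin = 0) : assocMap φ = 0 := by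
  refine Scheme.Modules.hom_ext _ _ fun U ↦ ?_
  ext f
  refine section_ext fun x hx ↦ ?_
  rw [germAt_assocMap, h, map_zero]
  rfl

lemma assocMap_eq_id {N : GrMod 𝒜} {φ : GrHom N N} (h : φ.lin = LinearMap.id) :
    assocMap φ = 𝟙 _ := by
  refine Scheme.Modules.hom_ext _ _ fun U ↦ ?_
  ext f
  refine section_ext fun x hx ↦ ?_
  change LocalizedModule.map _ φ.lin (germAt f x hx) = germAt f x hx
  rw [h]
  exact congr($(LocalizedModule.map_id _) (germAt f x hx))

end ProjModule

/-! ### Graded submodules, quotients and subquotients -/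

namespace ProjModule

variable {k A : Type u} [Field k] [CommRing A] [Algebra k A]
variable {𝒜 : ℕ → Submodule k A} [GradedAlgebra 𝒜]

/-- Projections onto the homogeneous pieces, exhibiting a graded module as the direct sum of its
pieces. -/
structure GrMod.Projections (N : GrMod 𝒜) where
  proj : ℤ → N.carrier →+ N.carrier
  proj_mem : ∀ d n, proj d n ∈ N.piece d
  proj_same : ∀ {d n}, n ∈ N.piece d → proj d n = n
  proj_ne : ∀ {d d' n}, n ∈ N.piece d → d' ≠ d → proj d' n = 0
  iSup_piece : ⨆ d, N.piece d = ⊤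

namespace GrMod.Projections

variable {N N' : GrMod 𝒜} (π : N.Projections) (π' : N'.Projections)

/-- Additive maps of degree `r` commute with the projections. -/
lemma map_proj (T : N.carrier →+ N'.carrier) (r : ℤ)
    (hT : ∀ {d m}, m ∈ N.piece d → T m ∈ N'.piece (r + d)) (d : ℤ) (m : N.carrier) :
    T (π.proj d m) = π'.proj (r + d) (T m) := by
  have hm : m ∈ ⨆ d, N.piece d := by rw [π.iSup_piece]; trivial
  induction hm using AddSubgroup.iSup_induction' with
  | hp i m hm =>
    by_cases h : d = i
    · subst h
      rw [π.proj_same hm, π'.proj_same (hT hm)]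
    · rw [π.proj_ne hm h, π'.proj_ne (hT hm) (by simpa using h), map_zero]
  | h1 => simp
  | hadd m m' _ _ h h' => simp [h, h']

/-- The projections of a shifted module. -/
def shift (n : ℤ) : (N.shift n).Projections where
  proj d := π.proj (n + d)
  proj_mem d m := π.proj_mem _ _
  proj_same h := π.proj_same h
  proj_ne h h' := π.proj_ne h (by simpa using h')
  iSup_piece := by
    exact ((Equiv.addLeft n).iSup_comp (g := N.piece)).trans π.iSup_piece

/-- A homogeneous submodule, one stable under the projections. -/
def IsHomogeneous (S : Submodule A N.carrier) : Prop := ∀ d, ∀ m ∈ S, π.proj d m ∈ S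

/-- If `c • n` lies in a homogeneous submodule and `n` is homogeneous, then a homogeneous component
of `c` not vanishing at the given point also multiplies `n` into this submodule. -/
lemma IsHomogeneous.exists_homogeneous_smul_mem {S : Submodule A N.carrier}
    (hS : π.IsHomogeneous S) {x : ProjectiveSpectrum.top 𝒜} {d : ℤ} {n : N.carrier}
    (hn : n ∈ N.piece d) {c : A} (hc : c ∉ x.asHomogeneousIdeal.toIdeal) (hcn : c • n ∈ S) :
    ∃ (e : ℕ) (c' : A), c' ∈ 𝒜 e ∧ c' ∉ x.asHomogeneousIdeal.toIdeal ∧ c' • n ∈ S := by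
  classical
  by_contra! hcon
  refine hc ?_
  rw [← DirectSum.sum_support_decompose 𝒜 c]
  refine Ideal.sum_mem _ fun e _ ↦ ?_
  by_contra he
  refine hcon e _ (SetLike.coe_mem (DirectSum.decompose 𝒜 c e)) he ?_
  have key : π.proj (e + d) (c • n) = (DirectSum.decompose 𝒜 c e : A) • n := by
    conv_lhs => rw [← DirectSum.sum_support_decompose 𝒜 c, Finset.sum_smul, map_sum]
    rw [Finset.sum_eq_single e]
    · exact π.proj_same (N.smul_mem (SetLike.coe_mem _) hn)
    · intro e' _ he'
      exact π.proj_ne (N.smul_mem (SetLike.coe_mem _) hn) (by simpa using he'.symm)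
    · intro he'
      rw [DFinsupp.notMem_support_iff.mp he']
      simp
  rw [← key]
  exact hS _ _ hcn

lemma isHomogeneous_bot : π.IsHomogeneous ⊥ := fun d m hm ↦ by
  rw [(Submodule.mem_bot A).1 hm, map_zero]; exact zero_mem _

lemma IsHomogeneous.inf {S S' : Submodule A N.carrier} (h : π.IsHomogeneous S)
    (h' : π.IsHomogeneous S') : π.IsHomogeneous (S ⊓ S') :=
  fun d m hm ↦ ⟨h d m hm.1, h' d m hm.2⟩

include π' in
lemma isHomogeneous_ker (T : N.carrier →ₗ[A] N'.carrier) (r : ℤ)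
    (hT : ∀ {d m}, m ∈ N.piece d → T m ∈ N'.piece (r + d)) : π.IsHomogeneous (LinearMap.ker T) := by
  intro d m hm
  refine (π.map_proj π' T.toAddMonoidHom r hT d m).trans ?_
  exact (congrArg _ (LinearMap.mem_ker.1 hm)).trans (map_zero _)

include π in
lemma isHomogeneous_range (T : N.carrier →ₗ[A] N'.carrier) (r : ℤ)
    (hT : ∀ {d m}, m ∈ N.piece d → T m ∈ N'.piece (r + d)) :
    π'.IsHomogeneous (LinearMap.range T) := by
  rintro d _ ⟨m, rfl⟩
  refine ⟨π.proj (-r + d) m, (π.map_proj π' T.toAddMonoidHom r hT _ m).trans ?_⟩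
  rw [add_neg_cancel_left]
  rfl

include π in
/-- A homogeneous element of the range of a map of degree `r` has a homogeneous preimage. -/
lemma exists_mem_piece_of_range (T : N.carrier →ₗ[A] N'.carrier) (r : ℤ)
    (hT : ∀ {d m}, m ∈ N.piece d → T m ∈ N'.piece (r + d)) {d : ℤ} (π' : N'.Projections)
    {n : N'.carrier} (hn : n ∈ N'.piece d) (hnT : n ∈ LinearMap.range T) :
    ∃ m ∈ N.piece (-r + d), T m = n := by
  obtain ⟨m, rfl⟩ := hnT
  refine ⟨π.proj (-r + d) m, π.proj_mem _ _, ?_⟩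
  refine (π.map_proj π' T.toAddMonoidHom r hT _ m).trans ?_
  rw [add_neg_cancel_left]
  exact π'.proj_same hn

end GrMod.Projections

/-- A submodule with the induced grading. -/
def GrMod.sub (N : GrMod 𝒜) (S : Submodule A N.carrier) : GrMod 𝒜 where
  carrier := S
  piece d := (N.piece d).comap S.subtype.toAddMonoidHom
  smul_mem ha hm := N.smul_mem ha hm

/-- A quotient module with the induced grading. -/
def GrMod.quot (N : GrMod 𝒜) (S : Submodule A N.carrier) : GrMod 𝒜 where
  carrier := N.carrier ⧸ S
  piece d := (N.piece d).map S.mkQ.toAddMonoidHom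
  smul_mem := by
    rintro i j a _ ha ⟨m, hm, rfl⟩
    exact ⟨a • m, N.smul_mem ha hm, rfl⟩

/-- The inclusion of a submodule. -/
def GrMod.subHom (N : GrMod 𝒜) (S : Submodule A N.carrier) : GrHom (N.sub S) N where
  lin := S.subtype
  map_mem h := h

/-- The inclusion between two submodules. -/
def GrMod.subLE (N : GrMod 𝒜) {S S' : Submodule A N.carrier} (h : S ≤ S') :
    GrHom (N.sub S) (N.sub S') where
  lin := Submodule.inclusion h
  map_mem h := h

/-- The projection onto a quotient module. -/
def GrMod.quotHom (N : GrMod 𝒜) (S : Submodule A N.carrier) : GrHom N (N.quot S) where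
  lin := S.mkQ
  map_mem h := ⟨_, h, rfl⟩

lemma GrMod.subHom_stalkInjective (N : GrMod 𝒜) (S : Submodule A N.carrier) :
    (N.subHom S).StalkInjective := GrHom.stalkInjective_of_injective _ Subtype.val_injective

lemma GrMod.subLE_stalkInjective (N : GrMod 𝒜) {S S' : Submodule A N.carrier} (h : S ≤ S') :
    (N.subLE h).StalkInjective :=
  GrHom.stalkInjective_of_injective _ (Submodule.inclusion_injective h)

lemma GrMod.quotHom_locallySurjective (N : GrMod 𝒜) (S : Submodule A N.carrier) :
    (N.quotHom S).LocallySurjective := by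
  rintro x d _ ⟨m, hm, rfl⟩
  exact ⟨0, 1, m, SetLike.GradedOne.one_mem, (Ideal.ne_top_iff_one _).mp x.isPrime.ne_top,
    by simpa using hm, (one_smul _ _).symm⟩

/-- The quotient `S' / S` of two submodules `S ≤ S'`, with the induced grading. -/
def GrMod.subquot (N : GrMod 𝒜) (S S' : Submodule A N.carrier) : GrMod 𝒜 :=
  (N.sub S').quot (S.submoduleOf S')

/-- The projection onto a subquotient. -/
def GrMod.subquotHom (N : GrMod 𝒜) (S S' : Submodule A N.carrier) :
    GrHom (N.sub S') (N.subquot S S') :=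
  (N.sub S').quotHom (S.submoduleOf S')

lemma GrMod.subquotHom_locallySurjective (N : GrMod 𝒜) (S S' : Submodule A N.carrier) :
    (N.subquotHom S S').LocallySurjective := quotHom_locallySurjective _ _

lemma GrMod.Projections.subquot_locallyExact {N : GrMod 𝒜} (π : N.Projections)
    {S S' : Submodule A N.carrier} (hS : π.IsHomogeneous S) (h : S ≤ S') :
    (N.subLE h).LocallyExact (N.subquotHom S S') := by
  intro x d n c hn hc e
  have e1 : c • n.1 ∈ S :=
    (Submodule.Quotient.mk_eq_zero (S.submoduleOf S') (x := c • (show S' from n))).1 e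
  obtain ⟨e, c', hc', hcx', hS'⟩ := hS.exists_homogeneous_smul_mem π (N := N) (n := n.1) hn hc e1
  exact ⟨e, c', ⟨c' • n.1, hS'⟩, hc', hcx', N.smul_mem hc' hn, rfl⟩

section Abelian

variable {C : Type*} [Category* C] [Abelian C]

/-- If the kernel of an epimorphism is `f`, the epimorphism is the cokernel of `f`. -/
def cokernelIsoOfLift {X Y Z : C} (f : X ⟶ Y) [Mono f] (g : Y ⟶ Z) [Epi g] (w : f ≫ g = 0)
    (h : ∀ {T : C} (t : T ⟶ Y), t ≫ g = 0 → ∃ l : T ⟶ X, l ≫ f = t) : Limits.cokernel f ≅ Z := by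
  have : (ShortComplex.mk f g w).Exact :=
    ShortComplex.exact_of_f_is_kernel _ (Limits.KernelFork.IsLimit.ofι' f w fun t ht ↦
      ⟨(h t ht).choose, (h t ht).choose_spec⟩)
  exact Limits.IsColimit.coconePointUniqueUpToIso (Limits.cokernelIsCokernel f) this.gIsCokernel

/-- The cokernel of the inclusion of two subobjects, computed from representing monomorphisms. -/
lemma nonempty_cokernel_ofLE_iso {X Y Z W : C} {P Q : Subobject W} (hPQ : P ≤ Q) (a : X ⟶ W)
    (b : Y ⟶ W) [Mono a] [Mono b] (hP : P = Subobject.mk a) (hQ : Q = Subobject.mk b) (f : X ⟶ Y)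
    [Mono f] (hf : f ≫ b = a) (g : Y ⟶ Z) [Epi g] (w : f ≫ g = 0)
    (h : ∀ {T : C} (t : T ⟶ Y), t ≫ g = 0 → ∃ l : T ⟶ X, l ≫ f = t) :
    Nonempty (Limits.cokernel (Subobject.ofLE P Q hPQ) ≅ Z) := by
  subst hP hQ
  refine ⟨Limits.cokernel.mapIso _ f (Subobject.underlyingIso a) (Subobject.underlyingIso b) ?_ ≪≫
    cokernelIsoOfLift f g w h⟩
  rw [← cancel_mono b]
  simp [hf]

end Abelian

end ProjModule

/-! ### Kernels and images of maps of associated sheaves -/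

namespace ProjModule

variable {k A : Type u} [Field k] [CommRing A] [Algebra k A]
variable (𝒜 : ℕ → Submodule k A) [GradedAlgebra 𝒜]

/-- The projection of `A` onto its homogeneous piece of degree `d`. -/
def intProj : ℤ → A →ₗ[k] A
  | Int.ofNat n => GradedAlgebra.proj 𝒜 n
  | Int.negSucc _ => 0

lemma intProj_mem (d : ℤ) (a : A) : intProj 𝒜 d a ∈ intPiece 𝒜 d := by
  cases d with
  | ofNat n => exact SetLike.coe_mem (DirectSum.decompose 𝒜 a n)
  | negSucc n => exact zero_mem _

lemma intProj_same {d : ℤ} {a : A} (ha : a ∈ intPiece 𝒜 d) : intProj 𝒜 d a = a := by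
  cases d with
  | ofNat n => exact DirectSum.decompose_of_mem_same 𝒜 ha
  | negSucc n => exact ((Submodule.mem_bot k).1 ha).symm

lemma intProj_ne {d d' : ℤ} {a : A} (ha : a ∈ intPiece 𝒜 d) (h : d' ≠ d) :
    intProj 𝒜 d' a = 0 := by
  cases d' with
  | ofNat n' =>
    cases d with
    | ofNat n => exact DirectSum.decompose_of_mem_ne 𝒜 ha fun e ↦ h (by rw [e])
    | negSucc n => rw [(Submodule.mem_bot k).1 ha, map_zero]
  | negSucc n => rfl

open TensorProduct in
/-- The projections of a free module `A ⊗ V`. -/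
def freeProjections (V : Type u) [AddCommGroup V] [Module k V] :
    (GrMod.free 𝒜 V).Projections where
  proj d := ((intProj 𝒜 d).rTensor V).toAddMonoidHom
  proj_mem d m := by
    refine ⟨(LinearMap.codRestrict (intPiece 𝒜 d) (intProj 𝒜 d) (intProj_mem 𝒜 d)).rTensor V m, ?_⟩
    change ((LinearMap.rTensor V _) ∘ₗ (LinearMap.rTensor V _)) m = _
    rw [← LinearMap.rTensor_comp]
    rfl
  proj_same := by
    rintro d _ ⟨t, rfl⟩
    change ((LinearMap.rTensor V _) ∘ₗ (LinearMap.rTensor V _)) t = _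
    rw [← LinearMap.rTensor_comp]
    congr 2
    ext a
    exact intProj_same 𝒜 a.2
  proj_ne := by
    rintro d d' _ ⟨t, rfl⟩ h
    change ((LinearMap.rTensor V _) ∘ₗ (LinearMap.rTensor V _)) t = _
    rw [← LinearMap.rTensor_comp]
    have : (intProj 𝒜 d' ∘ₗ (intPiece 𝒜 d).subtype) = 0 := by
      ext a
      exact intProj_ne 𝒜 a.2 h
    rw [this, LinearMap.rTensor_zero]
    rfl
  iSup_piece := by
    classical
    refine eq_top_iff.2 fun m _ ↦ ?_
    induction (show A ⊗[k] V from m) using TensorProduct.induction_on with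
    | zero => exact zero_mem _
    | add a b ha hb => exact add_mem ha hb
    | tmul a v =>
      conv => enter [2]; rw [← DirectSum.sum_support_decompose 𝒜 a, TensorProduct.sum_tmul]
      refine sum_mem fun n _ ↦ ?_
      refine AddSubgroup.mem_iSup_of_mem (n : ℤ) ?_
      exact ⟨(⟨_, SetLike.coe_mem (DirectSum.decompose 𝒜 a n)⟩ : intPiece 𝒜 (n : ℤ)) ⊗ₜ v, rfl⟩

variable {𝒜}

lemma GrMod.one_notMem (x : ProjectiveSpectrum.top 𝒜) : (1 : A) ∉ x.asHomogeneousIdeal.toIdeal :=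
  (Ideal.ne_top_iff_one _).mp x.isPrime.ne_top

lemma imageSubobject_epi_comp_mono {C : Type*} [Category* C] [Abelian C] {X Y Z : C} (a : X ⟶ Y)
    [Epi a] (b : Y ⟶ Z) [Mono b] : Limits.imageSubobject (a ≫ b) = Subobject.mk b := by
  rw [← Limits.imageSubobject_mono b]
  have := isIso_of_mono_of_epi (Subobject.ofLE _ _ (Limits.imageSubobject_comp_le a b))
  exact Subobject.eq_of_comm (asIso (Subobject.ofLE _ _ (Limits.imageSubobject_comp_le a b)))
    (by simp)

/-- The submodule `ker T ∩ im T^j`. -/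
def kerInfRange {A V : Type*} [CommRing A] [AddCommGroup V] [Module A V] (T : V →ₗ[A] V) (j : ℕ) :
    Submodule A V := LinearMap.ker T ⊓ LinearMap.range (T ^ j)

/-- The graded module `(ker T ∩ im T^{i-1}) / (ker T ∩ im T^i)`. -/
def GrMod.jordan (N : GrMod 𝒜) (T : N.carrier →ₗ[A] N.carrier) (i : ℕ) : GrMod 𝒜 :=
  N.subquot (kerInfRange T i) (kerInfRange T (i - 1))

lemma pow_mem_piece {N : GrMod 𝒜} {T : N.carrier →ₗ[A] N.carrier}
    (hT : ∀ {d m}, m ∈ N.piece d → T m ∈ N.piece (1 + d)) (j : ℕ) {d : ℤ} {m : N.carrier}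
    (hm : m ∈ N.piece d) : (T ^ j) m ∈ N.piece (j + d) := by
  induction j with
  | zero => simpa using hm
  | succ j ih =>
    rw [pow_succ', Nat.cast_add, Nat.cast_one, show (j : ℤ) + 1 + d = 1 + (j + d) by ring]
    exact hT ih

section Image

variable {N' N N'' : GrMod 𝒜} (π' : N'.Projections) (π : N.Projections) (π'' : N''.Projections)
  (φ : GrHom N' N) (ψ : GrHom N N'')

/-- The corestriction of a homomorphism to its range. -/
def GrHom.toRange : GrHom N' (N.sub (LinearMap.range φ.lin)) where
  lin := φ.lin.rangeRestrict
  map_mem hm := φ.map_mem hm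

lemma GrHom.mem_piece_zero_add {d : ℤ} {m : N'.carrier} (hm : m ∈ N'.piece d) :
    φ.lin m ∈ N.piece (0 + d) := by rw [zero_add]; exact φ.map_mem hm

include π' π in
lemma GrHom.toRange_locallySurjective : φ.toRange.LocallySurjective := by
  rintro x d ⟨n, hnr⟩ hn
  obtain ⟨m, hm, e⟩ := π'.exists_mem_piece_of_range φ.lin 0 φ.mem_piece_zero_add π hn hnr
  refine ⟨0, 1, m, SetLike.GradedOne.one_mem, GrMod.one_notMem x, ?_, ?_⟩
  · simpa using hm
  · exact (Subtype.ext e : _ = (⟨n, hnr⟩ : LinearMap.range φ.lin)).trans (one_smul _ _).symm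

lemma GrMod.mono_subHom (S : Submodule A N.carrier) : Mono (assocMap (N.subHom S)) :=
  (N.subHom_stalkInjective S).mono

attribute [local instance] GrMod.mono_subHom

include π' π in
/-- The image of a map of associated sheaves is associated to the image. -/
lemma imageSubobject_assocMap : Limits.imageSubobject (assocMap φ) =
    Subobject.mk (assocMap (N.subHom (LinearMap.range φ.lin))) := by
  have := (φ.toRange_locallySurjective π' π).epi
  have e : assocMap φ = assocMap φ.toRange ≫ assocMap (N.subHom (LinearMap.range φ.lin)) :=
    (congrArg assocMap (GrHom.ext (by ext; rfl))).trans (assocMap_comp _ _).symm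
  rw [e]
  exact imageSubobject_epi_comp_mono _ _

include π π'' in
lemma GrMod.Projections.isHomogeneous_ker_lin : π.IsHomogeneous (LinearMap.ker ψ.lin) :=
  π.isHomogeneous_ker π'' ψ.lin 0 ψ.mem_piece_zero_add

include π' π in
lemma GrMod.Projections.isHomogeneous_range_lin : π.IsHomogeneous (LinearMap.range φ.lin) :=
  π'.isHomogeneous_range π φ.lin 0 φ.mem_piece_zero_add

include π'' in
lemma GrHom.ker_locallyExact (S : Submodule A N.carrier) :
    (N.subLE (inf_le_right : LinearMap.ker ψ.lin ⊓ S ≤ S)).LocallyExact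
      (ψ.comp (N.subHom S)) := by
  rintro x d ⟨n, hnS⟩ c hn hc e
  obtain ⟨e, c', hc', hcx', h0⟩ := (π''.isHomogeneous_bot).exists_homogeneous_smul_mem π''
    (ψ.map_mem hn) hc ((Submodule.mem_bot A).2 e)
  refine ⟨e, c', ⟨c' • n, ?_, S.smul_mem _ hnS⟩, hc', hcx', N.smul_mem hc' hn, rfl⟩
  exact (map_smul ψ.lin c' n).trans ((Submodule.mem_bot A).1 h0)

include π' π π'' in
/-- Kernels and images of maps of associated sheaves can be intersected on graded modules. -/
lemma kernel_inf_image_assocMap :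
    Limits.kernelSubobject (assocMap ψ) ⊓ Limits.imageSubobject (assocMap φ) =
    Subobject.mk (assocMap (N.subHom (LinearMap.ker ψ.lin ⊓ LinearMap.range φ.lin))) := by
  have hmono := (N.subLE_stalkInjective
    (inf_le_right : LinearMap.ker ψ.lin ⊓ LinearMap.range φ.lin ≤ LinearMap.range φ.lin))
  rw [imageSubobject_assocMap π' π]
  refine le_antisymm ?_ (le_inf ?_ ?_)
  · obtain ⟨l, hl⟩ := (ψ.ker_locallyExact π'' (LinearMap.range φ.lin)).exists_lift hmono
      (Subobject.ofLEMk (Limits.kernelSubobject (assocMap ψ) ⊓ Subobject.mk (assocMap (N.subHom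
        (LinearMap.range φ.lin)))) (assocMap (N.subHom (LinearMap.range φ.lin))) inf_le_right) (by
          rw [← assocMap_comp, ← Category.assoc, Subobject.ofLEMk_comp,
            ← Subobject.ofLE_arrow inf_le_left, Category.assoc,
            Limits.kernelSubobject_arrow_comp, Limits.comp_zero])
    refine Subobject.le_mk_of_comm l ?_
    rw [← Subobject.ofLEMk_comp (inf_le_right : Limits.kernelSubobject (assocMap ψ) ⊓
      Subobject.mk (assocMap (N.subHom (LinearMap.range φ.lin))) ≤ _), ← hl, Category.assoc,
      assocMap_comp]
    rfl
  · refine Limits.le_kernelSubobject _ _ ?_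
    rw [← cancel_epi (Subobject.underlyingIso _).inv, Subobject.underlyingIso_arrow_assoc,
      Limits.comp_zero, assocMap_comp]
    exact assocMap_eq_zero (LinearMap.ext fun m ↦ m.2.1)
  · exact Subobject.mk_le_mk_of_comm (assocMap (N.subLE inf_le_right)) (assocMap_comp _ _)

include π in
/-- The quotient of two subsheaves associated to homogeneous submodules is associated to the
subquotient. -/
lemma nonempty_cokernel_subobject_iso {P Q : Subobject (assocSheaf N)} (h : P ≤ Q)
    {S S' : Submodule A N.carrier} (hS : π.IsHomogeneous S) (hSS' : S ≤ S')
    (hP : P = Subobject.mk (assocMap (N.subHom S)))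
    (hQ : Q = Subobject.mk (assocMap (N.subHom S'))) :
    Nonempty (Limits.cokernel (Subobject.ofLE P Q h) ≅ assocSheaf (N.subquot S S')) := by
  have hinj := N.subLE_stalkInjective hSS'
  have := hinj.mono
  have := (N.subquotHom_locallySurjective S S').epi
  refine nonempty_cokernel_ofLE_iso h _ _ hP hQ (assocMap (N.subLE hSS')) (assocMap_comp _ _)
    (assocMap (N.subquotHom S S')) ?_
    (fun t ht ↦ (π.subquot_locallyExact hS hSS').exists_lift hinj t ht)
  rw [assocMap_comp]
  exact assocMap_eq_zero (LinearMap.ext fun m ↦ (Submodule.Quotient.mk_eq_zero _).2 m.2)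

end Image

end ProjModule

/-! ### The sheaf `ℱ_i(M)` as an associated sheaf -/

namespace Sl2
open MvPolynomial TensorProduct ProjModule

variable (k : Type u) [Field k]
variable (p : ℕ) (M : Type u) [AddCommGroup M] [Module k M] [Module (RestrictedEnveloping k p) M]
  [IsScalarTower k (RestrictedEnveloping k p) M]

lemma theta_pow_mem (j : ℕ) {d : ℤ} {m : NullconeRing k ⊗[k] M}
    (hm : m ∈ (GrMod.free (nullconeGrading k) M).piece d) :
    (theta k p M ^ j) m ∈ (GrMod.free (nullconeGrading k) M).piece (j + d) :=
  pow_mem_piece (N := GrMod.free (nullconeGrading k) M) (theta_mem k p M) j hm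

/-- The graded module `A ⊗ M`, in the form underlying `M̃(0)`. -/
abbrev base : GrMod (nullconeGrading k) := (GrMod.free (nullconeGrading k) M).shift 0

/-- The projections of `A ⊗ M` onto its homogeneous pieces. -/
abbrev baseProjections : (base k M).Projections := (freeProjections (nullconeGrading k) M).shift 0

/-- `Θ^j` as a degree zero homomorphism `(A ⊗ M)[-j] → A ⊗ M`. -/
def powHom (j : ℕ) : GrHom ((GrMod.free (nullconeGrading k) M).shift (-(j : ℤ))) (base k M) where
  lin := theta k p M ^ j
  map_mem {d} m hm := by
    have e : (j : ℤ) + (-(j : ℤ) + d) = 0 + d := by ring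
    change _ ∈ (GrMod.free (nullconeGrading k) M).piece (0 + d)
    exact e ▸ theta_pow_mem k p M j hm

lemma globalOpPow_eq (j : ℕ) : globalOpPow k p M j = assocMap (powHom k p M j) := by
  induction j with
  | zero => exact (assocMap_eq_id (N := base k M) (φ := powHom k p M 0) (pow_zero _)).symm
  | succ j ih =>
    rw [globalOpPow, ih]
    exact (assocMap_comp _ _).trans (congrArg assocMap (GrHom.ext (pow_succ (theta k p M) j).symm))

/-- `Θ` as a degree zero homomorphism `A ⊗ M → (A ⊗ M)[1]`. -/
def thetaHom : GrHom (base k M) ((GrMod.free (nullconeGrading k) M).shift 1) where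
  lin := theta k p M
  map_mem {d} m hm := by
    have e : (1 : ℤ) + (0 + d) = 1 + d := by ring
    change _ ∈ (GrMod.free (nullconeGrading k) M).piece (1 + d)
    exact e ▸ theta_mem k p M hm

/-- The submodule `ker Θ ∩ im Θ^j` of `A ⊗ M`. -/
def kerInf (j : ℕ) : Submodule (NullconeRing k) (base k M).carrier := kerInfRange (theta k p M) j

lemma kerTheta_inf_imTheta (j : ℕ) :
    haveI := (base k M).mono_subHom (kerInf k p M j)
    kerTheta k p M ⊓ imTheta k p M j =
      Subobject.mk (assocMap ((base k M).subHom (kerInf k p M j))) := by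
  have e : imTheta k p M j = Limits.imageSubobject (assocMap (powHom k p M j)) := by
    unfold imTheta
    simp only [globalOpPow_eq]
    rfl
  exact (congrArg (kerTheta k p M ⊓ ·) e).trans (kernel_inf_image_assocMap
    ((freeProjections (nullconeGrading k) M).shift (-(j : ℤ))) (baseProjections k M)
    ((freeProjections (nullconeGrading k) M).shift 1) (powHom k p M j) (thetaHom k p M))

lemma isHomogeneous_kerInf (j : ℕ) : (baseProjections k M).IsHomogeneous (kerInf k p M j) :=
  GrMod.Projections.IsHomogeneous.inf _
    ((baseProjections k M).isHomogeneous_ker_lin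
      ((freeProjections (nullconeGrading k) M).shift 1) (thetaHom k p M))
    (GrMod.Projections.isHomogeneous_range_lin
      ((freeProjections (nullconeGrading k) M).shift (-(j : ℤ))) (baseProjections k M)
      (powHom k p M j))

lemma kerInf_le (i : ℕ) : kerInf k p M i ≤ kerInf k p M (i - 1) := by
  refine inf_le_inf_left _ ?_
  cases i with
  | zero => exact le_rfl
  | succ j =>
    rintro _ ⟨m, rfl⟩
    exact ⟨theta k p M m, congr($((pow_succ (theta k p M) j).symm) m)⟩

/-- The graded module `(ker Θ ∩ im Θ^{i-1}) / (ker Θ ∩ im Θ^i)`. -/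
def grF (i : ℕ) : GrMod (nullconeGrading k) :=
  (base k M).subquot (kerInf k p M i) (kerInf k p M (i - 1))

/-- `ℱ_i(M)` is the sheaf associated to the corresponding subquotient of the graded module
`A ⊗ M`. -/
lemma nonempty_sheafF_iso (i : ℕ) : Nonempty (sheafF k p M i ≅ assocSheaf (grF k p M i)) :=
  nonempty_cokernel_subobject_iso (baseProjections k M) _ (isHomogeneous_kerInf k p M i)
    (kerInf_le k p M i) (kerTheta_inf_imTheta k p M i) (kerTheta_inf_imTheta k p M (i - 1))

end Sl2

/-! ### Jordan subquotients in an extension with a nilpotent operator -/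

namespace ProjModule

section LinearAlgebra

variable {A L V W : Type*} [CommRing A] [AddCommGroup L] [Module A L] [AddCommGroup V] [Module A V]
  [AddCommGroup W] [Module A W]

lemma exists_comp_eq_of_ker_le (α : V →ₗ[A] L) (β : V →ₗ[A] W) (hα : Function.Surjective α)
    (h : LinearMap.ker α ≤ LinearMap.ker β) : ∃ Φ : L →ₗ[A] W, ∀ v, Φ (α v) = β v := by
  refine ⟨(LinearMap.ker α).liftQ β h ∘ₗ (α.quotKerEquivOfSurjective hα).symm.toLinearMap,
    fun v ↦ ?_⟩
  have : (α.quotKerEquivOfSurjective hα).symm (α v) = (LinearMap.ker α).mkQ v := by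
    rw [LinearEquiv.symm_apply_eq]
    rfl
  rw [LinearMap.comp_apply, LinearEquiv.coe_coe, this]
  rfl

lemma map_pow_of_comm {T : V →ₗ[A] V} {T' : W →ₗ[A] W} {π : V →ₗ[A] W}
    (h : ∀ v, π (T v) = T' (π v)) (j : ℕ) (v : V) : π ((T ^ j) v) = (T' ^ j) (π v) := by
  induction j generalizing v with
  | zero => rfl
  | succ j ih => rw [pow_succ, pow_succ, Module.End.mul_apply, Module.End.mul_apply, ih, h]

/-- A short exact sequence `0 → L → V → W → 0` of modules with endomorphisms, where the `p`-th
power of the endomorphism of the middle term vanishes. -/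
structure NilpotentExtension (TL : L →ₗ[A] L) (TV : V →ₗ[A] V) (TW : W →ₗ[A] W) (p : ℕ) where
  ι : L →ₗ[A] V
  π : V →ₗ[A] W
  ι_injective : Function.Injective ι
  π_surjective : Function.Surjective π
  exact : LinearMap.range ι = LinearMap.ker π
  ι_comm : ∀ l, ι (TL l) = TV (ι l)
  π_comm : ∀ v, π (TV v) = TW (π v)
  pow_eq_zero : TV ^ p = 0

variable {TL : L →ₗ[A] L} {TV : V →ₗ[A] V} {TW : W →ₗ[A] W} {p : ℕ}

namespace NilpotentExtension

variable (E : NilpotentExtension TL TV TW p)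
include E

lemma mem_kerInfRange_right {i : ℕ} (hi : 1 ≤ i) {v : V} (hv : (TW ^ i) (E.π v) = 0) :
    (TW ^ (i - 1)) (E.π v) ∈ kerInfRange TW (i - 1) := by
  refine ⟨?_, _, rfl⟩
  change TW _ = 0
  rw [← Module.End.mul_apply, ← pow_succ', Nat.sub_add_cancel hi, hv]

/-- If `v` lifts an element killed by the `i`-th power of the operator, then `Θ^i v` comes from
`L`. -/
lemma exists_left {i : ℕ} {v : V} (hv : (TW ^ i) (E.π v) = 0) : ∃ l, E.ι l = (TV ^ i) v := by
  have : (TV ^ i) v ∈ LinearMap.range E.ι := by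
    rw [E.exact, LinearMap.mem_ker, map_pow_of_comm E.π_comm, hv]
  exact this

lemma pow_left_eq_zero {i : ℕ} (hip : i < p) {v : V} {l : L} (hl : E.ι l = (TV ^ i) v) :
    (TL ^ (p - i)) l = 0 := by
  refine E.ι_injective ?_
  rw [map_pow_of_comm E.ι_comm, hl, ← Module.End.mul_apply, ← pow_add, Nat.sub_add_cancel hip.le,
    E.pow_eq_zero, map_zero]
  rfl

lemma mem_kerInfRange_left {i : ℕ} (hip : i < p) {v : V} {l : L} (hl : E.ι l = (TV ^ i) v) :
    (TL ^ (p - i - 1)) l ∈ kerInfRange TL (p - i - 1) := by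
  refine ⟨?_, _, rfl⟩
  change TL _ = 0
  rw [← Module.End.mul_apply, ← pow_succ',
    Nat.sub_add_cancel (Nat.sub_pos_of_lt hip), E.pow_left_eq_zero hip hl]

/-- The comparison map between the subquotients of the two ends: if `v` lifts `m'`, it sends the
class of `Θ^{i-1} m'` to the class of `Θ^{p-1} v = Θ^{p-i-1} (Θ^i v)`. -/
lemma exists_hom {i : ℕ} (hi : 1 ≤ i) (hip : i < p) :
    ∃ Φ : (↥(kerInfRange TW (i - 1)) ⧸ (kerInfRange TW i).submoduleOf (kerInfRange TW (i - 1)))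
        →ₗ[A] (↥(kerInfRange TL (p - i - 1)) ⧸
          (kerInfRange TL (p - i)).submoduleOf (kerInfRange TL (p - i - 1))),
      ∀ (v : V) (l : L) (hv : (TW ^ i) (E.π v) = 0) (hl : E.ι l = (TV ^ i) v),
        Φ (Submodule.Quotient.mk ⟨_, E.mem_kerInfRange_right hi hv⟩) =
          Submodule.Quotient.mk ⟨_, E.mem_kerInfRange_left hip hl⟩ := by
  -- `G` consists of the lifts `v`; `α` and `β` send `v` to the two classes to be compared
  let G : Submodule A V := LinearMap.ker ((TW ^ i : W →ₗ[A] W) ∘ₗ E.π)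
  have hG (v : G) : (TW ^ i) (E.π v.1) = 0 := v.2
  let α₀ : G →ₗ[A] kerInfRange TW (i - 1) :=
    LinearMap.codRestrict _ (((TW ^ (i - 1) : W →ₗ[A] W) ∘ₗ E.π) ∘ₗ G.subtype)
      fun v ↦ E.mem_kerInfRange_right hi (hG v)
  let α := ((kerInfRange TW i).submoduleOf (kerInfRange TW (i - 1))).mkQ ∘ₗ α₀
  let β₀ : G →ₗ[A] L := (LinearEquiv.ofInjective E.ι E.ι_injective).symm.toLinearMap ∘ₗ
    LinearMap.codRestrict (LinearMap.range E.ι) ((TV ^ i : V →ₗ[A] V) ∘ₗ G.subtype)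
      fun v ↦ E.exists_left (hG v)
  have hβ₀ (v : G) : E.ι (β₀ v) = (TV ^ i) v := by
    have := (LinearEquiv.ofInjective E.ι E.ι_injective).apply_symm_apply
      (LinearMap.codRestrict (LinearMap.range E.ι) ((TV ^ i : V →ₗ[A] V) ∘ₗ G.subtype)
        (fun v ↦ E.exists_left (hG v)) v)
    exact congrArg Subtype.val this
  let β₁ : G →ₗ[A] kerInfRange TL (p - i - 1) :=
    LinearMap.codRestrict _ ((TL ^ (p - i - 1) : L →ₗ[A] L) ∘ₗ β₀)
      fun v ↦ E.mem_kerInfRange_left hip (hβ₀ v)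
  let β := ((kerInfRange TL (p - i)).submoduleOf (kerInfRange TL (p - i - 1))).mkQ ∘ₗ β₁
  have hα : Function.Surjective α := by
    refine (Submodule.mkQ_surjective _).comp ?_
    rintro ⟨m, hm, m', rfl⟩
    obtain ⟨v, rfl⟩ := E.π_surjective m'
    refine ⟨⟨v, ?_⟩, rfl⟩
    change TW _ = 0 at hm
    rw [← Module.End.mul_apply, ← pow_succ', Nat.sub_add_cancel hi] at hm
    exact hm
  have hker : LinearMap.ker α ≤ LinearMap.ker β := by
    intro v hv
    obtain ⟨-, w', hw'⟩ : (TW ^ (i - 1)) (E.π v.1) ∈ kerInfRange TW i :=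
      (Submodule.Quotient.mk_eq_zero ((kerInfRange TW i).submoduleOf _)).1 hv
    refine (Submodule.Quotient.mk_eq_zero _).2 ?_
    obtain ⟨w, rfl⟩ := E.π_surjective w'
    obtain ⟨l, hl⟩ : (TV ^ (i - 1)) v.1 - (TV ^ i) w ∈ LinearMap.range E.ι := by
      rw [E.exact, LinearMap.mem_ker, map_sub, map_pow_of_comm E.π_comm, map_pow_of_comm E.π_comm,
        hw', sub_self]
    refine ⟨(E.mem_kerInfRange_left hip (hβ₀ v)).1, l, E.ι_injective ?_⟩
    change E.ι ((TL ^ (p - i)) l) = E.ι ((TL ^ (p - i - 1)) (β₀ v))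
    rw [map_pow_of_comm E.ι_comm, map_pow_of_comm E.ι_comm, hβ₀, hl, map_sub,
      ← Module.End.mul_apply, ← Module.End.mul_apply, ← Module.End.mul_apply, ← pow_add, ← pow_add,
      ← pow_add, Nat.sub_add_cancel hip.le, E.pow_eq_zero, LinearMap.zero_apply, sub_zero,
      show p - i + (i - 1) = p - i - 1 + i by lia]
  obtain ⟨Φ, hΦ⟩ := exists_comp_eq_of_ker_le α β hα hker
  refine ⟨Φ, fun v l hv hl ↦ (hΦ ⟨v, hv⟩).trans ?_⟩
  have e : β₀ ⟨v, hv⟩ = l := E.ι_injective ((hβ₀ _).trans hl.symm)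
  refine congrArg Submodule.Quotient.mk (Subtype.ext ?_)
  change (TL ^ (p - i - 1)) (β₀ ⟨v, hv⟩) = _
  rw [e]

end NilpotentExtension

end LinearAlgebra

variable {k A : Type u} [Field k] [CommRing A] [Algebra k A]
variable {𝒜 : ℕ → Submodule k A} [GradedAlgebra 𝒜]

section

variable {L V W : GrMod 𝒜} {TL : L.carrier →ₗ[A] L.carrier} {TV : V.carrier →ₗ[A] V.carrier}
  {TW : W.carrier →ₗ[A] W.carrier} {p : ℕ} (E : NilpotentExtension TL TV TW p)
  (πL : L.Projections) (πV : V.Projections) (πW : W.Projections)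

include πL πV πW in
/-- If the middle term of the extension is locally free over `A[T] / T^p`, the subquotients of the
two ends have isomorphic associated sheaves, up to a twist. -/
lemma NilpotentExtension.nonempty_iso
    (hTL : ∀ {d m}, m ∈ L.piece d → TL m ∈ L.piece (1 + d))
    (hTV : ∀ {d m}, m ∈ V.piece d → TV m ∈ V.piece (1 + d))
    (hTW : ∀ {d m}, m ∈ W.piece d → TW m ∈ W.piece (1 + d))
    (hι : ∀ {d m}, m ∈ L.piece d → E.ι m ∈ V.piece d)
    (hπ : ∀ {d m}, m ∈ V.piece d → E.π m ∈ W.piece d)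
    (hex : ∀ (x : ProjectiveSpectrum.top 𝒜) (j : ℕ) (v : V.carrier), j ≤ p → (TV ^ j) v = 0 →
      ∃ c ∉ x.asHomogeneousIdeal.toIdeal, c • v ∈ LinearMap.range (TV ^ (p - j)))
    {i : ℕ} (hi : 1 ≤ i) (hip : i < p) :
    Nonempty (assocSheaf (W.jordan TW i) ≅
      assocSheaf ((L.jordan TL (p - i)).shift ((p - i : ℕ) : ℤ))) := by
  obtain ⟨Φ, hΦ⟩ := E.exists_hom hi hip
  have hπ0 {d m} (hm : m ∈ V.piece d) : E.π m ∈ W.piece (0 + d) := by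
    rw [zero_add]; exact hπ hm
  have hι0 {d m} (hm : m ∈ L.piece d) : E.ι m ∈ V.piece (0 + d) := by
    rw [zero_add]; exact hι hm
  -- The degrees match: if `Θ^{i-1} (π v)` has degree `d`, then `Θ^{p-1} v` has degree `p - i + d`.
  let Ψ : GrHom (W.jordan TW i) ((L.jordan TL (p - i)).shift ((p - i : ℕ) : ℤ)) :=
    { lin := Φ
      map_mem := by
        rintro d _ ⟨⟨m, hm, hr⟩, hmd, rfl⟩
        obtain ⟨w, hw, rfl⟩ := πW.exists_mem_piece_of_range (TW ^ (i - 1)) _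
          (pow_mem_piece hTW _) πW hmd hr
        obtain ⟨v, hv, rfl⟩ := πV.exists_mem_piece_of_range E.π 0 hπ0 πW hw
          (by rw [LinearMap.range_eq_top.2 E.π_surjective]; trivial)
        have hv0 : (TW ^ i) (E.π v) = 0 := by
          change TW _ = 0 at hm
          rwa [← Module.End.mul_apply, ← pow_succ', Nat.sub_add_cancel hi] at hm
        obtain ⟨l, hl⟩ := E.exists_left hv0
        have hlm : l ∈ L.piece (i + (-0 + (-((i - 1 : ℕ) : ℤ) + d))) := by
          have h1 := πL.map_proj πV E.ι.toAddMonoidHom 0 hι0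
            (i + (-0 + (-((i - 1 : ℕ) : ℤ) + d))) l
          rw [zero_add] at h1
          have h2 : E.ι l ∈ V.piece (i + (-0 + (-((i - 1 : ℕ) : ℤ) + d))) := by
            rw [hl]; exact pow_mem_piece hTV i hv
          have h3 := E.ι_injective (h1.trans (πV.proj_same h2))
          exact h3 ▸ πL.proj_mem _ _
        refine ⟨⟨_, E.mem_kerInfRange_left hip hl⟩, ?_, (hΦ v l hv0 hl).symm⟩
        have h4 := pow_mem_piece hTL (p - i - 1) hlm
        have h5 : (((p - i - 1 : ℕ) : ℤ) + (i + (-0 + (-((i - 1 : ℕ) : ℤ) + d)))) =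
            ((p - i : ℕ) : ℤ) + d := by lia
        exact h5 ▸ h4 }
  -- If `Θ^{p-1} v` agrees with `Θ^{p-i} l'`, then `Θ^{i-1} v - l'` is killed by `Θ^{p-i}`, so it is
  -- locally in the image of `Θ^i`, and `Θ^{i-1} (π v)` is too.
  have hinj : Ψ.StalkInjective := by
    rintro x m c hc e
    induction m using Submodule.Quotient.induction_on with
    | H m =>
    obtain ⟨m, hm, w, rfl⟩ := m
    obtain ⟨v, rfl⟩ := E.π_surjective w
    have hv0 : (TW ^ i) (E.π v) = 0 := by
      change TW _ = 0 at hm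
      rwa [← Module.End.mul_apply, ← pow_succ', Nat.sub_add_cancel hi] at hm
    obtain ⟨l, hl⟩ := E.exists_left hv0
    have e1 : c • Φ (Submodule.Quotient.mk ⟨_, E.mem_kerInfRange_right hi hv0⟩) = 0 := e
    rw [hΦ v l hv0 hl, ← Submodule.Quotient.mk_smul] at e1
    obtain ⟨-, l', hl'⟩ : c • (TL ^ (p - i - 1)) l ∈ kerInfRange TL (p - i) :=
      (Submodule.Quotient.mk_eq_zero ((kerInfRange TL (p - i)).submoduleOf _)).1 e1
    have e2 : (TV ^ (p - i)) (c • (TV ^ (i - 1)) v - E.ι l') = 0 := by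
      rw [map_sub, ← map_pow_of_comm E.ι_comm, hl', map_smul, map_smul,
        map_pow_of_comm E.ι_comm, hl, ← Module.End.mul_apply, ← Module.End.mul_apply, ← pow_add,
        ← pow_add, show p - i + (i - 1) = p - i - 1 + i by lia, sub_self]
    obtain ⟨c', hc', v', hv'⟩ := hex x _ _ (Nat.sub_le _ _) e2
    refine ⟨c' * c, x.asHomogeneousIdeal.toIdeal.primeCompl.mul_mem hc' hc,
      (Submodule.Quotient.mk_eq_zero _).2 ⟨?_, E.π v', ?_⟩⟩
    · exact (map_smul TW _ _).trans ((congrArg _ hm).trans (smul_zero _))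
    · rw [Nat.sub_sub_self hip.le] at hv'
      have hl0 : E.π (E.ι l') = 0 := by
        rw [← LinearMap.mem_ker, ← E.exact]; exact ⟨l', rfl⟩
      rw [← map_pow_of_comm E.π_comm, hv', map_smul, map_sub, hl0, sub_zero, map_smul,
        map_pow_of_comm E.π_comm, smul_smul]
      rfl
  -- If `Θ^{p-i} l = 0`, then locally `l = Θ^i v` for some `v`, which is the lift required.
  have hsurj : Ψ.LocallySurjective := by
    rintro x d _ ⟨⟨n, hn, hr⟩, hnd, rfl⟩
    obtain ⟨l, hl, rfl⟩ := πL.exists_mem_piece_of_range (TL ^ (p - i - 1)) _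
      (pow_mem_piece hTL _) πL hnd hr
    have hl0 : (TL ^ (p - i)) l = 0 := by
      change TL _ = 0 at hn
      rwa [← Module.End.mul_apply, ← pow_succ',
        Nat.sub_add_cancel (Nat.sub_pos_of_lt hip)] at hn
    obtain ⟨c, hc, hcr⟩ := hex x (p - i) (E.ι l) (Nat.sub_le _ _) (by
      rw [← map_pow_of_comm E.ι_comm, hl0, map_zero])
    rw [Nat.sub_sub_self hip.le] at hcr
    obtain ⟨e, c', hc', hcx', hcr'⟩ := (πV.isHomogeneous_range πV (TV ^ i) _
      (pow_mem_piece hTV _)).exists_homogeneous_smul_mem πV (hι hl) hc hcr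
    obtain ⟨v, hv, hv'⟩ := πV.exists_mem_piece_of_range (TV ^ i) _ (pow_mem_piece hTV _) πV
      (V.smul_mem hc' (hι hl)) hcr'
    have hv0 : (TW ^ i) (E.π v) = 0 := by
      rw [← map_pow_of_comm E.π_comm, ← LinearMap.mem_ker, ← E.exact, hv', ← map_smul]
      exact ⟨_, rfl⟩
    refine ⟨e, c', Submodule.Quotient.mk ⟨_, E.mem_kerInfRange_right hi hv0⟩, hc', hcx',
      ⟨⟨_, E.mem_kerInfRange_right hi hv0⟩, ?_, rfl⟩, ?_⟩
    · have h4 := pow_mem_piece hTW (i - 1) (hπ hv)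
      have h5 : ((i - 1 : ℕ) : ℤ) + (-(i : ℤ) + (e + (-((p - i - 1 : ℕ) : ℤ) +
          (((p - i : ℕ) : ℤ) + d)))) = e + d := by lia
      exact h5 ▸ h4
    · refine (hΦ v (c' • l) hv0 (by rw [map_smul, hv'])).trans ?_
      exact congrArg Submodule.Quotient.mk (Subtype.ext (map_smul _ _ _))
  have := isIso_assocMap hinj hsurj
  exact ⟨asIso (assocMap Ψ)⟩

end

end ProjModule

/-! ### Inclusions of Veronese subrings induce open immersions -/

namespace ProjMap
open HomogeneousLocalization ProjectiveSpectrum.StructureSheaf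

variable {k A B : Type u} [Field k] [CommRing A] [Algebra k A] [CommRing B] [Algebra k B]
  {𝒜 : ℕ → Submodule k A} {ℬ : ℕ → Submodule k B} [GradedAlgebra 𝒜] [GradedAlgebra ℬ]
  {d : ℕ} (hd : 0 < d) (g : A →ₐ[k] B) (hg : ∀ (i : ℕ) (a : A), a ∈ 𝒜 i → g a ∈ ℬ (d * i))
  (hirr : (HomogeneousIdeal.irrelevant ℬ).toIdeal ≤
    ((HomogeneousIdeal.irrelevant 𝒜).toIdeal.map g).radical)
  (hinj : Function.Injective g)
  (hver : ∀ (i : ℕ) (b : B), b ∈ ℬ (d * i) → ∃ a ∈ 𝒜 i, g a = b)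

include hver in
/-- A homogeneous prime of `ℬ` is determined by its contraction, because the `d`-th power of a
homogeneous element comes from `𝒜`. -/
lemma pointMap_injective : Function.Injective (pointMap hd g hg hirr) := by
  have key (p p' : ProjectiveSpectrum ℬ) (h : pointMap hd g hg hirr p = pointMap hd g hg hirr p') :
      p.asHomogeneousIdeal.toIdeal ≤ p'.asHomogeneousIdeal.toIdeal := by
    classical
    intro b hb
    rw [← DirectSum.sum_support_decompose ℬ b]
    refine Ideal.sum_mem _ fun i _ ↦ ?_
    have hbi := p.asHomogeneousIdeal.isHomogeneous i hb
    obtain ⟨a, -, ha⟩ := hver i ((DirectSum.decompose ℬ b i : B) ^ d)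
      (by simpa using SetLike.pow_mem_graded d (SetLike.coe_mem (DirectSum.decompose ℬ b i)))
    refine p'.isPrime.mem_of_pow_mem d ?_
    rw [← ha]
    have h1 : a ∈ (pointMap hd g hg hirr p).asHomogeneousIdeal.toIdeal := by
      change g a ∈ p.asHomogeneousIdeal.toIdeal
      rw [ha]
      exact Ideal.pow_mem_of_mem _ hbi d hd
    rw [h] at h1
    exact h1
  intro p p' h
  exact ProjectiveSpectrum.ext (HomogeneousIdeal.toIdeal_injective
    (le_antisymm (key p p' h) (key p' p h.symm)))

/-- Lying over for homogeneous primes, relative to a homogeneous ideal. -/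
lemma exists_point_of_le (hint : g.toRingHom.IsIntegral) (I : HomogeneousIdeal ℬ)
    (q : ProjectiveSpectrum 𝒜)
    (hI : I.toIdeal.comap g.toRingHom ≤ q.asHomogeneousIdeal.toIdeal) :
    ∃ p : ProjectiveSpectrum ℬ, I.toIdeal ≤ p.asHomogeneousIdeal.toIdeal ∧
      pointMap hd g hg hirr p = q := by
  classical
  let _ := g.toRingHom.toAlgebra
  have : Algebra.IsIntegral A B := ⟨hint⟩
  obtain ⟨Q, hQI, hQ, hQq⟩ := Ideal.exists_ideal_over_prime_of_isIntegral
    q.asHomogeneousIdeal.toIdeal I.toIdeal hI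
  have hcomap : (Q.homogeneousCore ℬ).toIdeal.comap g.toRingHom =
      q.asHomogeneousIdeal.toIdeal := by
    refine le_antisymm ?_ fun a ha ↦ ?_
    · exact (Ideal.comap_mono (Ideal.toIdeal_homogeneousCore_le ℬ Q)).trans hQq.le
    · rw [Ideal.mem_comap, ← DirectSum.sum_support_decompose 𝒜 a, map_sum]
      refine Ideal.sum_mem _ fun i _ ↦ ?_
      refine Ideal.mem_homogeneousCore_of_homogeneous_of_mem
        ⟨_, hg i _ (SetLike.coe_mem (DirectSum.decompose 𝒜 a i))⟩ ?_
      exact hQq.ge (q.asHomogeneousIdeal.isHomogeneous i ha)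
  refine ⟨⟨Q.homogeneousCore ℬ, hQ.homogeneousCore, fun h ↦ q.not_irrelevant_le ?_⟩, ?_,
    ProjectiveSpectrum.ext (HomogeneousIdeal.toIdeal_injective hcomap)⟩
  · refine (HomogeneousIdeal.irrelevant_le 𝒜).2 fun i hi a ha ↦ ?_
    have h1 : g a ∈ (Q.homogeneousCore ℬ).toIdeal :=
      h (HomogeneousIdeal.mem_irrelevant_of_mem _ (Nat.mul_pos hd hi) (hg i a ha))
    exact hcomap.le h1
  · have := Ideal.homogeneousCore_mono ℬ hQI
    rwa [HomogeneousIdeal.toIdeal_homogeneousCore_eq_self] at this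

include hver in
lemma isOpenEmbedding_pointMap (hinj : Function.Injective g) (hint : g.toRingHom.IsIntegral) :
    Topology.IsOpenEmbedding (pointMap hd g hg hirr) := by
  have hclosed : IsClosedMap (pointMap hd g hg hirr) := by
    intro Z hZ
    have hZ' : ProjectiveSpectrum.zeroLocus ℬ
        (ProjectiveSpectrum.vanishingIdeal Z : Set B) = Z := by
      rw [ProjectiveSpectrum.zeroLocus_vanishingIdeal_eq_closure, hZ.closure_eq]
    convert ProjectiveSpectrum.isClosed_zeroLocus 𝒜
      (((ProjectiveSpectrum.vanishingIdeal Z).toIdeal.comap g.toRingHom : Ideal A) : Set A) using 1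
    ext q
    constructor
    · rintro ⟨p, hp, rfl⟩
      rw [← hZ'] at hp
      exact fun a ha ↦ hp ha
    · intro hq
      obtain ⟨p, hp, rfl⟩ := exists_point_of_le hd g hg hirr hint _ q hq
      exact ⟨p, hZ' ▸ hp, rfl⟩
  refine ⟨(Topology.IsClosedEmbedding.of_continuous_injective_isClosedMap
    (pointMap hd g hg hirr).continuous (pointMap_injective hd g hg hirr hver)
      hclosed).isEmbedding, ?_⟩
  convert isOpen_univ
  refine Set.eq_univ_of_forall fun q ↦ ?_
  obtain ⟨p, -, hp⟩ := exists_point_of_le hd g hg hirr hint ⊥ q (fun a ha ↦ by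
    have : g a = 0 := ha
    rw [hinj (this.trans (map_zero g).symm)]
    exact zero_mem _)
  exact ⟨p, hp⟩

include hinj in
lemma locHom_injective [IsDomain B] (p : ProjectiveSpectrum ℬ) :
    Function.Injective (locHom hd g hg hirr p) := by
  refine (injective_iff_map_eq_zero _).2 fun t ht ↦ ?_
  induction t using Localization.induction_on with
  | H y =>
    obtain ⟨a, s⟩ := y
    have e : Localization.mk (g a) ⟨g s, s.2⟩ = 0 := (Localization.localRingHom_mk ..).symm.trans ht
    rw [Localization.mk_eq_mk', IsLocalization.mk'_eq_zero_iff] at e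
    obtain ⟨c, hc⟩ := e
    have hc0 : (c : B) ≠ 0 := fun h ↦ c.2 (h ▸ zero_mem _)
    have hga : g a = 0 := (mul_eq_zero.1 hc).resolve_left hc0
    rw [hinj (hga.trans (map_zero g).symm), Localization.mk_zero]

include hver in
/-- A fraction `b / c` over `ℬ` of degree `d * m` is `(b * c ^ (d - 1)) / c ^ d`, and hence comes
from a fraction of degree `m` over `𝒜`. -/
lemma exists_fraction_eq (p : ProjectiveSpectrum ℬ) {m n : ℕ} {b c : B} (hb : b ∈ ℬ (d * m + n))
    (hc : c ∈ ℬ n) (hcp : c ∉ p.asHomogeneousIdeal.toIdeal) :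
    ∃ (a s : A), a ∈ 𝒜 (m + n) ∧ s ∈ 𝒜 n ∧ g a = b * c ^ (d - 1) ∧ g s = c ^ d ∧
      s ∉ (point hd g hg hirr p).asHomogeneousIdeal.toIdeal := by
  obtain ⟨s, hs, hs'⟩ := hver n (c ^ d) (by simpa using SetLike.pow_mem_graded d hc)
  obtain ⟨a, ha, ha'⟩ := hver (m + n) (b * c ^ (d - 1)) (by
    have h1 := SetLike.GradedMul.mul_mem hb (SetLike.pow_mem_graded (d - 1) hc)
    obtain ⟨e, rfl⟩ : ∃ e, d = e + 1 := ⟨d - 1, by lia⟩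
    have : (e + 1) * m + n + (e + 1 - 1) • n = (e + 1) * (m + n) := by simp; ring
    rwa [this] at h1)
  refine ⟨a, s, ha, hs, ha', hs', fun h ↦ hcp (p.isPrime.mem_of_pow_mem d ?_)⟩
  rw [← hs']
  exact h

include hinj hver in
lemma localMap_bijective [IsDomain B] (p : ProjectiveSpectrum ℬ) :
    Function.Bijective (localMap hd g hg hirr p) := by
  constructor
  · intro x y h
    refine val_injective _ (locHom_injective hd g hg hirr hinj p ?_)
    rw [← val_localFun, ← val_localFun]
    exact congrArg val h
  · intro y
    obtain ⟨⟨n, ⟨b, hb⟩, ⟨c, hc⟩, hcp⟩, rfl⟩ := y.mk_surjective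
    obtain ⟨a, s, ha, hs, ha', hs', hsp⟩ := exists_fraction_eq hd g hg hirr hver p (m := 0)
      (by simpa using hb) hc hcp
    let z : AtPrime 𝒜 (point hd g hg hirr p).asHomogeneousIdeal.toIdeal :=
      mk ⟨n, ⟨a, by simpa using ha⟩, ⟨s, hs⟩, hsp⟩
    refine ⟨z, val_injective _ ?_⟩
    change (localFun hd g hg hirr p z).val = _
    rw [val_localFun, val_mk, val_mk, Localization.localRingHom_mk, Localization.mk_eq_mk_iff,
      Localization.r_iff_exists]
    refine ⟨1, ?_⟩
    change 1 * (c * g a) = 1 * (g s * b)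
    obtain ⟨e, rfl⟩ : ∃ e, d = e + 1 := ⟨d - 1, by lia⟩
    rw [ha', hs', Nat.add_sub_cancel]
    ring

include hinj hver in
/-- The morphism on `Proj` induced by the inclusion of a Veronese subring is an open immersion. -/
lemma isOpenImmersion_map [IsDomain B] (hint : g.toRingHom.IsIntegral) :
    IsOpenImmersion (map hd g hg hirr) := by
  have hst (p : ProjectiveSpectrum.top ℬ) :
      IsIso ((presheafedMap hd g hg hirr).stalkMap p) := by
    have hb : Function.Bijective ((presheafedMap hd g hg hirr).stalkMap p).hom := by
      have h1 := (localMap_bijective hd g hg hirr hinj hver p).comp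
        (Proj.stalkIso' 𝒜 (pointMap hd g hg hirr p)).bijective
      have h2 : (localMap hd g hg hirr p) ∘ (Proj.stalkIso' 𝒜 (pointMap hd g hg hirr p)) =
          (Proj.stalkIso' ℬ p) ∘ ((presheafedMap hd g hg hirr).stalkMap p).hom :=
        funext fun x ↦ (stalkMap_spec hd g hg hirr p x).symm
      have h1' : Function.Bijective
        ((localMap hd g hg hirr p) ∘ (Proj.stalkIso' 𝒜 (pointMap hd g hg hirr p))) := h1
      rw [h2] at h1'
      exact (Function.Bijective.of_comp_iff' (Proj.stalkIso' ℬ p).bijective _).1 h1'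
    exact (ConcreteCategory.isIso_iff_bijective _).2 hb
  have (x : Proj ℬ) : IsIso ((map hd g hg hirr).stalkMap x) := hst x
  exact IsOpenImmersion.of_isIso_stalkMap _ (isOpenEmbedding_pointMap hd g hg hirr hver hinj hint)

end ProjMap

/-! ### The coordinate ring of the nullcone as a Veronese subring -/

namespace Sl2
open MvPolynomial TensorProduct ProjModule

variable (k : Type u) [Field k]

lemma iotaRing_X0 : iotaRing k (nullconeMk k (X 0)) = X 0 ^ 2 := by
  change aeval (R := k) ![(X 0 ^ 2 : MvPolynomial (Fin 2) k), -X 1 ^ 2, X 0 * X 1] (X 0) = _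
  simp

lemma iotaRing_X1 : iotaRing k (nullconeMk k (X 1)) = -X 1 ^ 2 := by
  change aeval (R := k) ![(X 0 ^ 2 : MvPolynomial (Fin 2) k), -X 1 ^ 2, X 0 * X 1] (X 1) = _
  simp

lemma iotaRing_X2 : iotaRing k (nullconeMk k (X 2)) = X 0 * X 1 := by
  change aeval (R := k) ![(X 0 ^ 2 : MvPolynomial (Fin 2) k), -X 1 ^ 2, X 0 * X 1] (X 2) = _
  simp

lemma nullcone_relation : nullconeMk k (X 0) * nullconeMk k (X 1) + nullconeMk k (X 2) ^ 2 = 0 := by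
  rw [← map_mul, ← map_pow, ← map_add]
  exact Ideal.Quotient.eq_zero_iff_mem.mpr (Ideal.mem_span_singleton_self _)

/-- The element of the coordinate ring of the nullcone corresponding to the monomial `s^a t^b`
(zero when `a + b` is odd). -/
def monomialLift (a b : ℕ) : NullconeRing k :=
  if a % 2 = b % 2 then
    nullconeMk k (X 0) ^ (a / 2) * (-nullconeMk k (X 1)) ^ (b / 2) * nullconeMk k (X 2) ^ (a % 2)
  else 0

lemma monomialLift_X0 (a b : ℕ) :
    monomialLift k (a + 2) b = nullconeMk k (X 0) * monomialLift k a b := by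
  unfold monomialLift
  rw [Nat.add_mod_right, Nat.add_div_right _ two_pos]
  split_ifs <;> ring

lemma monomialLift_X1 (a b : ℕ) :
    monomialLift k a (b + 2) = -nullconeMk k (X 1) * monomialLift k a b := by
  unfold monomialLift
  rw [Nat.add_mod_right, Nat.add_div_right _ two_pos]
  split_ifs <;> ring

lemma monomialLift_X2 (a b : ℕ) :
    monomialLift k (a + 1) (b + 1) = nullconeMk k (X 2) * monomialLift k a b := by
  have hrel : nullconeMk k (X 2) ^ 2 = -(nullconeMk k (X 0) * nullconeMk k (X 1)) :=
    eq_neg_of_add_eq_zero_right (nullcone_relation k)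
  unfold monomialLift
  obtain ⟨a', rfl | rfl⟩ := Nat.even_or_odd' a <;> obtain ⟨b', rfl | rfl⟩ := Nat.even_or_odd' b
  · rw [if_pos (by lia), if_pos (by lia), show (2 * a' + 1) / 2 = a' by lia,
      show (2 * b' + 1) / 2 = b' by lia, show (2 * a') / 2 = a' by lia,
      show (2 * b') / 2 = b' by lia, show (2 * a' + 1) % 2 = 1 by lia,
      show (2 * a') % 2 = 0 by lia]
    ring
  · rw [if_neg (by lia), if_neg (by lia), mul_zero]
  · rw [if_neg (by lia), if_neg (by lia), mul_zero]
  · rw [if_pos (by lia), if_pos (by lia), show (2 * a' + 1 + 1) / 2 = a' + 1 by lia,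
      show (2 * b' + 1 + 1) / 2 = b' + 1 by lia, show (2 * a' + 1) / 2 = a' by lia,
      show (2 * b' + 1) / 2 = b' by lia, show (2 * a' + 1 + 1) % 2 = 0 by lia,
      show (2 * a' + 1) % 2 = 1 by lia]
    calc _ = nullconeMk k (X 0) ^ a' * (-nullconeMk k (X 1)) ^ b' *
          (-(nullconeMk k (X 0) * nullconeMk k (X 1))) := by ring
      _ = _ := by rw [← hrel]; ring

/-- The linear retraction of the inclusion of the even part of `k[s, t]`. -/
def retraction : MvPolynomial (Fin 2) k →ₗ[k] NullconeRing k :=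
  (basisMonomials (Fin 2) k).constr k fun m ↦ monomialLift k (m 0) (m 1)

lemma retraction_monomial (m : Fin 2 →₀ ℕ) (c : k) :
    retraction k (monomial m c) = c • monomialLift k (m 0) (m 1) := by
  have h : (monomial m c : MvPolynomial (Fin 2) k) = c • basisMonomials (Fin 2) k m := by
    rw [coe_basisMonomials, smul_monomial, smul_eq_mul, mul_one]
  rw [h, map_smul]
  exact congrArg (c • ·) ((basisMonomials (Fin 2) k).constr_basis k _ _)

/-- The retraction is linear over the coordinate ring of the nullcone. -/
lemma retraction_iotaRing_mul (a : NullconeRing k) (b : MvPolynomial (Fin 2) k) :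
    retraction k (iotaRing k a * b) = a * retraction k b := by
  obtain ⟨q, rfl⟩ := Ideal.Quotient.mkₐ_surjective k _ a
  induction q using MvPolynomial.induction_on generalizing b with
  | C c =>
    have h1 : nullconeMk k (C c) = algebraMap k _ c := rfl
    change retraction k (iotaRing k (nullconeMk k (C c)) * b) = nullconeMk k (C c) * _
    rw [h1, AlgHom.commutes, ← Algebra.smul_def, ← Algebra.smul_def, map_smul]
  | add q q' h h' => rw [map_add, map_add, add_mul, map_add, h, h', add_mul]
  | mul_X q j ih =>
    rw [map_mul (Ideal.Quotient.mkₐ k _) q, map_mul (iotaRing k), mul_assoc, ih, mul_assoc]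
    congr 1
    induction b using MvPolynomial.induction_on' with
    | add b b' h h' => rw [mul_add, map_add, h, h', map_add, mul_add]
    | monomial m c =>
      rw [retraction_monomial, mul_smul_comm]
      fin_cases j
      · change retraction k (iotaRing k (nullconeMk k (X 0)) * _) = _
        rw [iotaRing_X0, X_pow_eq_monomial (σ := Fin 2), monomial_mul, one_mul, retraction_monomial]
        congr 1
        simpa [add_comm] using monomialLift_X0 k (m 0) (m 1)
      · change retraction k (iotaRing k (nullconeMk k (X 1)) * _) = _
        rw [iotaRing_X1, X_pow_eq_monomial (σ := Fin 2), neg_mul, map_neg, monomial_mul, one_mul,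
          retraction_monomial, ← smul_neg]
        congr 1
        have : -monomialLift k (m 0) (m 1 + 2) =
            nullconeMk k (X 1) * monomialLift k (m 0) (m 1) := by
          rw [monomialLift_X1]; ring
        simpa [add_comm] using this
      · change retraction k (iotaRing k (nullconeMk k (X 2)) * _) = _
        rw [iotaRing_X2]
        rw [show (X 0 * X 1 : MvPolynomial (Fin 2) k) = monomial (Finsupp.single 0 1 +
          Finsupp.single 1 1) 1 by rw [X, X, monomial_mul, one_mul], monomial_mul, one_mul,
          retraction_monomial]
        congr 1
        simpa [add_comm] using monomialLift_X2 k (m 0) (m 1)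

lemma retraction_iotaRing (a : NullconeRing k) : retraction k (iotaRing k a) = a := by
  have h1 : retraction k 1 = 1 := by
    rw [show (1 : MvPolynomial (Fin 2) k) = monomial 0 1 from rfl, retraction_monomial]
    simp [monomialLift]
  have := retraction_iotaRing_mul k a 1
  rwa [mul_one, h1, mul_one] at this

lemma iotaRing_injective : Function.Injective (iotaRing k) :=
  Function.LeftInverse.injective (retraction_iotaRing k)

instance : IsDomain (NullconeRing k) := (iotaRing_injective k).isDomain (iotaRing k).toRingHom

/-- The image of the coordinate ring of the nullcone is the even part of `k[s, t]`. -/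
lemma exists_iotaRing_eq (i : ℕ) (b : MvPolynomial (Fin 2) k) (hb : b ∈ lineGrading k (2 * i)) :
    ∃ a ∈ nullconeGrading k i, iotaRing k a = b := by
  have hmem (j : Fin 3) : nullconeMk k (X j) ∈ nullconeGrading k 1 :=
    ⟨X j, isHomogeneous_X k j, rfl⟩
  have key (m : Fin 2 →₀ ℕ) (hm : m 0 + m 1 = 2 * i) :
      monomialLift k (m 0) (m 1) ∈ nullconeGrading k i ∧
        iotaRing k (monomialLift k (m 0) (m 1)) = monomial m 1 := by
    unfold monomialLift
    rw [if_pos (by lia)]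
    constructor
    · have h0 := SetLike.pow_mem_graded (m 0 / 2) (hmem 0)
      have h1 := SetLike.pow_mem_graded (m 1 / 2) (neg_mem (hmem 1))
      have h2 := SetLike.pow_mem_graded (m 0 % 2) (hmem 2)
      have h3 := SetLike.GradedMul.mul_mem (SetLike.GradedMul.mul_mem h0 h1) h2
      have e : (m 0 / 2) • 1 + (m 1 / 2) • 1 + (m 0 % 2) • 1 = i := by
        simp only [smul_eq_mul, mul_one]; lia
      rwa [e] at h3
    · rw [map_mul, map_mul, map_pow, map_pow, map_pow, map_neg, iotaRing_X0, iotaRing_X1,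
        iotaRing_X2, neg_neg, monomial_eq, C_1, one_mul,
        Finsupp.prod_fintype _ _ (fun _ ↦ pow_zero _), Fin.prod_univ_two]
      conv_rhs => rw [← Nat.div_add_mod (m 0) 2, ← Nat.div_add_mod (m 1) 2,
        show m 1 % 2 = m 0 % 2 by lia]
      ring
  have hb' : b ∈ (homogeneousSubmodule (Fin 2) k (2 * i)) := hb
  rw [b.as_sum]
  refine Finset.sum_induction _ (fun b ↦ ∃ a ∈ nullconeGrading k i, iotaRing k a = b) ?_ ?_ ?_
  · rintro _ _ ⟨a, ha, rfl⟩ ⟨a', ha', rfl⟩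
    exact ⟨a + a', add_mem ha ha', map_add _ _ _⟩
  · exact ⟨0, zero_mem _, map_zero _⟩
  · intro m hm
    have hdeg := hb' (mem_support_iff.1 hm)
    rw [Finsupp.weight_apply, Finsupp.sum_fintype _ _ (by simp), Fin.sum_univ_two] at hdeg
    obtain ⟨h1, h2⟩ := key m (by simpa using hdeg)
    refine ⟨coeff m b • monomialLift k (m 0) (m 1), Submodule.smul_mem _ _ h1, ?_⟩
    rw [map_smul, h2, smul_monomial, smul_eq_mul, mul_one]

lemma iotaRing_isIntegral : (iotaRing k).toRingHom.IsIntegral := by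
  have hX (i : Fin 2) : (iotaRing k).toRingHom.IsIntegralElem (X i) := by
    let := (iotaRing k).toRingHom.toAlgebra
    refine IsIntegral.of_pow (R := NullconeRing k) (n := 2) two_pos ?_
    fin_cases i
    · change RingHom.IsIntegralElem (iotaRing k).toRingHom (X 0 ^ 2)
      rw [← iotaRing_X0]
      exact RingHom.isIntegralElem_map _
    · change RingHom.IsIntegralElem (iotaRing k).toRingHom (X 1 ^ 2)
      rw [← neg_neg (X 1 ^ 2), ← iotaRing_X1, ← map_neg]
      exact RingHom.isIntegralElem_map _
  intro b
  induction b using MvPolynomial.induction_on with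
  | C c =>
    have : (C c : MvPolynomial (Fin 2) k) = iotaRing k (algebraMap k _ c) :=
      ((iotaRing k).commutes c).symm
    rw [this]
    exact RingHom.isIntegralElem_map _
  | add b b' h h' => exact RingHom.IsIntegralElem.add _ h h'
  | mul_X b i h => exact RingHom.IsIntegralElem.mul _ h (hX i)

instance : IsOpenImmersion (iota k) :=
  ProjMap.isOpenImmersion_map two_pos (iotaRing k) (iotaRing_mem k) (irrelevant_le k)
    (iotaRing_injective k) (exists_iotaRing_eq k) (iotaRing_isIntegral k)

end Sl2

/-! ### Shifts and twists along the inclusion of a Veronese subring -/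

namespace ProjModule

section
variable {k A : Type u} [Field k] [CommRing A] [Algebra k A]
variable {𝒜 : ℕ → Submodule k A} [GradedAlgebra 𝒜]

lemma mk_one_smul_mk_smul {S : Submonoid A} {M : Type*} [AddCommGroup M] [Module A M] (a : S)
    (t : LocalizedModule S M) :
    (Localization.mk 1 a : Localization S) • ((Localization.mk a 1 : Localization S) • t) = t := by
  rw [smul_smul, Localization.mk_mul, one_mul, mul_one, Localization.mk_self, one_smul]

lemma mk_smul_mk_one_smul {S : Submonoid A} {M : Type*} [AddCommGroup M] [Module A M] (a : S)
    (t : LocalizedModule S M) :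
    (Localization.mk a 1 : Localization S) • ((Localization.mk 1 a : Localization S) • t) = t := by
  rw [smul_smul, Localization.mk_mul, one_mul, mul_one, Localization.mk_self, one_smul]

/-- A family of elements of the local rings which is locally a fraction is a function. -/
lemma exists_function {U : (Proj 𝒜).Opens}
    (t : ∀ x : ProjectiveSpectrum.top 𝒜, x ∈ U →
      Localization x.asHomogeneousIdeal.toIdeal.primeCompl)
    (h : ∀ x (_ : x ∈ U), ∃ (V : (Proj 𝒜).Opens) (hVU : V ≤ U) (_ : x ∈ V) (i : ℕ)
      (a s : A), a ∈ 𝒜 i ∧ s ∈ 𝒜 i ∧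
      ∀ (y : ProjectiveSpectrum.top 𝒜) (hy : y ∈ V),
        ∃ hs : s ∉ y.asHomogeneousIdeal.toIdeal, t y (hVU hy) = Localization.mk a ⟨s, hs⟩) :
    ∃ r : Γ(Proj 𝒜, U), ∀ x hx, valAt r x hx = t x hx := by
  have hex (x : ProjectiveSpectrum.top 𝒜) (hx : x ∈ U) :
      ∃ c : HomogeneousLocalization.AtPrime 𝒜 x.asHomogeneousIdeal.toIdeal, c.val = t x hx := by
    obtain ⟨V, hVU, hxV, i, a, s, ha, hs, w⟩ := h x hx
    obtain ⟨hsx, e⟩ := w x hxV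
    exact ⟨HomogeneousLocalization.mk ⟨i, ⟨a, ha⟩, ⟨s, hs⟩, hsx⟩,
      (HomogeneousLocalization.val_mk _).trans e.symm⟩
  choose c hc using hex
  refine ⟨show (ProjectiveSpectrum.StructureSheaf.structureSheafInType 𝒜).1.obj (op U) from
    ⟨fun x ↦ c x.1 x.2, fun x ↦ ?_⟩, hc⟩
  obtain ⟨V, hVU, hxV, i, a, s, ha, hs, w⟩ := h x.1 x.2
  refine ⟨V, hxV, homOfLE hVU, i, ⟨a, ha⟩, ⟨s, hs⟩, fun y ↦ (w y.1 y.2).1, fun y ↦ ?_⟩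
  refine HomogeneousLocalization.val_injective _ ?_
  rw [HomogeneousLocalization.val_mk]
  exact (hc y.1 (hVU y.2)).trans (w y.1 y.2).2

end

section

open ProjMap HomogeneousLocalization

variable {k A B : Type u} [Field k] [CommRing A] [Algebra k A] [CommRing B] [Algebra k B]
  {𝒜 : ℕ → Submodule k A} {ℬ : ℕ → Submodule k B} [GradedAlgebra 𝒜] [GradedAlgebra ℬ]
  {d : ℕ} (hd : 0 < d) (g : A →ₐ[k] B) (hg : ∀ (i : ℕ) (a : A), a ∈ 𝒜 i → g a ∈ ℬ (d * i))
  (hirr : (HomogeneousIdeal.irrelevant ℬ).toIdeal ≤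
    ((HomogeneousIdeal.irrelevant 𝒜).toIdeal.map g).radical)
  (hinj : Function.Injective g)
  (hver : ∀ (i : ℕ) (b : B), b ∈ ℬ (d * i) → ∃ a ∈ 𝒜 i, g a = b)

lemma valAt_appIso_inv [IsOpenImmersion (map hd g hg hirr)] {U : (Proj ℬ).Opens}
    (r : Γ(Proj ℬ, U)) (q : ProjectiveSpectrum.top ℬ) (hq : q ∈ U)
    (hy : point hd g hg hirr q ∈ map hd g hg hirr ''ᵁ U) :
    locHom hd g hg hirr q (valAt (((map hd g hg hirr).appIso U).inv r)
      (point hd g hg hirr q) hy) = valAt r q hq := by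
  have h1 : ((map hd g hg hirr).appIso U).hom (((map hd g hg hirr).appIso U).inv r) = r :=
    ConcreteCategory.congr_hom (((map hd g hg hirr).appIso U).inv_hom_id) r
  rw [Scheme.Hom.appIso_hom] at h1
  refine Eq.trans ?_ (congrArg (fun r : Γ(Proj ℬ, U) ↦ valAt r q hq) h1)
  exact (val_localFun hd g hg hirr q _).symm

/-- The value of a section of a twisting sheaf at a point, as an element of the local ring. -/
def twistValAt {n : ℤ} {U : (Proj ℬ).Opens} (l : Γ(twistingSheaf ℬ n, U))
    (q : ProjectiveSpectrum.top ℬ) (hq : q ∈ U) :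
    Localization q.asHomogeneousIdeal.toIdeal.primeCompl :=
  germAt (N := (GrMod.self ℬ).shift n) l q hq

lemma twistValAt_add {n : ℤ} {U : (Proj ℬ).Opens} (l l' : Γ(twistingSheaf ℬ n, U)) (q hq) :
    twistValAt (l + l') q hq = twistValAt l q hq + twistValAt l' q hq := rfl

lemma twistValAt_smul {n : ℤ} {U : (Proj ℬ).Opens} (r : Γ(Proj ℬ, U))
    (l : Γ(twistingSheaf ℬ n, U)) (q hq) :
    twistValAt (r • l) q hq = valAt r q hq * twistValAt l q hq := rfl

lemma twistValAt_injective {n : ℤ} {U : (Proj ℬ).Opens} {l l' : Γ(twistingSheaf ℬ n, U)}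
    (h : ∀ q hq, twistValAt l q hq = twistValAt l' q hq) : l = l' :=
  section_ext (N := (GrMod.self ℬ).shift n) h

lemma exists_fraction_twist {n : ℕ} {U : (Proj ℬ).Opens} (l : Γ(twistingSheaf ℬ n, U))
    (x : ProjectiveSpectrum.top ℬ) (hx : x ∈ U) :
    ∃ (V : (Proj ℬ).Opens) (hVU : V ≤ U) (_ : x ∈ V) (i : ℕ) (b c : B),
      b ∈ ℬ (n + i) ∧ c ∈ ℬ i ∧ ∀ (y : ProjectiveSpectrum.top ℬ) (hy : y ∈ V),
        ∃ hc : c ∉ y.asHomogeneousIdeal.toIdeal,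
          twistValAt l y (hVU hy) = Localization.mk b ⟨c, hc⟩ := by
  obtain ⟨V, hVU, hxV, i, b, c, hb, hc, w⟩ :=
    exists_fraction (N := (GrMod.self ℬ).shift n) l x hx
  refine ⟨V, hVU, hxV, i, b, c, ?_, hc, w⟩
  have hb' : b ∈ intPiece ℬ ((n : ℤ) + i) := hb
  exact hb'

/-- `c` is the element of the local ring of `Proj 𝒜` at `y` corresponding to the value at the
preimage of `y` of a section `l` of a twisting sheaf on `Proj ℬ`. -/
def IsCoeff (g : A →ₐ[k] B) {n : ℤ} {U : (Proj ℬ).Opens} (l : Γ(twistingSheaf ℬ n, U))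
    (y : ProjectiveSpectrum.top 𝒜) (c : Localization y.asHomogeneousIdeal.toIdeal.primeCompl) :
    Prop :=
  ∃ (q : ProjectiveSpectrum.top ℬ) (hq : q ∈ U)
    (h : y.asHomogeneousIdeal.toIdeal = q.asHomogeneousIdeal.toIdeal.comap g.toRingHom),
    Localization.localRingHom y.asHomogeneousIdeal.toIdeal q.asHomogeneousIdeal.toIdeal
      g.toRingHom h c = twistValAt l q hq

include hd hg hirr hinj hver in
lemma IsCoeff.unique [IsDomain B] {n : ℤ} {U : (Proj ℬ).Opens} {l : Γ(twistingSheaf ℬ n, U)}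
    {y : ProjectiveSpectrum.top 𝒜} {c c' : Localization y.asHomogeneousIdeal.toIdeal.primeCompl}
    (h : IsCoeff g l y c) (h' : IsCoeff g l y c') : c = c' := by
  obtain ⟨q, hq, e, hc⟩ := h
  obtain ⟨q', hq', e', hc'⟩ := h'
  obtain rfl : y = point hd g hg hirr q :=
    ProjectiveSpectrum.ext (HomogeneousIdeal.toIdeal_injective e)
  obtain rfl : q = q' := pointMap_injective hd g hg hirr hver
    (ProjectiveSpectrum.ext (HomogeneousIdeal.toIdeal_injective e'))
  exact locHom_injective hd g hg hirr hinj q (hc.trans hc'.symm)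

include hd hg hirr hver in
lemma exists_isCoeff {n m : ℕ} (hn : n = d * m) {U : (Proj ℬ).Opens}
    (l : Γ(twistingSheaf ℬ n, U)) (q : ProjectiveSpectrum.top ℬ) (hq : q ∈ U) :
    ∃ (V : (Proj ℬ).Opens) (_ : V ≤ U) (_ : q ∈ V) (i : ℕ) (a s : A),
      a ∈ 𝒜 (m + i) ∧ s ∈ 𝒜 i ∧ ∀ (y : ProjectiveSpectrum.top ℬ) (_ : y ∈ V),
        ∃ hs : s ∉ (point hd g hg hirr y).asHomogeneousIdeal.toIdeal,
          IsCoeff g l (point hd g hg hirr y) (Localization.mk a ⟨s, hs⟩) := by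
  subst hn
  obtain ⟨V, hVU, hxV, i, b, c, hb, hc, w⟩ := exists_fraction_twist l q hq
  obtain ⟨a, s, ha, hs, ha', hs', -⟩ :=
    exists_fraction_eq hd g hg hirr hver q hb hc (w q hxV).1
  refine ⟨V, hVU, hxV, i, a, s, ha, hs, fun y hy ↦ ?_⟩
  obtain ⟨hcy, e⟩ := w y hy
  have hsy : s ∉ (point hd g hg hirr y).asHomogeneousIdeal.toIdeal := fun h ↦
    hcy (y.isPrime.mem_of_pow_mem d (by rw [← hs']; exact h))
  refine ⟨hsy, y, hVU hy, rfl, ?_⟩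
  refine (Localization.localRingHom_mk ..).trans (Eq.trans ?_ e.symm)
  rw [Localization.mk_eq_mk_iff, Localization.r_iff_exists]
  refine ⟨1, ?_⟩
  change 1 * (c * g a) = 1 * (g s * b)
  obtain ⟨e, rfl⟩ : ∃ e, d = e + 1 := ⟨d - 1, by lia⟩
  rw [ha', hs', Nat.add_sub_cancel]
  ring

include hd hg hirr hver in
lemma IsCoeff.add {n : ℤ} {U : (Proj ℬ).Opens} {l l' : Γ(twistingSheaf ℬ n, U)}
    {y : ProjectiveSpectrum.top 𝒜} {c c' : Localization y.asHomogeneousIdeal.toIdeal.primeCompl}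
    (h : IsCoeff g l y c) (h' : IsCoeff g l' y c') : IsCoeff g (l + l') y (c + c') := by
  obtain ⟨q, hq, e, hc⟩ := h
  obtain ⟨q', hq', e', hc'⟩ := h'
  obtain rfl : y = point hd g hg hirr q :=
    ProjectiveSpectrum.ext (HomogeneousIdeal.toIdeal_injective e)
  obtain rfl : q = q' := pointMap_injective hd g hg hirr hver
    (ProjectiveSpectrum.ext (HomogeneousIdeal.toIdeal_injective e'))
  exact ⟨q, hq, e, by rw [map_add, hc, hc', twistValAt_add]⟩

variable [IsOpenImmersion (map hd g hg hirr)]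

lemma IsCoeff.smul {n : ℤ} {U : (Proj ℬ).Opens} {l : Γ(twistingSheaf ℬ n, U)} (r : Γ(Proj ℬ, U))
    {y : ProjectiveSpectrum.top 𝒜} {c : Localization y.asHomogeneousIdeal.toIdeal.primeCompl}
    (h : IsCoeff g l y c) (hy : y ∈ map hd g hg hirr ''ᵁ U) :
    IsCoeff g (r • l) y (valAt (((map hd g hg hirr).appIso U).inv r) y hy * c) := by
  obtain ⟨q, hq, e, hc⟩ := h
  obtain rfl : y = point hd g hg hirr q :=
    ProjectiveSpectrum.ext (HomogeneousIdeal.toIdeal_injective e)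
  refine ⟨q, hq, e, ?_⟩
  rw [map_mul, hc, twistValAt_smul, ← valAt_appIso_inv hd g hg hirr r q hq hy]

lemma exists_preimage_opens (U : (Proj ℬ).Opens) (y : ProjectiveSpectrum.top 𝒜)
    (hy : y ∈ map hd g hg hirr ''ᵁ U) :
    ∃ (q : ProjectiveSpectrum.top ℬ), q ∈ U ∧ point hd g hg hirr q = y := hy

include hinj hver in
/-- The pairing of the pullbacks of `N` and of `𝒪(d * m)` into the pullback of `N[m]`, stalkwise
multiplication by the element of the local ring of `Proj 𝒜` corresponding to `l`. -/
lemma exists_pairing [IsDomain B] (N : GrMod 𝒜) {n m : ℕ} (hn : n = d * m) :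
    ∃ μ : Pairing ((assocSheaf N).restrict (map hd g hg hirr)) (twistingSheaf ℬ n)
        ((assocSheaf (N.shift m)).restrict (map hd g hg hirr)),
      ∀ (U : (Proj ℬ).Opens) (f : Γ(assocSheaf N, map hd g hg hirr ''ᵁ U))
        (l : Γ(twistingSheaf ℬ n, U)) (y : ProjectiveSpectrum.top 𝒜)
        (hy : y ∈ map hd g hg hirr ''ᵁ U)
        (c : Localization y.asHomogeneousIdeal.toIdeal.primeCompl), IsCoeff g l y c →
        germAt (N := N.shift m) (U := map hd g hg hirr ''ᵁ U) (μ.toFun U f l) y hy =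
          c • germAt f y hy := by
  have hex (U : (Proj ℬ).Opens) (l : Γ(twistingSheaf ℬ n, U)) (y : ProjectiveSpectrum.top 𝒜)
      (hy : y ∈ map hd g hg hirr ''ᵁ U) :
      ∃ c : Localization y.asHomogeneousIdeal.toIdeal.primeCompl, IsCoeff g l y c := by
    obtain ⟨q, hq, rfl⟩ := hy
    obtain ⟨V, hVU, hqV, i, a, s, ha, hs, w⟩ := exists_isCoeff hd g hg hirr hver hn l q hq
    exact ⟨_, (w q hqV).2⟩
  choose t ht using hex
  have huniq (U : (Proj ℬ).Opens) (l : Γ(twistingSheaf ℬ n, U)) (y : ProjectiveSpectrum.top 𝒜)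
      (hy : y ∈ map hd g hg hirr ''ᵁ U) (c) (hc : IsCoeff g l y c) : t U l y hy = c :=
    (ht U l y hy).unique hd g hg hirr hinj hver hc
  let T (U : (Proj ℬ).Opens) (f : Γ(assocSheaf N, map hd g hg hirr ''ᵁ U))
      (l : Γ(twistingSheaf ℬ n, U)) : Γ(assocSheaf (N.shift m), map hd g hg hirr ''ᵁ U) :=
    mkSection (N.shift m) (map hd g hg hirr ''ᵁ U)
      (fun y hy ↦ t U l y hy • germAt f y hy) (by
        intro x hx
        obtain ⟨q, hq, rfl⟩ := exists_preimage_opens hd g hg hirr U x hx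
        obtain ⟨V, hVU, hqV, i, a, s, ha, hs, w⟩ := exists_isCoeff hd g hg hirr hver hn l q hq
        obtain ⟨W, hWU, hxW, j, b, r, hb, hr, w'⟩ := exists_fraction f _ hx
        refine ⟨map hd g hg hirr ''ᵁ V ⊓ W, inf_le_right.trans hWU, ⟨⟨q, hqV, rfl⟩, hxW⟩, i + j,
          a • b, s * r, ?_, SetLike.GradedMul.mul_mem hs hr, ?_⟩
        · have := N.smul_mem ha hb
          have e : ((m + i : ℕ) : ℤ) + j = m + ((i + j : ℕ) : ℤ) := by push_cast; ring
          rw [e] at this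
          exact this
        · rintro y ⟨hyV, hyW⟩
          obtain ⟨hry, e1⟩ := w' y hyW
          obtain ⟨q', hq', rfl⟩ := exists_preimage_opens hd g hg hirr V y hyV
          obtain ⟨hsy, e2⟩ := w q' hq'
          refine ⟨(point hd g hg hirr q').asHomogeneousIdeal.toIdeal.primeCompl.mul_mem hsy hry, ?_⟩
          rw [huniq _ _ _ _ _ e2, e1]
          exact LocalizedModule.mk_smul_mk ..)
  have hT (U f l y hy) : germAt (T U f l) y hy = t U l y hy • germAt f y hy := rfl
  refine ⟨⟨fun U ↦ LinearMap.mk₂ Γ(Proj ℬ, U) (M := Γ((assocSheaf N).restrict _, U))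
      (Pₗ := Γ((assocSheaf (N.shift m)).restrict _, U)) (fun f l ↦ T U f l) ?_ ?_ ?_ ?_, ?_⟩, ?_⟩
  · intro f f' l
    exact section_ext fun y hy ↦ smul_add (t U l y hy) (germAt f y hy) (germAt f' y hy)
  · intro r f l
    refine section_ext fun y hy ↦ ?_
    exact smul_comm (t U l y hy) (valAt (((map hd g hg hirr).appIso U).inv r) y hy) (germAt f y hy)
  · intro f l l'
    refine section_ext fun y hy ↦ ?_
    have := huniq _ _ _ hy _ ((ht U l y hy).add hd g hg hirr hver (ht U l' y hy))
    refine (congrArg (· • germAt f y hy) this).trans ?_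
    exact add_smul _ _ _
  · intro r f l
    refine section_ext fun y hy ↦ ?_
    have := huniq _ _ _ hy _ ((ht U l y hy).smul hd g hg hirr r hy)
    refine (congrArg (· • germAt f y hy) this).trans ?_
    exact mul_smul _ _ _
  · intro U V i f l
    refine section_ext fun y hy ↦ ?_
    have hyV : y ∈ map hd g hg hirr ''ᵁ V := (map hd g hg hirr).image_mono i.le hy
    have : t U ((twistingSheaf ℬ n).presheaf.map i.op l) y hy = t V l y hyV := by
      refine ((ht V l y hyV).unique hd g hg hirr hinj hver ?_).symm
      obtain ⟨q, hq, e, hc⟩ := ht U ((twistingSheaf ℬ n).presheaf.map i.op l) y hy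
      exact ⟨q, i.le hq, e, hc⟩
    exact (congrArg (· • germAt f y hyV) this).symm
  · intro U f l y hy c hc
    exact congrArg (· • germAt f y hy) (huniq U l y hy c hc)

include hinj hver in
/-- The pullback of `N[m]` along the morphism `Proj ℬ ⟶ Proj 𝒜` induced by the inclusion of a
Veronese subring is the pullback of `N`, twisted by `d * m`. -/
lemma nonempty_restrict_shift_iso [IsDomain B] (hgen : ∀ q : ProjectiveSpectrum ℬ, ∃ u ∈ ℬ 1,
      u ∉ q.asHomogeneousIdeal.toIdeal) (N : GrMod 𝒜) {n m : ℕ} (hn : n = d * m) :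
    Nonempty ((assocSheaf (N.shift m)).restrict (map hd g hg hirr) ≅
      twist ((assocSheaf N).restrict (map hd g hg hirr)) n) := by
  obtain ⟨μ, hμ⟩ := exists_pairing hd g hg hirr hinj hver N hn
  suffices IsIso μ.desc from ⟨(asIso μ.desc).symm⟩
  refine μ.isIso_desc fun q ↦ ?_
  obtain ⟨u, hu, huq⟩ := hgen q
  refine ⟨nonvanishing ℬ u, huq, fun W hW ↦ ?_⟩
  obtain ⟨a, ha, hau⟩ := hver m (u ^ n) (by
    have := SetLike.pow_mem_graded n hu
    rw [smul_eq_mul, mul_one] at this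
    exact hn ▸ this)
  have hun : u ^ n ∈ ((GrMod.self ℬ).shift n).piece ((0 : ℕ) : ℤ) := by
    have h1 : u ^ n ∈ intPiece ℬ n := by
      have := SetLike.pow_mem_graded n hu
      rwa [smul_eq_mul, mul_one] at this
    exact (add_zero (n : ℤ)).symm ▸ h1
  have hu0 (q : ProjectiveSpectrum.top ℬ) (hq : q ∈ W) :
      u ^ n ∉ q.asHomogeneousIdeal.toIdeal := fun h ↦ hW hq (q.isPrime.mem_of_pow_mem _ h)
  have h1 (x : ProjectiveSpectrum ℬ) : (1 : B) ∉ x.asHomogeneousIdeal.toIdeal :=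
    (Ideal.ne_top_iff_one _).1 x.isPrime.ne_top
  let l : Γ(twistingSheaf ℬ n, W) :=
    fractionSection ((GrMod.self ℬ).shift n) hun SetLike.GradedOne.one_mem fun x _ ↦ h1 x
  have hl (q : ProjectiveSpectrum.top ℬ) (hq : q ∈ W) :
      twistValAt l q hq = Localization.mk (u ^ n) ⟨1, h1 q⟩ := rfl
  -- the coefficient of the generator is the unit `a`
  have hal (q : ProjectiveSpectrum.top ℬ) (hq : q ∈ W) :
      IsCoeff g l (point hd g hg hirr q) (Localization.mk a 1) := by
    refine ⟨q, hq, rfl, (Localization.localRingHom_mk ..).trans ?_⟩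
    rw [hl, Localization.mk_eq_mk_iff, Localization.r_iff_exists]
    refine ⟨1, ?_⟩
    change 1 * (1 * g a) = 1 * (g 1 * u ^ n)
    rw [hau, map_one]
  have ha0 (y : ProjectiveSpectrum.top 𝒜) (hy : y ∈ map hd g hg hirr ''ᵁ W) :
      a ∉ y.asHomogeneousIdeal.toIdeal := by
    obtain ⟨q, hq, rfl⟩ := exists_preimage_opens hd g hg hirr W y hy
    intro h
    have h' : g a ∈ q.asHomogeneousIdeal.toIdeal := h
    rw [hau] at h'
    exact hu0 q hq h'
  have hμl (f : Γ(assocSheaf N, map hd g hg hirr ''ᵁ W)) (y : ProjectiveSpectrum.top 𝒜)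
      (hy : y ∈ map hd g hg hirr ''ᵁ W) :
      germAt (N := N.shift m) (U := map hd g hg hirr ''ᵁ W) (μ.toFun W f l) y hy =
        (Localization.mk a 1 : Localization y.asHomogeneousIdeal.toIdeal.primeCompl) •
          germAt f y hy := by
    obtain ⟨q, hq, rfl⟩ := exists_preimage_opens hd g hg hirr W y hy
    exact hμ W f l _ hy _ (hal q hq)
  refine TensorProduct.lift_bijective_of_generator _ l ?_ ⟨?_, ?_⟩
  · intro l'
    obtain ⟨r, hr⟩ := exists_function (U := W)
      (fun q hq ↦ (Localization.mk 1 ⟨u ^ n, hu0 q hq⟩ :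
        Localization q.asHomogeneousIdeal.toIdeal.primeCompl) * twistValAt l' q hq) (by
        intro x hx
        obtain ⟨V, hVU, hxV, i, b, c, hb, hc, w⟩ := exists_fraction_twist l' x hx
        have hun' : u ^ n ∈ ℬ n := by simpa using SetLike.pow_mem_graded n hu
        refine ⟨V, hVU, hxV, n + i, b, u ^ n * c, hb, SetLike.GradedMul.mul_mem hun' hc,
          fun y hy ↦ ?_⟩
        obtain ⟨hcy, e⟩ := w y hy
        refine ⟨y.asHomogeneousIdeal.toIdeal.primeCompl.mul_mem
          (hu0 y (hVU hy)) hcy, ?_⟩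
        rw [e, Localization.mk_mul, one_mul]
        rfl)
    refine ⟨r, twistValAt_injective fun q hq ↦ ?_⟩
    change valAt r q hq * twistValAt l q hq = _
    rw [hr, hl, mul_assoc, mul_comm (twistValAt l' q hq)]
    exact mk_one_smul_mk_smul (M := B) ⟨u ^ n, hu0 q hq⟩ (twistValAt l' q hq)
  · intro f f' h
    refine section_ext (U := map hd g hg hirr ''ᵁ W) fun y hy ↦ ?_
    have h2 := congrArg (fun s : Γ(assocSheaf (N.shift m), map hd g hg hirr ''ᵁ W) ↦
      germAt (N := N.shift m) (U := map hd g hg hirr ''ᵁ W) s y hy) h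
    exact (mk_one_smul_mk_smul ⟨a, ha0 y hy⟩ _).symm.trans ((congrArg
      ((Localization.mk 1 ⟨a, ha0 y hy⟩ : Localization y.asHomogeneousIdeal.toIdeal.primeCompl) • ·)
      ((hμl f y hy).symm.trans (h2.trans (hμl f' y hy)))).trans (mk_one_smul_mk_smul _ _))
  · intro s
    let f : Γ(assocSheaf N, map hd g hg hirr ''ᵁ W) :=
      mkSection N (map hd g hg hirr ''ᵁ W) (fun (y : ProjectiveSpectrum.top 𝒜) hy ↦
        (Localization.mk 1 ⟨a, ha0 y hy⟩ : Localization y.asHomogeneousIdeal.toIdeal.primeCompl) •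
          germAt (N := N.shift m) (U := map hd g hg hirr ''ᵁ W) s y hy) (by
        intro x hx
        obtain ⟨V, hVU, hxV, i, b, c, hb, hc, w⟩ :=
          exists_fraction (N := N.shift m) (U := map hd g hg hirr ''ᵁ W) s x hx
        refine ⟨V, hVU, hxV, m + i, b, a * c, ?_, SetLike.GradedMul.mul_mem ha hc, fun y hy ↦ ?_⟩
        · have hb' : b ∈ N.piece ((m : ℤ) + i) := hb
          exact_mod_cast hb'
        · obtain ⟨hcy, e⟩ := w y hy
          refine ⟨y.asHomogeneousIdeal.toIdeal.primeCompl.mul_mem (ha0 y (hVU hy)) hcy, ?_⟩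
          rw [e]
          refine (LocalizedModule.mk_smul_mk ..).trans ?_
          rw [one_smul]
          rfl)
    refine ⟨f, section_ext (N := N.shift m) (U := map hd g hg hirr ''ᵁ W) fun y hy ↦ ?_⟩
    exact (hμl f y hy).trans (mk_smul_mk_one_smul (M := N.carrier) ⟨a, ha0 y hy⟩ _)

end
end ProjModule

/-! ### Shifts and twists along `ι` -/

namespace ProjModule

/-- The tensor product of sheaves of modules respects isomorphisms in the first factor. -/
def tensorSheafIso {X : Scheme.{u}} {F F' : X.Modules} (e : F ≅ F') (G : X.Modules) :
    tensorSheaf F G ≅ tensorSheaf F' G :=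
  (PresheafOfModules.sheafification (𝟙 X.ringCatSheaf.obj)).mapIso
    (@MonoidalCategory.whiskerRightIso _ _ (PresheafOfModules.monoidalCategory (R := X.presheaf))
      F.val F'.val ((SheafOfModules.forget X.ringCatSheaf).mapIso e) G.val)

end ProjModule

namespace Sl2
open MvPolynomial ProjModule

variable (k : Type u) [Field k]

lemma exists_X_notMem (q : ProjectiveSpectrum (lineGrading k)) :
    ∃ u ∈ lineGrading k 1, u ∉ q.asHomogeneousIdeal.toIdeal := by
  by_contra! h
  refine q.not_irrelevant_le fun b hb ↦ ?_
  have h0 := h (X 0) (isHomogeneous_X k 0)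
  have h1 := h (X 1) (isHomogeneous_X k 1)
  have hq0 : coeff 0 b = 0 := by
    have h1 := (HomogeneousIdeal.mem_irrelevant_iff _ _).mp hb
    rw [GradedRing.proj_apply] at h1
    have h2 : homogeneousComponent 0 b = 0 :=
      (decomposition.decompose'_apply b 0).symm.trans h1
    rw [homogeneousComponent_zero] at h2
    exact C_eq_zero.mp h2
  have hspan : b ∈ Ideal.span (X '' (Set.univ : Set (Fin 2))) := by
    refine mem_ideal_span_X_image.mpr fun m hm ↦ ?_
    by_contra! hcon
    have : m = 0 := Finsupp.ext fun i ↦ hcon i (Set.mem_univ i)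
    subst this
    exact (mem_support_iff.mp hm) hq0
  refine Ideal.span_le.mpr ?_ hspan
  rintro _ ⟨i, -, rfl⟩
  fin_cases i
  exacts [h0, h1]

/-- Pullback along `ι` turns the shift by `m` into the twist by `2 * m`. -/
lemma nonempty_pullback_shift_iso (N : GrMod (nullconeGrading k)) (m : ℕ) :
    Nonempty ((Scheme.Modules.pullback (iota k)).obj (assocSheaf (N.shift m)) ≅
      twist ((Scheme.Modules.pullback (iota k)).obj (assocSheaf N)) ((2 * m : ℕ) : ℤ)) := by
  obtain ⟨e⟩ : Nonempty ((assocSheaf (N.shift m)).restrict (iota k) ≅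
      twist ((assocSheaf N).restrict (iota k)) ((2 * m : ℕ) : ℤ)) :=
    have : IsOpenImmersion (ProjMap.map two_pos (iotaRing k) (iotaRing_mem k) (irrelevant_le k)) :=
      inferInstanceAs (IsOpenImmersion (iota k))
    nonempty_restrict_shift_iso two_pos (iotaRing k) (iotaRing_mem k) (irrelevant_le k)
      (iotaRing_injective k) (exists_iotaRing_eq k) (exists_X_notMem k) N rfl
  exact ⟨((Scheme.Modules.restrictFunctorIsoPullback (iota k)).app _).symm ≪≫ e ≪≫
    tensorSheafIso ((Scheme.Modules.restrictFunctorIsoPullback (iota k)).app _) _⟩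

end Sl2

/-! ### The restricted enveloping algebra over a commutative `k`-algebra -/

namespace Sl2
open TensorProduct

section

attribute [local instance] LieRing.ofAssociativeRing

variable (k : Type u) [Field k] (p : ℕ)

lemma adjoin_range_toRestricted :
    Algebra.adjoin k (Set.range (toRestricted k p)) = ⊤ := by
  let φ : TensorAlgebra k (sl2 k) →ₐ[k] RestrictedEnveloping k p :=
    (RingQuot.mkAlgHom k (RestrictedRel k p)).comp (UniversalEnvelopingAlgebra.mkAlgHom k (sl2 k))
  have hφ : Function.Surjective φ := by
    have h : Function.Surjective (UniversalEnvelopingAlgebra.mkAlgHom k (sl2 k)) := by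
      unfold UniversalEnvelopingAlgebra.mkAlgHom
      exact RingCon.mkₐ_surjective _
    exact (RingQuot.mkAlgHom_surjective k (RestrictedRel k p)).comp h
  have h := φ.map_adjoin (Set.range (TensorAlgebra.ι k))
  rw [TensorAlgebra.adjoin_range_ι, Algebra.map_top, (AlgHom.range_eq_top φ).2 hφ,
    ← Set.range_comp] at h
  exact h.symm

lemma toRestricted_lie (x y : sl2 k) :
    toRestricted k p ⁅x, y⁆ =
      toRestricted k p x * toRestricted k p y - toRestricted k p y * toRestricted k p x := by
  rw [toRestricted, LieHom.map_lie, Ring.lie_def, map_sub, map_mul, map_mul]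
  rfl

lemma toRestricted_pow (x y : sl2 k)
    (h : (y : Matrix (Fin 2) (Fin 2) k) = (x : Matrix (Fin 2) (Fin 2) k) ^ p) :
    toRestricted k p x ^ p = toRestricted k p y := by
  rw [toRestricted, ← map_pow]
  exact RingQuot.mkAlgHom_rel k (RestrictedRel.pow x y h)

lemma toRestricted_add (x y : sl2 k) :
    toRestricted k p (x + y) = toRestricted k p x + toRestricted k p y := by
  rw [toRestricted, map_add, map_add]; rfl

lemma toRestricted_smul (a : k) (x : sl2 k) :
    toRestricted k p (a • x) = a • toRestricted k p x := by
  rw [toRestricted, map_smul, map_smul]; rfl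

variable {k p}

/-- The universal property of the restricted enveloping algebra. -/
def restrictedLift {R : Type*} [Ring R] [Algebra k R] (F : sl2 k →ₗ[k] R)
    (hlie : ∀ x y, F ⁅x, y⁆ = F x * F y - F y * F x)
    (hF : ∀ x y : sl2 k, (y : Matrix (Fin 2) (Fin 2) k) = (x : Matrix (Fin 2) (Fin 2) k) ^ p →
      F x ^ p = F y) : RestrictedEnveloping k p →ₐ[k] R :=
  RingQuot.liftAlgHom k ⟨UniversalEnvelopingAlgebra.lift k { F with map_lie' := hlie _ _ }, by
    rintro _ _ ⟨x, y, h⟩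
    rw [map_pow, UniversalEnvelopingAlgebra.lift_ι_apply, UniversalEnvelopingAlgebra.lift_ι_apply]
    exact hF x y h⟩

lemma restrictedLift_toRestricted {R : Type*} [Ring R] [Algebra k R] (F : sl2 k →ₗ[k] R)
    (hlie) (hF) (x : sl2 k) : restrictedLift (p := p) F hlie hF (toRestricted k p x) = F x := by
  rw [restrictedLift, toRestricted, RingQuot.liftAlgHom_mkAlgHom_apply,
    UniversalEnvelopingAlgebra.lift_ι_apply]
  rfl

lemma restricted_algHom_ext {R : Type*} [Ring R] [Algebra k R]
    {φ ψ : RestrictedEnveloping k p →ₐ[k] R}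
    (h : ∀ x, φ (toRestricted k p x) = ψ (toRestricted k p x)) : φ = ψ :=
  RingQuot.ringQuot_ext' k φ ψ (UniversalEnvelopingAlgebra.hom_ext k (LieHom.ext h))

lemma sl2_lie_he : ⁅sl2H k, sl2E k⁆ = (2 : k) • sl2E k := by
  apply Subtype.ext
  rw [LieSubalgebra.coe_bracket, Ring.lie_def]
  ext i j
  fin_cases i <;> fin_cases j <;> simp [sl2H, sl2E] 
  all_goals norm_num

lemma sl2_lie_hf : ⁅sl2H k, sl2F k⁆ = (-2 : k) • sl2F k := by
  apply Subtype.ext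
  rw [LieSubalgebra.coe_bracket, Ring.lie_def]
  ext i j
  fin_cases i <;> fin_cases j <;> simp [sl2H, sl2F] 
  all_goals norm_num

lemma sl2_lie_ef : ⁅sl2E k, sl2F k⁆ = sl2H k := by
  apply Subtype.ext
  rw [LieSubalgebra.coe_bracket, Ring.lie_def]
  ext i j
  fin_cases i <;> fin_cases j <;> simp [sl2H, sl2E, sl2F]

lemma sl2_apply_one_one (x : sl2 k) : x.1 1 1 = -x.1 0 0 := by
  have h : Matrix.trace x.1 = 0 := x.2
  rw [Matrix.trace_fin_two] at h
  exact eq_neg_of_add_eq_zero_right h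

lemma sl2_eq (x : sl2 k) : x = x.1 0 1 • sl2E k + x.1 1 0 • sl2F k + x.1 0 0 • sl2H k := by
  apply Subtype.ext
  ext i j
  fin_cases i <;> fin_cases j <;> simp [sl2H, sl2E, sl2F, sl2_apply_one_one]

lemma toRestricted_eq (x : sl2 k) : toRestricted k p x = x.1 0 1 • toRestricted k p (sl2E k) +
    x.1 1 0 • toRestricted k p (sl2F k) + x.1 0 0 • toRestricted k p (sl2H k) := by
  conv_lhs => rw [sl2_eq x]
  simp only [toRestricted_add, toRestricted_smul]

lemma he_eq : toRestricted k p (sl2H k) * toRestricted k p (sl2E k) =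
    toRestricted k p (sl2E k) * toRestricted k p (sl2H k) +
      (2 : k) • toRestricted k p (sl2E k) := by
  have := toRestricted_lie k p (sl2H k) (sl2E k)
  rw [sl2_lie_he, toRestricted_smul] at this
  rw [this]; abel

lemma fh_eq : toRestricted k p (sl2F k) * toRestricted k p (sl2H k) =
    toRestricted k p (sl2H k) * toRestricted k p (sl2F k) +
      (2 : k) • toRestricted k p (sl2F k) := by
  have := toRestricted_lie k p (sl2H k) (sl2F k)
  rw [sl2_lie_hf, toRestricted_smul, neg_smul] at this
  rw [← sub_eq_iff_eq_add', ← neg_sub, ← this, neg_neg]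

lemma fe_eq : toRestricted k p (sl2F k) * toRestricted k p (sl2E k) =
    toRestricted k p (sl2E k) * toRestricted k p (sl2F k) - toRestricted k p (sl2H k) := by
  have := toRestricted_lie k p (sl2E k) (sl2F k)
  rw [sl2_lie_ef] at this
  rw [this]; abel

variable (p) {C C' : Type*} [CommRing C] [Algebra k C] [CommRing C'] [Algebra k C']

/-- The element of `C ⊗ u(sl₂)` corresponding to a trace zero matrix over `C`. -/
def thetaElem (N : Matrix (Fin 2) (Fin 2) C) : C ⊗[k] RestrictedEnveloping k p :=
  N 0 1 ⊗ₜ toRestricted k p (sl2E k) + N 1 0 ⊗ₜ toRestricted k p (sl2F k) +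
    N 0 0 ⊗ₜ toRestricted k p (sl2H k)

lemma thetaElem_add (N N' : Matrix (Fin 2) (Fin 2) C) :
    thetaElem (k := k) p (N + N') = thetaElem p N + thetaElem p N' := by
  simp only [thetaElem, Matrix.add_apply, add_tmul]; abel

lemma thetaElem_smul (a : C) (N : Matrix (Fin 2) (Fin 2) C) :
    thetaElem (k := k) p (a • N) = a • thetaElem p N := by
  simp only [thetaElem, Matrix.smul_apply, smul_add, smul_tmul']

lemma thetaElem_map (φ : C →ₐ[k] C') (N : Matrix (Fin 2) (Fin 2) C) :
    Algebra.TensorProduct.map φ (AlgHom.id k (RestrictedEnveloping k p)) (thetaElem p N) =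
      thetaElem p (N.map φ) := by
  simp [thetaElem]

lemma thetaElem_coe (x : sl2 k) :
    thetaElem p (x.1.map (algebraMap k C)) = 1 ⊗ₜ toRestricted k p x := by
  rw [toRestricted_eq]
  simp only [thetaElem, Matrix.map_apply, tmul_add, tmul_smul, ← smul_tmul',
    Algebra.algebraMap_eq_smul_one]

lemma thetaElem_lie (N N' : Matrix (Fin 2) (Fin 2) C) (hN : N 1 1 = -N 0 0)
    (hN' : N' 1 1 = -N' 0 0) :
    thetaElem (k := k) p (N * N' - N' * N) =
      thetaElem p N * thetaElem p N' - thetaElem p N' * thetaElem p N := by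
  have h1 := congrArg (fun t ↦ (1 : C) ⊗ₜ[k] t) (he_eq (k := k) (p := p))
  have h2 := congrArg (fun t ↦ (1 : C) ⊗ₜ[k] t) (fh_eq (k := k) (p := p))
  have h3 := congrArg (fun t ↦ (1 : C) ⊗ₜ[k] t) (fe_eq (k := k) (p := p))
  simp only [tmul_add, tmul_sub, ofNat_smul_eq_nsmul, tmul_smul] at h1 h2 h3
  have hs (a : C) (t : RestrictedEnveloping k p) : a ⊗ₜ[k] t = a • ((1 : C) ⊗ₜ[k] t) := by
    rw [smul_tmul', smul_eq_mul, mul_one]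
  simp only [thetaElem, Matrix.sub_apply, Matrix.mul_apply, Fin.sum_univ_two, hN, hN', add_mul,
    mul_add, Algebra.TensorProduct.tmul_mul_tmul]
  simp only [hs (_ * _), hs (_ - _), h1, h2, h3]
  module

/-- Over an infinite field, a polynomial with coefficients in a vector space vanishes if all its
values do. -/
lemma eq_zero_of_forall_eval {σ V : Type*} [AddCommGroup V] [Module k V] [Infinite k]
    (t : MvPolynomial σ k ⊗[k] V)
    (h : ∀ α : σ → k, LinearMap.rTensor V (MvPolynomial.aeval α).toLinearMap t = 0) : t = 0 := by
  let b := Module.Basis.ofVectorSpace k V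
  refine (Algebra.TensorProduct.basis (MvPolynomial σ k) b).repr.injective (Finsupp.ext fun i ↦ ?_)
  rw [map_zero, Finsupp.zero_apply]
  refine MvPolynomial.funext fun α ↦ ?_
  have key (t : MvPolynomial σ k ⊗[k] V) : MvPolynomial.eval α
      ((Algebra.TensorProduct.basis (MvPolynomial σ k) b).repr t i) =
      (Algebra.TensorProduct.basis k b).repr
        (LinearMap.rTensor V (MvPolynomial.aeval α).toLinearMap t) i := by
    induction t with
    | zero => simp
    | add x y hx hy => simp only [map_add, Finsupp.add_apply, hx, hy]
    | tmul q v =>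
      rw [LinearMap.rTensor_tmul, Algebra.TensorProduct.basis_repr_tmul,
        Algebra.TensorProduct.basis_repr_tmul]
      simp [MvPolynomial.aeval_eq_eval, MvPolynomial.algebraMap_eq]
  rw [key, h, map_zero, map_zero, Finsupp.zero_apply]

/-- The `p`-operation preserves `sl₂`. -/
lemma trace_pow_char [Fact p.Prime] [CharP k p] (N : Matrix (Fin 2) (Fin 2) k)
    (hN : N 1 1 = -N 0 0) : (N ^ p).trace = 0 := by
  have h2 : N ^ 2 = (N 0 0 ^ 2 + N 0 1 * N 1 0) • (1 : Matrix (Fin 2) (Fin 2) k) := by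
    rw [pow_two]
    ext i j
    fin_cases i <;> fin_cases j <;> simp [Matrix.mul_apply, Fin.sum_univ_two, hN] <;> ring
  rcases (Fact.out : p.Prime).eq_two_or_odd' with rfl | ⟨m, rfl⟩
  · rw [h2, Matrix.trace_smul, Matrix.trace_one, Fintype.card_fin]
    have : ((2 : ℕ) : k) = 0 := CharP.cast_eq_zero k 2
    rw [this, smul_zero]
  · rw [pow_succ, pow_mul, h2, smul_pow, one_pow, smul_mul_assoc, one_mul, Matrix.trace_smul,
      Matrix.trace_fin_two, hN, add_neg_cancel, smul_zero]

/-- The restricted structure of `C ⊗ sl₂`. The coefficients of both sides are polynomials in the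
entries of the matrix, so that it suffices to compare them over the infinite field `k`. -/
lemma thetaElem_pow [Infinite k] [Fact p.Prime] [CharP k p] (N : Matrix (Fin 2) (Fin 2) C)
    (hN : N 1 1 = -N 0 0) : thetaElem (k := k) p N ^ p = thetaElem p (N ^ p) := by
  let R := MvPolynomial (Fin 3) k
  let G : Matrix (Fin 2) (Fin 2) R :=
    !![MvPolynomial.X 0, MvPolynomial.X 1; MvPolynomial.X 2, -MvPolynomial.X 0]
  have hG : thetaElem (k := k) p G ^ p = thetaElem p (G ^ p) := by
    refine sub_eq_zero.1 (eq_zero_of_forall_eval _ fun α ↦ ?_)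
    let ev : R →ₐ[k] k := MvPolynomial.aeval α
    let x : sl2 k := ⟨G.map ev, by
      change Matrix.trace (G.map ev) = 0
      rw [Matrix.trace_fin_two]
      simp [G]⟩
    let y : sl2 k := ⟨G.map ev ^ p, trace_pow_char p _ (by simp [G])⟩
    change Algebra.TensorProduct.map ev (AlgHom.id k (RestrictedEnveloping k p)) _ = 0
    rw [map_sub, map_pow, thetaElem_map, thetaElem_map]
    have hx : thetaElem p (G.map ev) = 1 ⊗ₜ[k] toRestricted k p x := thetaElem_coe p (C := k) x
    have hy : thetaElem p ((G ^ p).map ev) = 1 ⊗ₜ[k] toRestricted k p y := by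
      refine Eq.trans ?_ (thetaElem_coe p (C := k) y)
      congr 1
      exact map_pow (AlgHom.mapMatrix (m := Fin 2) ev) G p
    rw [hx, hy, Algebra.TensorProduct.tmul_pow, one_pow, toRestricted_pow k p x y rfl, sub_self]
  let φ : R →ₐ[k] C := MvPolynomial.aeval ![N 0 0, N 0 1, N 1 0]
  have hφ : G.map φ = N := by
    ext i j
    fin_cases i <;> fin_cases j <;> simp [G, φ, hN] <;>
      exact MvPolynomial.aeval_X _ _
  have := congrArg (Algebra.TensorProduct.map φ (AlgHom.id k (RestrictedEnveloping k p))) hG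
  rw [map_pow, thetaElem_map, thetaElem_map, hφ] at this
  rw [this]
  congr 1
  rw [← hφ]
  exact map_pow (AlgHom.mapMatrix (m := Fin 2) φ) G p

lemma conj_apply_one_one {g g' : Matrix (Fin 2) (Fin 2) C} (hg : g' * g = 1)
    {N : Matrix (Fin 2) (Fin 2) C} (hN : N 1 1 = -N 0 0) :
    (g * N * g') 1 1 = -(g * N * g') 0 0 := by
  have h : (g * N * g').trace = 0 := by
    rw [Matrix.trace_mul_comm, ← mul_assoc, hg, one_mul, Matrix.trace_fin_two, hN, add_neg_cancel]
  rw [Matrix.trace_fin_two] at h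
  exact eq_neg_of_add_eq_zero_right h

lemma map_apply_one_one (x : sl2 k) :
    (x.1.map (algebraMap k C)) 1 1 = -(x.1.map (algebraMap k C)) 0 0 := by
  simp [sl2_apply_one_one]

/-- The homomorphism `u(sl₂) → C ⊗ u(sl₂)` induced by `x ↦ g x g'`, where `g'` is the inverse
of the matrix `g` over `C`. -/
def conjAux [Infinite k] [Fact p.Prime] [CharP k p] (g g' : Matrix (Fin 2) (Fin 2) C)
    (hg : g' * g = 1) : RestrictedEnveloping k p →ₐ[k] C ⊗[k] RestrictedEnveloping k p :=
  restrictedLift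
    { toFun x := thetaElem p (g * x.1.map (algebraMap k C) * g')
      map_add' x y := by
        rw [← thetaElem_add, ← add_mul, ← mul_add]
        congr 3
        exact map_add (algebraMap k C).mapMatrix x.1 y.1
      map_smul' a x := by
        have : ((a • x).1.map (algebraMap k C)) = algebraMap k C a • x.1.map (algebraMap k C) := by
          ext; simp
        rw [this, mul_smul_comm, smul_mul_assoc, thetaElem_smul, algebraMap_smul]
        rfl }
    (fun x y ↦ by
        change thetaElem p _ = thetaElem p _ * thetaElem p _ - thetaElem p _ * thetaElem p _
        rw [← thetaElem_lie p _ _ (conj_apply_one_one hg (map_apply_one_one x))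
          (conj_apply_one_one hg (map_apply_one_one y))]
        congr 1
        have h1 : ⁅x, y⁆.1.map (algebraMap k C) = x.1.map (algebraMap k C) *
            y.1.map (algebraMap k C) - y.1.map (algebraMap k C) * x.1.map (algebraMap k C) := by
          rw [LieSubalgebra.coe_bracket, Ring.lie_def]
          exact (map_sub (algebraMap k C).mapMatrix _ _).trans
            congr($(map_mul (algebraMap k C).mapMatrix _ _) -
              $(map_mul (algebraMap k C).mapMatrix _ _))
        have h2 (a b : Matrix (Fin 2) (Fin 2) C) :
            g * a * g' * (g * b * g') = g * (a * b) * g' := by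
          calc _ = g * a * (g' * g) * b * g' := by noncomm_ring
            _ = _ := by rw [hg]; noncomm_ring
        rw [h1, h2, h2, mul_sub, sub_mul])
    fun x y hxy ↦ by
      change thetaElem p _ ^ p = thetaElem p _
      rw [thetaElem_pow p _ (conj_apply_one_one hg (map_apply_one_one x))]
      congr 1
      have h1 : y.1.map (algebraMap k C) = x.1.map (algebraMap k C) ^ p := by
        rw [hxy]
        exact map_pow (algebraMap k C).mapMatrix _ _
      have h2 (a : Matrix (Fin 2) (Fin 2) C) (n : ℕ) :
          (g * a * g') ^ (n + 1) = g * a ^ (n + 1) * g' := by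
        induction n with
        | zero => simp
        | succ n ih =>
          rw [pow_succ, ih]
          calc _ = g * a ^ (n + 1) * (g' * g) * a * g' := by noncomm_ring
            _ = _ := by rw [hg, mul_one, pow_succ a (n + 1), ← mul_assoc g]
      obtain ⟨n, hn⟩ : ∃ n, p = n + 1 := ⟨p - 1, by have := (Fact.out : p.Prime).pos; lia⟩
      rw [h1, hn, h2]

/-- Conjugation by a matrix over `C`, as an endomorphism of `C ⊗ u(sl₂)`. -/
def conj [Infinite k] [Fact p.Prime] [CharP k p] (g g' : Matrix (Fin 2) (Fin 2) C)
    (hg : g' * g = 1) : C ⊗[k] RestrictedEnveloping k p →ₐ[C] C ⊗[k] RestrictedEnveloping k p :=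
  Algebra.TensorProduct.lift (Algebra.ofId C _) (conjAux p g g' hg) fun c _ ↦
    show Commute (algebraMap C _ c) _ from Algebra.commutes c _

lemma conj_one_tmul [Infinite k] [Fact p.Prime] [CharP k p] (g g' : Matrix (Fin 2) (Fin 2) C)
    (hg : g' * g = 1) (x : sl2 k) :
    conj p g g' hg (1 ⊗ₜ toRestricted k p x) =
      thetaElem p (g * x.1.map (algebraMap k C) * g') := by
  refine (Algebra.TensorProduct.lift_tmul ..).trans ?_
  rw [map_one, one_mul]
  exact restrictedLift_toRestricted _ _ _ x

lemma conj_thetaElem [Infinite k] [Fact p.Prime] [CharP k p] (g g' : Matrix (Fin 2) (Fin 2) C)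
    (hg : g' * g = 1) (N : Matrix (Fin 2) (Fin 2) C) (hN : N 1 1 = -N 0 0) :
    conj (k := k) p g g' hg (thetaElem p N) = thetaElem p (g * N * g') := by
  have h (a : C) (x : sl2 k) : conj p g g' hg (a ⊗ₜ toRestricted k p x) =
      thetaElem p (g * (a • x.1.map (algebraMap k C)) * g') := by
    rw [mul_smul_comm, smul_mul_assoc, thetaElem_smul, ← conj_one_tmul, ← map_smul, smul_tmul',
      smul_eq_mul, mul_one]
  rw [thetaElem, map_add, map_add, h, h, h, ← thetaElem_add, ← thetaElem_add, ← add_mul, ← mul_add,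
    ← add_mul, ← mul_add]
  congr 3
  ext i j
  fin_cases i <;> fin_cases j <;> simp [sl2H, sl2E, sl2F, hN]

lemma conj_conj [Infinite k] [Fact p.Prime] [CharP k p] (g g' : Matrix (Fin 2) (Fin 2) C)
    (hg : g' * g = 1) (hg' : g * g' = 1) (t : C ⊗[k] RestrictedEnveloping k p) :
    conj p g g' hg (conj p g' g hg' t) = t := by
  have : (conj p g g' hg).comp (conj p g' g hg') =
      AlgHom.id C (C ⊗[k] RestrictedEnveloping k p) := by
    refine Algebra.TensorProduct.ext (by ext) (restricted_algHom_ext fun x ↦ ?_)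
    change conj p g g' hg (conj p g' g hg' (1 ⊗ₜ toRestricted k p x)) = 1 ⊗ₜ toRestricted k p x
    rw [conj_one_tmul, conj_thetaElem _ _ _ _ _ (conj_apply_one_one hg' (map_apply_one_one x)),
      ← thetaElem_coe]
    congr 1
    calc _ = (g * g') * x.1.map (algebraMap k C) * (g * g') := by noncomm_ring
      _ = _ := by rw [hg', one_mul, mul_one]
  exact congr($this t)

end

end Sl2

/-! ### An action of `u(sl₂)` on polynomials -/

namespace Sl2
open MvPolynomial TensorProduct

section

attribute [local instance] LieRing.ofAssociativeRing

variable (k : Type u) [Field k] (p : ℕ)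

/-- The derivation of the coordinate ring `k[X_{ia}]` of two copies of the natural representation
of `2 × 2` matrices that extends the action of the matrix `N` on the `X_{0a}, X_{1a}`. -/
def matDer (N : Matrix (Fin 2) (Fin 2) k) :
    Derivation k (MvPolynomial (Fin 2 × Fin 2) k) (MvPolynomial (Fin 2 × Fin 2) k) :=
  mkDerivation k fun i ↦ ∑ j, C (N j i.1) * X (j, i.2)

variable {k}

lemma matDer_X (N : Matrix (Fin 2) (Fin 2) k) (i : Fin 2 × Fin 2) :
    matDer k N (X i) = ∑ j, C (N j i.1) * X (j, i.2) := mkDerivation_X _ _ _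

lemma matDer_lie (N N' : Matrix (Fin 2) (Fin 2) k) :
    matDer k (N * N' - N' * N) = ⁅matDer k N, matDer k N'⁆ := by
  refine derivation_ext fun i ↦ ?_
  rw [Derivation.commutator_apply, matDer_X, matDer_X, matDer_X]
  simp only [map_sum, Derivation.leibniz, Derivation.map_algebraMap, matDer_X, smul_eq_mul,
    ← algebraMap_eq, mul_zero, add_zero]
  simp only [Matrix.sub_apply, Matrix.mul_apply, Fin.sum_univ_two, algebraMap_eq, C_add,
    C_mul, C_sub]
  ring

/-- In characteristic `p`, the `p`-th power of a derivation satisfies the Leibniz rule. -/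
lemma _root_.Derivation.pow_char_leibniz {R A : Type*} [CommRing R] [CommRing A] [Algebra R A]
    (p : ℕ) [Fact p.Prime] [CharP R p] (D : Derivation R A A) (a b : A) :
    ((D : A →ₗ[R] A) ^ p) (a * b) = a * ((D : A →ₗ[R] A) ^ p) b + b * ((D : A →ₗ[R] A) ^ p) a := by
  let x : Module.End R (TensorProduct R A A) := LinearMap.rTensor A (D : A →ₗ[R] A)
  let y : Module.End R (TensorProduct R A A) := LinearMap.lTensor A (D : A →ₗ[R] A)
  have hxy : Commute x y := by
    change x ∘ₗ y = y ∘ₗ x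
    rw [LinearMap.rTensor_comp_lTensor, LinearMap.lTensor_comp_rTensor]
  have hp : (x + y) ^ p = x ^ p + y ^ p := by
    obtain ⟨r, hr⟩ := hxy.exists_add_pow_prime_eq (Fact.out : p.Prime)
    rw [hr, add_eq_left]
    have : ((p : ℕ) : Module.End R (TensorProduct R A A)) = 0 := by
      rw [← map_natCast (algebraMap R (Module.End R (TensorProduct R A A))), CharP.cast_eq_zero,
        map_zero]
    rw [this, zero_mul, zero_mul, zero_mul]
  have hD (n : ℕ) (t : TensorProduct R A A) : LinearMap.mul' R A (((x + y) ^ n) t) =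
      ((D : A →ₗ[R] A) ^ n) (LinearMap.mul' R A t) := by
    induction n generalizing t with
    | zero => rfl
    | succ n ih =>
      rw [pow_succ, pow_succ, Module.End.mul_apply, Module.End.mul_apply, ih]
      congr 1
      induction t with
      | zero => simp
      | add a b ha hb => rw [map_add, map_add, map_add, map_add, ha, hb]
      | tmul a b => simp [x, y]; ring
  have := hD p (a ⊗ₜ b)
  have hx : x ^ p = LinearMap.rTensor A ((D : A →ₗ[R] A) ^ p) := LinearMap.rTensor_pow ..
  have hy : y ^ p = LinearMap.lTensor A ((D : A →ₗ[R] A) ^ p) := LinearMap.lTensor_pow ..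
  rw [hp, hx, hy, LinearMap.add_apply, map_add, LinearMap.rTensor_tmul,
    LinearMap.lTensor_tmul] at this
  simp only [LinearMap.mul'_apply] at this
  rw [← this]
  ring

/-- The linear map underlying `matDer`. -/
def matEnd (N : Matrix (Fin 2) (Fin 2) k) : Module.End k (MvPolynomial (Fin 2 × Fin 2) k) :=
  (matDer k N).toLinearMap

lemma matEnd_pow [Fact p.Prime] [CharP k p] (N : Matrix (Fin 2) (Fin 2) k) :
    matEnd N ^ p = matEnd (N ^ p) := by
  let D' : Derivation k (MvPolynomial (Fin 2 × Fin 2) k) (MvPolynomial (Fin 2 × Fin 2) k) :=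
    Derivation.mk' (matEnd N ^ p) fun a b ↦ Derivation.pow_char_leibniz p _ a b
  suffices D' = matDer k (N ^ p) from
    LinearMap.ext fun q ↦ congrArg (fun D : Derivation k _ _ ↦ D q) this
  refine derivation_ext fun i ↦ ?_
  have key (n : ℕ) : (matEnd N ^ n) (X i) = matDer k (N ^ n) (X i) := by
    induction n with
    | zero =>
      rw [pow_zero, pow_zero, matDer_X, Module.End.one_apply]
      simp [Matrix.one_apply]
    | succ n ih =>
      rw [pow_succ', Module.End.mul_apply, ih, matDer_X, matDer_X]
      change matDer k N _ = _
      simp only [Fin.sum_univ_two, map_add, Derivation.leibniz, matDer_X, smul_eq_mul,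
        derivation_C, mul_zero, add_zero, pow_succ', Matrix.mul_apply, C_mul]
      ring
  exact key p

/-- The action of `u(sl₂)` on `k[X_{ia}]` by derivations. Two copies of the natural representation
are used so that the weights of the vectors `X_{10}^{p-1} X_{11}^r` exhaust the prime field. -/
def polyRep [Fact p.Prime] [CharP k p] :
    RestrictedEnveloping k p →ₐ[k] Module.End k (MvPolynomial (Fin 2 × Fin 2) k) :=
  restrictedLift
    { toFun x := matEnd x.1
      map_add' x y := by
        have : matDer k (x + y).1 = matDer k x.1 + matDer k y.1 := by
          refine derivation_ext fun i ↦ ?_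
          rw [Derivation.add_apply, matDer_X, matDer_X, matDer_X]
          simp [Fin.sum_univ_two]
          ring
        rw [matEnd, this]
        rfl
      map_smul' a x := by
        have : matDer k (a • x).1 = a • matDer k x.1 := by
          refine derivation_ext fun i ↦ ?_
          rw [Derivation.smul_apply, matDer_X, matDer_X]
          simp [Fin.sum_univ_two, smul_eq_C_mul]
          ring
        rw [matEnd, this]
        rfl }
    (fun x y ↦ by
      change matEnd _ = matEnd _ * matEnd _ - matEnd _ * matEnd _
      rw [LieSubalgebra.coe_bracket, Ring.lie_def, matEnd, matDer_lie]
      exact Derivation.commutator_coe_linear_map)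
    fun x y h ↦ by
      change matEnd _ ^ p = matEnd _
      rw [matEnd_pow, h]

lemma polyRep_toRestricted [Fact p.Prime] [CharP k p] (x : sl2 k)
    (q : MvPolynomial (Fin 2 × Fin 2) k) :
    polyRep p (toRestricted k p x) q = matDer k x.1 q := by
  rw [polyRep, restrictedLift_toRestricted]
  rfl

lemma matDer_E (i : Fin 2 × Fin 2) :
    matDer k (sl2E k).1 (X i) = if i.1 = 0 then 0 else X (0, i.2) := by
  obtain ⟨i, a⟩ := i
  rw [matDer_X]
  fin_cases i <;> simp [sl2E, Fin.sum_univ_two]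

lemma matDer_F (i : Fin 2 × Fin 2) :
    matDer k (sl2F k).1 (X i) = if i.1 = 0 then X (1, i.2) else 0 := by
  obtain ⟨i, a⟩ := i
  rw [matDer_X]
  fin_cases i <;> simp [sl2F, Fin.sum_univ_two]

lemma matDer_H (i : Fin 2 × Fin 2) :
    matDer k (sl2H k).1 (X i) = if i.1 = 0 then X i else -X i := by
  obtain ⟨i, a⟩ := i
  rw [matDer_X]
  fin_cases i <;> simp [sl2H, Fin.sum_univ_two]

section
variable [Fact p.Prime] [CharP k p]

lemma polyRep_F_pow (m r n : ℕ) (hn : n ≤ m) :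
    polyRep p (toRestricted k p (sl2F k) ^ n) (X (0, 0) ^ m * X (1, 1) ^ r) =
      (m.descFactorial n : MvPolynomial (Fin 2 × Fin 2) k) *
        (X (0, 0) ^ (m - n) * X (1, 0) ^ n * X (1, 1) ^ r) := by
  induction n with
  | zero => simp
  | succ n ih =>
    rw [pow_succ', map_mul (polyRep p), Module.End.mul_apply, ih (by lia), polyRep_toRestricted,
      Nat.descFactorial_succ]
    obtain ⟨l, hl⟩ : ∃ l, m - n = l + 1 := ⟨m - n - 1, by lia⟩
    rw [show m - (n + 1) = l by lia, hl]
    simp [Derivation.leibniz, Derivation.leibniz_pow, matDer_F]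
    ring

lemma polyRep_E_pow (m r n : ℕ) (hn : n ≤ m) :
    polyRep p (toRestricted k p (sl2E k) ^ n) (X (1, 0) ^ m * X (1, 1) ^ r) -
      (m.descFactorial n : MvPolynomial (Fin 2 × Fin 2) k) *
        (X (0, 0) ^ n * X (1, 0) ^ (m - n) * X (1, 1) ^ r) ∈
      Ideal.span {(X (0, 1) : MvPolynomial (Fin 2 × Fin 2) k)} := by
  induction n with
  | zero => simp
  | succ n ih =>
    obtain ⟨b, hb⟩ := Ideal.mem_span_singleton.1 (ih (by lia))
    rw [sub_eq_iff_eq_add] at hb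
    rw [pow_succ', map_mul (polyRep p), Module.End.mul_apply, hb, polyRep_toRestricted,
      Nat.descFactorial_succ]
    obtain ⟨l, hl⟩ : ∃ l, m - n = l + 1 := ⟨m - n - 1, by lia⟩
    rw [show m - (n + 1) = l by lia, hl]
    refine Ideal.mem_span_singleton.2 ⟨matDer k (sl2E k).1 b +
      (m.descFactorial n : MvPolynomial (Fin 2 × Fin 2) k) * (X (0, 0) ^ n * X (1, 0) ^ (l + 1) *
        ((r : MvPolynomial (Fin 2 × Fin 2) k) * X (1, 1) ^ (r - 1))), ?_⟩
    simp [Derivation.leibniz, Derivation.leibniz_pow, matDer_E]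
    ring

lemma polyRep_aeval_H (q : Polynomial k) (m r : ℕ) :
    polyRep p (Polynomial.aeval (toRestricted k p (sl2H k)) q) (X (1, 0) ^ m * X (1, 1) ^ r) =
      q.eval (-(m + r : k)) • (X (1, 0) ^ m * X (1, 1) ^ r) := by
  have h : polyRep p (toRestricted k p (sl2H k)) (X (1, 0) ^ m * X (1, 1) ^ r) =
      (-(m + r : k)) • (X (1, 0) ^ m * X (1, 1) ^ r) := by
    have hD (a : Fin 2) (m : ℕ) : matDer k (sl2H k).1 (X (1, a) ^ m) =
        -((m : MvPolynomial (Fin 2 × Fin 2) k) * X (1, a) ^ m) := by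
      induction m with
      | zero => simp
      | succ m ih =>
        rw [pow_succ, Derivation.leibniz, ih, matDer_H]
        simp
        ring
    rw [polyRep_toRestricted, smul_eq_C_mul, Derivation.leibniz, hD, hD]
    simp
    ring
  rw [← Polynomial.aeval_algHom_apply]
  refine Module.End.aeval_apply_of_hasEigenvector ⟨Module.End.mem_eigenspace_iff.2 h, ?_⟩
  exact mul_ne_zero (pow_ne_zero _ (X_ne_zero _)) (pow_ne_zero _ (X_ne_zero _))

/-- The vector `X_{00}^{p-1} X_{11}^r` is sent by `f ^ (p - 1)` to a nonzero multiple of the weight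
vector `X_{10}^{p-1} X_{11}^r`, and `e ^ (p - 1)` does not kill the latter, as is seen modulo
`X_{01}`. -/
lemma eval_eq_zero_of_E_pow_mul_F_pow (q : Polynomial k)
    (h : toRestricted k p (sl2E k) ^ (p - 1) * Polynomial.aeval (toRestricted k p (sl2H k)) q *
      toRestricted k p (sl2F k) ^ (p - 1) = 0) (r : ℕ) : q.eval (1 - r : k) = 0 := by
  have hp := (Fact.out : p.Prime).pos
  have h1 := congr(polyRep p $h (X (0, 0) ^ (p - 1) * X (1, 1) ^ r))
  rw [map_mul (polyRep p), map_mul (polyRep p), map_zero, Module.End.mul_apply,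
    Module.End.mul_apply, polyRep_F_pow _ _ _ _ le_rfl, Nat.sub_self, pow_zero, one_mul,
    Nat.descFactorial_self, ← nsmul_eq_mul, map_nsmul, polyRep_aeval_H, map_nsmul, map_smul,
    LinearMap.zero_apply] at h1
  have h2 := polyRep_E_pow (k := k) p (p - 1) r (p - 1) le_rfl
  obtain ⟨b, hb⟩ := Ideal.mem_span_singleton.1 h2
  rw [sub_eq_iff_eq_add] at hb
  rw [hb] at h1
  have h3 := congrArg
    (MvPolynomial.eval fun i : Fin 2 × Fin 2 ↦ if i = (0, 1) then (0 : k) else 1) h1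
  have hfac : ((p - 1).factorial : k) ≠ 0 := by
    rw [Ne, CharP.cast_eq_zero_iff k p, (Fact.out : p.Prime).dvd_factorial]
    lia
  simp [smul_eq_C_mul, Nat.descFactorial_self, hfac] at h3
  rw [← h3]
  congr 1
  rw [Nat.cast_sub hp, CharP.cast_eq_zero k p]
  ring

/-- Here `q` vanishes on the prime field, so that it is divisible by `X ^ p - X`, of which `h` is a
root. -/
lemma aeval_H_eq_zero (q : Polynomial k)
    (h : toRestricted k p (sl2E k) ^ (p - 1) * Polynomial.aeval (toRestricted k p (sl2H k)) q *
      toRestricted k p (sl2F k) ^ (p - 1) = 0) :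
    Polynomial.aeval (toRestricted k p (sl2H k)) q = 0 := by
  have hp := (Fact.out : p.Prime)
  have heval := eval_eq_zero_of_E_pow_mul_F_pow p q h
  have hmonic : (Polynomial.X ^ p - Polynomial.X : Polynomial k).Monic :=
    Polynomial.monic_X_pow_sub (by simpa using hp.one_lt)
  have hH : Polynomial.aeval (toRestricted k p (sl2H k))
      (Polynomial.X ^ p - Polynomial.X : Polynomial k) = 0 := by
    rw [map_sub, map_pow, Polynomial.aeval_X, toRestricted_pow k p (sl2H k) (sl2H k), sub_self]
    have : sl2H k = Matrix.diagonal ![(1 : k), -1] := by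
      ext i j
      fin_cases i <;> fin_cases j <;> rfl
    rw [this, Matrix.diagonal_pow]
    congr 1
    ext i
    fin_cases i
    · simp
    · rcases hp.eq_two_or_odd' with rfl | ho
      · have : (2 : k) = 0 := CharP.cast_eq_zero k 2
        simp
        linear_combination -this
      · simp [ho.neg_one_pow]
  let f := ZMod.castHom (dvd_refl p) k
  have hf (z : ZMod p) : q.eval (f z) = 0 := by
    have := heval (1 - z).val
    rw [← map_natCast f, ZMod.natCast_zmod_val, map_sub, map_one] at this
    rwa [sub_sub_cancel] at this
  have hrem : q %ₘ (Polynomial.X ^ p - Polynomial.X) = 0 := by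
    refine Polynomial.eq_zero_of_natDegree_lt_card_of_eval_eq_zero _ f.injective (fun z ↦ ?_) ?_
    · have h1 := congrArg (Polynomial.eval (f z))
        (Polynomial.modByMonic_add_div q (Polynomial.X ^ p - Polynomial.X))
      rw [Polynomial.eval_add, Polynomial.eval_mul, hf] at h1
      have : Polynomial.eval (f z) (Polynomial.X ^ p - Polynomial.X) = 0 := by
        simp [← map_pow, ZMod.pow_card]
      rwa [this, zero_mul, add_zero] at h1
    · rw [ZMod.card]
      have h1 : (Polynomial.X ^ p - Polynomial.X : Polynomial k).natDegree = p := by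
        exact FiniteField.X_pow_card_sub_X_natDegree_eq k hp.one_lt
      have := Polynomial.natDegree_modByMonic_lt q hmonic (by
        intro h
        rw [h, Polynomial.natDegree_one] at h1
        exact hp.ne_zero h1.symm)
      rwa [h1] at this
  rw [← Polynomial.modByMonic_add_div q (Polynomial.X ^ p - Polynomial.X), hrem, zero_add, map_mul,
    hH, zero_mul]

end

end

end Sl2

/-! ### The left annihilator of `e` in `u(sl₂)` -/

/-- An operator whose kernel is contained in the image of its `(p - 1)`-st power has all its Jordan
blocks of size `p`. -/
lemma Module.End.exists_pow_apply_eq_of_ker_le {R M : Type*} [Semiring R] [AddCommGroup M]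
    [Module R M] {T : Module.End R M} {p : ℕ} (h : ∀ v, T v = 0 → ∃ w, (T ^ (p - 1)) w = v)
    {j : ℕ} (hj : j ≤ p) {v : M} (hv : (T ^ j) v = 0) : ∃ w, (T ^ (p - j)) w = v := by
  induction j generalizing v with
  | zero => exact ⟨0, (map_zero _).trans (by simpa using hv.symm)⟩
  | succ j ih =>
    rw [pow_succ, Module.End.mul_apply] at hv
    obtain ⟨b, hb⟩ := ih (by lia) hv
    obtain ⟨l, hl⟩ : ∃ l, p - j = l + 1 := ⟨p - j - 1, by lia⟩
    obtain ⟨c, hc⟩ := h (v - (T ^ l) b) (by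
      rw [map_sub, ← hb, hl, pow_succ', Module.End.mul_apply, sub_self])
    refine ⟨b + (T ^ j) c, ?_⟩
    rw [show p - (j + 1) = l by lia, map_add, ← Module.End.mul_apply, ← pow_add,
      show l + j = p - 1 by lia, hc, add_sub_cancel]

namespace Sl2
open TensorProduct Polynomial

section
variable (k : Type u) [Field k] (p : ℕ)

lemma f_mul_aeval (q : k[X]) : toRestricted k p (sl2F k) * aeval (toRestricted k p (sl2H k)) q =
    aeval (toRestricted k p (sl2H k)) (q.comp (X + C 2)) * toRestricted k p (sl2F k) := by
  induction q using Polynomial.induction_on' with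
  | add q q' h h' => rw [map_add, mul_add, h, h', add_comp, map_add, add_mul]
  | monomial n a =>
    have h1 : SemiconjBy (toRestricted k p (sl2F k)) (toRestricted k p (sl2H k))
        (toRestricted k p (sl2H k) + algebraMap k _ 2) := by
      rw [SemiconjBy, fh_eq, add_mul, ← Algebra.smul_def]
    have h2 := (h1.pow_right n).eq
    rw [aeval_monomial, monomial_comp, map_mul, aeval_C, map_pow, map_add, aeval_X, aeval_C,
      ← mul_assoc, ← Algebra.commutes, mul_assoc, h2, mul_assoc]

lemma h_mul_e_pow (i : ℕ) : toRestricted k p (sl2H k) * toRestricted k p (sl2E k) ^ i =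
    toRestricted k p (sl2E k) ^ i * aeval (toRestricted k p (sl2H k)) (X + C (2 * i : k)) := by
  induction i with
  | zero => simp
  | succ i ih =>
    rw [pow_succ, ← mul_assoc, ih]
    simp only [map_add, aeval_X, aeval_C, mul_add, add_mul, mul_assoc, he_eq, Nat.cast_succ]
    simp only [← Algebra.commutes, ← Algebra.smul_def, mul_smul_comm]
    module

lemma f_mul_e_pow (i : ℕ) : toRestricted k p (sl2F k) * toRestricted k p (sl2E k) ^ i =
    toRestricted k p (sl2E k) ^ i * toRestricted k p (sl2F k) -
      toRestricted k p (sl2E k) ^ (i - 1) *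
        aeval (toRestricted k p (sl2H k)) (C (i : k) * (X + C (i - 1 : k))) := by
  have hpoly (c d : k) : aeval (toRestricted k p (sl2H k)) (C c * (X + C d)) =
      c • (toRestricted k p (sl2H k) + d • 1) := by
    rw [map_mul, map_add, aeval_C, aeval_X, aeval_C, ← Algebra.smul_def,
      Algebra.algebraMap_eq_smul_one]
  have hstep (i : ℕ) (c d : k) : toRestricted k p (sl2E k) ^ i *
      (c • (toRestricted k p (sl2H k) + d • 1)) * toRestricted k p (sl2E k) =
      toRestricted k p (sl2E k) ^ (i + 1) * (c • (toRestricted k p (sl2H k) + (d + 2) • 1)) := by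
    have h : toRestricted k p (sl2E k) * toRestricted k p (sl2H k) +
        (2 : k) • toRestricted k p (sl2E k) + d • toRestricted k p (sl2E k) =
        toRestricted k p (sl2E k) * (toRestricted k p (sl2H k) + (d + 2) • 1) := by
      rw [mul_add, mul_smul_comm, mul_one]
      module
    rw [mul_assoc, smul_mul_assoc, add_mul, he_eq, smul_mul_assoc, one_mul, pow_succ, mul_assoc, h]
    simp only [mul_smul_comm]
  induction i with
  | zero => simp
  | succ i ih =>
    rw [pow_succ, ← mul_assoc, ih, sub_mul, mul_assoc, fe_eq, Nat.add_sub_cancel, hpoly, hpoly]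
    cases i with
    | zero => simp
    | succ i =>
      rw [Nat.add_sub_cancel, hstep, mul_sub, sub_sub, mul_assoc, ← mul_add]
      congr 2
      push_cast
      module

/-- The elements `e ^ i * q(h) * f ^ l` span the restricted enveloping algebra. -/
lemma span_pbw : Submodule.span k {a | ∃ (i l : ℕ) (q : k[X]), a = toRestricted k p (sl2E k) ^ i *
    aeval (toRestricted k p (sl2H k)) q * toRestricted k p (sl2F k) ^ l} = ⊤ := by
  set S := Submodule.span k {a | ∃ (i l : ℕ) (q : k[X]), a = toRestricted k p (sl2E k) ^ i *
    aeval (toRestricted k p (sl2H k)) q * toRestricted k p (sl2F k) ^ l} with hS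
  have hmem (i l : ℕ) (q : k[X]) : toRestricted k p (sl2E k) ^ i *
      aeval (toRestricted k p (sl2H k)) q * toRestricted k p (sl2F k) ^ l ∈ S :=
    Submodule.subset_span ⟨i, l, q, rfl⟩
  have hgen (a : RestrictedEnveloping k p) (h : ∀ (i l : ℕ) (q : k[X]),
      a * (toRestricted k p (sl2E k) ^ i * aeval (toRestricted k p (sl2H k)) q *
        toRestricted k p (sl2F k) ^ l) ∈ S) (s : RestrictedEnveloping k p) (hs : s ∈ S) :
      a * s ∈ S := by
    have : S ≤ S.comap (LinearMap.mulLeft k a) := by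
      rw [hS, Submodule.span_le]
      rintro _ ⟨i, l, q, rfl⟩
      exact h i l q
    exact this hs
  have hE := hgen (toRestricted k p (sl2E k)) fun i l q ↦ by
    rw [← mul_assoc, ← mul_assoc, ← pow_succ']
    exact hmem _ _ _
  have hH := hgen (toRestricted k p (sl2H k)) fun i l q ↦ by
    rw [← mul_assoc, ← mul_assoc, h_mul_e_pow, mul_assoc (_ ^ i), ← map_mul]
    exact hmem _ _ _
  have hF := hgen (toRestricted k p (sl2F k)) fun i l q ↦ by
    rw [← mul_assoc, ← mul_assoc, f_mul_e_pow, sub_mul, sub_mul, mul_assoc (_ ^ i), f_mul_aeval,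
      mul_assoc (_ ^ (i - 1)), ← map_mul, ← mul_assoc, mul_assoc _ _ (_ ^ l), ← pow_succ']
    exact sub_mem (hmem _ _ _) (hmem _ _ _)
  refine eq_top_iff.2 fun a _ ↦ ?_
  have ha : a ∈ Algebra.adjoin k (Set.range (toRestricted k p)) := by
    rw [adjoin_range_toRestricted]; trivial
  suffices ∀ s ∈ S, a * s ∈ S by
    have h1 := this 1 (by simpa using hmem 0 0 1)
    rwa [mul_one] at h1
  induction ha using Algebra.adjoin_induction with
  | mem a ha =>
    obtain ⟨x, rfl⟩ := ha
    intro s hs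
    rw [toRestricted_eq, add_mul, add_mul, smul_mul_assoc, smul_mul_assoc, smul_mul_assoc]
    exact add_mem (add_mem (S.smul_mem _ (hE s hs)) (S.smul_mem _ (hF s hs)))
      (S.smul_mem _ (hH s hs))
  | algebraMap c =>
    intro s hs
    rw [← Algebra.smul_def]
    exact S.smul_mem _ hs
  | add a b _ _ ha hb =>
    intro s hs
    rw [add_mul]
    exact add_mem (ha trivial s hs) (hb trivial s hs)
  | mul a b _ _ ha hb =>
    intro s hs
    rw [mul_assoc]
    exact ha trivial _ (hb trivial s hs)

variable [Fact p.Prime]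

lemma e_pow_char : toRestricted k p (sl2E k) ^ p = 0 := by
  rw [toRestricted_pow k p (sl2E k) 0]
  · simpa using toRestricted_smul k p 0 0
  · have h2 : (sl2E k).1 ^ 2 = 0 := by
      rw [pow_two]
      ext i j
      fin_cases i <;> fin_cases j <;> simp [sl2E]
    obtain ⟨n, hn⟩ := Nat.exists_eq_add_of_le (Fact.out : p.Prime).two_le
    rw [hn, pow_add, h2, zero_mul]
    rfl

lemma f_pow_char : toRestricted k p (sl2F k) ^ p = 0 := by
  rw [toRestricted_pow k p (sl2F k) 0]
  · simpa using toRestricted_smul k p 0 0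
  · have h2 : (sl2F k).1 ^ 2 = 0 := by
      rw [pow_two]
      ext i j
      fin_cases i <;> fin_cases j <;> simp [sl2F]
    obtain ⟨n, hn⟩ := Nat.exists_eq_add_of_le (Fact.out : p.Prime).two_le
    rw [hn, pow_add, h2, zero_mul]
    rfl

/-- Every element is a combination of the `e ^ i * q(h) * f ^ l` with `i, l < p`. -/
lemma exists_pbw (a : RestrictedEnveloping k p) : ∃ Q : ℕ → ℕ → k[X],
    a = ∑ i ∈ Finset.range p, toRestricted k p (sl2E k) ^ i *
      ∑ l ∈ Finset.range p, aeval (toRestricted k p (sl2H k)) (Q i l) *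
        toRestricted k p (sl2F k) ^ l := by
  have ha : a ∈ Submodule.span k {a | ∃ (i l : ℕ) (q : k[X]), a = toRestricted k p (sl2E k) ^ i *
    aeval (toRestricted k p (sl2H k)) q * toRestricted k p (sl2F k) ^ l} := by
    rw [span_pbw]; trivial
  induction ha using Submodule.span_induction with
  | mem a ha =>
    obtain ⟨i, l, q, rfl⟩ := ha
    by_cases hi : i < p
    · by_cases hl : l < p
      · refine ⟨fun i' l' ↦ if i' = i then if l' = l then q else 0 else 0, ?_⟩
        rw [Finset.sum_eq_single i (fun i' _ h ↦ by simp [h]) (fun h ↦ by simp [hi] at h),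
          Finset.sum_eq_single l (fun l' _ h ↦ by simp [h]) (fun h ↦ by simp [hl] at h)]
        simp [mul_assoc]
      · refine ⟨0, ?_⟩
        rw [← Nat.add_sub_of_le (not_lt.1 hl), pow_add, f_pow_char]
        simp
    · refine ⟨0, ?_⟩
      rw [← Nat.add_sub_of_le (not_lt.1 hi), pow_add, e_pow_char]
      simp
  | zero => exact ⟨0, by simp⟩
  | add a b _ _ ha hb =>
    obtain ⟨Q, hQ⟩ := ha
    obtain ⟨Q', hQ'⟩ := hb
    refine ⟨Q + Q', ?_⟩
    conv_lhs => rw [hQ, hQ']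
    simp only [Pi.add_apply, map_add, add_mul, Finset.sum_add_distrib, mul_add]
  | smul c a _ ha =>
    obtain ⟨Q, hQ⟩ := ha
    refine ⟨c • Q, ?_⟩
    conv_lhs => rw [hQ]
    simp only [Pi.smul_apply, map_smul, smul_mul_assoc, ← Finset.smul_sum, mul_smul_comm]

variable [CharP k p]

/-- Multiplying on the right by `f ^ (p - 1 - l)` isolates the coefficient of `f ^ l` once the lower
ones are known to vanish. -/
lemma aeval_eq_zero_of_e_pow_mul (Q : ℕ → k[X])
    (h : toRestricted k p (sl2E k) ^ (p - 1) * ∑ l ∈ Finset.range p,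
      aeval (toRestricted k p (sl2H k)) (Q l) * toRestricted k p (sl2F k) ^ l = 0) (l : ℕ)
    (hl : l < p) : aeval (toRestricted k p (sl2H k)) (Q l) = 0 := by
  induction l using Nat.strong_induction_on with
  | _ l ih =>
    refine aeval_H_eq_zero p _ ?_
    have h1 := congrArg (· * toRestricted k p (sl2F k) ^ (p - 1 - l)) h
    simp only [Finset.mul_sum, Finset.sum_mul, zero_mul] at h1
    rw [Finset.sum_eq_single l] at h1
    · rw [mul_assoc, mul_assoc, ← pow_add, show l + (p - 1 - l) = p - 1 by lia] at h1
      rw [mul_assoc, h1]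
    · intro l' hl' hne
      rcases lt_or_gt_of_ne hne with h2 | h2
      · rw [ih l' h2 (by lia), zero_mul, mul_zero, zero_mul]
      · rw [mul_assoc, mul_assoc, ← pow_add, show l' + (p - 1 - l) = p + (l' - 1 - l) by lia,
          pow_add, f_pow_char, zero_mul, mul_zero, mul_zero]
    · intro h2
      simp [hl] at h2

/-- The restricted enveloping algebra is free over `k[e] / (e ^ p)`: an element killed by left
multiplication by `e` is a multiple of `e ^ (p - 1)`. -/
lemma exists_e_pow_mul_eq (a : RestrictedEnveloping k p) (ha : toRestricted k p (sl2E k) * a = 0) :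
    ∃ b, toRestricted k p (sl2E k) ^ (p - 1) * b = a := by
  have hp := (Fact.out : p.Prime).two_le
  obtain ⟨Q, rfl⟩ := exists_pbw k p a
  have h0 (i : ℕ) (hi : i < p - 1) : ∑ l ∈ Finset.range p,
      aeval (toRestricted k p (sl2H k)) (Q i l) * toRestricted k p (sl2F k) ^ l = 0 := by
    induction i using Nat.strong_induction_on with
    | _ i ih =>
      refine Finset.sum_eq_zero fun l hl ↦ ?_
      rw [aeval_eq_zero_of_e_pow_mul k p (Q i) ?_ l (Finset.mem_range.1 hl), zero_mul]
      have h1 := congrArg (toRestricted k p (sl2E k) ^ (p - 2 - i) * ·) ha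
      simp only [mul_zero] at h1
      rw [← mul_assoc, ← pow_succ, Finset.mul_sum, Finset.sum_eq_single i] at h1
      · rwa [← mul_assoc, ← pow_add, show p - 2 - i + 1 + i = p - 1 by lia] at h1
      · intro i' hi' hne
        rcases lt_or_gt_of_ne hne with h2 | h2
        · rw [ih i' h2 (by lia), mul_zero, mul_zero]
        · rw [← mul_assoc, ← pow_add, show p - 2 - i + 1 + i' = p + (i' - 1 - i) by lia,
            pow_add, e_pow_char, zero_mul, zero_mul]
      · intro h2
        simp at h2
        lia
  refine ⟨∑ l ∈ Finset.range p, aeval (toRestricted k p (sl2H k)) (Q (p - 1) l) *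
    toRestricted k p (sl2F k) ^ l, ?_⟩
  refine Eq.symm ((Finset.sum_eq_single (p - 1) ?_ ?_).trans rfl)
  · intro i hi hne
    rw [h0 i (by have := Finset.mem_range.1 hi; lia), mul_zero]
  · intro h2
    simp at h2
    lia

end

end Sl2

/-! ### Extension of scalars for representations -/

namespace Sl2
open TensorProduct

section
variable {k : Type u} [Field k] (p : ℕ) (C : Type*) [CommRing C] [Algebra k C]

/-- The action of `C ⊗ u(sl₂)` on `C ⊗ M`. -/
def extRep (M : Type*) [AddCommGroup M] [Module k M] [Module (RestrictedEnveloping k p) M]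
    [IsScalarTower k (RestrictedEnveloping k p) M] :
    C ⊗[k] RestrictedEnveloping k p →ₐ[C] Module.End C (C ⊗[k] M) :=
  Algebra.TensorProduct.lift (Algebra.ofId C _)
    ((Module.End.baseChangeHom k C M).comp (Algebra.lsmul k k M))
    fun c _ ↦ show Commute (algebraMap C _ c) _ from Algebra.commutes c _

variable {M M' : Type*} [AddCommGroup M] [Module k M] [Module (RestrictedEnveloping k p) M]
    [IsScalarTower k (RestrictedEnveloping k p) M] [AddCommGroup M'] [Module k M']
    [Module (RestrictedEnveloping k p) M'] [IsScalarTower k (RestrictedEnveloping k p) M']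

lemma extRep_tmul (c : C) (a : RestrictedEnveloping k p) :
    extRep p C M (c ⊗ₜ a) = c • (Algebra.lsmul k k M a).baseChange C := by
  refine (Algebra.TensorProduct.lift_tmul ..).trans ?_
  exact (Algebra.smul_def c _).symm

lemma extRep_tmul_tmul (c c' : C) (a : RestrictedEnveloping k p) (m : M) :
    extRep p C M (c ⊗ₜ a) (c' ⊗ₜ m) = (c * c') ⊗ₜ (a • m) := by
  rw [extRep_tmul]
  simp [smul_tmul']

lemma extRep_map (f : M →ₗ[RestrictedEnveloping k p] M') (t : C ⊗[k] RestrictedEnveloping k p)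
    (v : C ⊗[k] M) :
    (f.restrictScalars k).baseChange C (extRep p C M t v) =
      extRep p C M' t ((f.restrictScalars k).baseChange C v) := by
  induction t with
  | zero => simp
  | add t t' h h' => simp only [map_add, LinearMap.add_apply, h, h']
  | tmul c a =>
    induction v with
    | zero => simp
    | add v v' h h' => simp only [map_add, h, h']
    | tmul c' m =>
      rw [extRep_tmul_tmul, LinearMap.baseChange_tmul, LinearMap.baseChange_tmul, extRep_tmul_tmul]
      simp

lemma extRep_self (t s : C ⊗[k] RestrictedEnveloping k p) :
    extRep p C (RestrictedEnveloping k p) t s = t * s := by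
  induction t with
  | zero => simp
  | add t t' h h' => simp only [map_add, LinearMap.add_apply, h, h', add_mul]
  | tmul c a =>
    induction s with
    | zero => simp
    | add v v' h h' => simp only [map_add, h, h', mul_add]
    | tmul c' m => rw [extRep_tmul_tmul, Algebra.TensorProduct.tmul_mul_tmul, smul_eq_mul]

/-- Extension of scalars along a homomorphism of coefficient rings is compatible with the
actions. -/
lemma extRep_rTensor {C' : Type*} [CommRing C'] [Algebra k C'] (φ : C →ₐ[k] C')
    (t : C ⊗[k] RestrictedEnveloping k p) (v : C ⊗[k] M) :
    LinearMap.rTensor M φ.toLinearMap (extRep p C M t v) =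
      extRep p C' M (Algebra.TensorProduct.map φ (AlgHom.id k _) t)
        (LinearMap.rTensor M φ.toLinearMap v) := by
  induction t with
  | zero => simp
  | add t t' h h' => simp only [map_add, LinearMap.add_apply, h, h']
  | tmul c a =>
    induction v with
    | zero => simp
    | add v v' h h' => simp only [map_add, h, h']
    | tmul c' m =>
      rw [extRep_tmul_tmul, LinearMap.rTensor_tmul, LinearMap.rTensor_tmul,
        Algebra.TensorProduct.map_tmul, extRep_tmul_tmul]
      simp

variable [Fact p.Prime] [CharP k p]

/-- The left annihilator of `e` in `C ⊗ u(sl₂)`, by flatness of `C`. -/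
lemma exists_one_tmul_e_pow_mul_eq (t : C ⊗[k] RestrictedEnveloping k p)
    (ht : (1 ⊗ₜ toRestricted k p (sl2E k)) * t = 0) :
    ∃ s, (1 ⊗ₜ toRestricted k p (sl2E k)) ^ (p - 1) * s = t := by
  have hex : Function.Exact (LinearMap.mulLeft k (toRestricted k p (sl2E k) ^ (p - 1)))
      (LinearMap.mulLeft k (toRestricted k p (sl2E k))) := by
    intro a
    refine ⟨fun h ↦ exists_e_pow_mul_eq k p a h, ?_⟩
    rintro ⟨b, rfl⟩
    rw [LinearMap.mulLeft_apply, LinearMap.mulLeft_apply, ← mul_assoc, ← pow_succ',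
      Nat.sub_add_cancel (Fact.out : p.Prime).one_le, e_pow_char, zero_mul]
  have key (a : RestrictedEnveloping k p) (s : C ⊗[k] RestrictedEnveloping k p) :
      (LinearMap.mulLeft k a).lTensor C s = (1 ⊗ₜ a) * s := by
    induction s with
    | zero => simp
    | add v v' h h' => simp only [map_add, h, h', mul_add]
    | tmul c' m => simp
  obtain ⟨s, hs⟩ := (Module.Flat.lTensor_exact C hex t).1 (by rw [key]; exact ht)
  refine ⟨s, ?_⟩
  rw [← hs, key, Algebra.TensorProduct.tmul_pow, one_pow]

variable {C}

/-- Conjugation by `g` reduces the statement for `g e g⁻¹` to the one for `e`. -/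
lemma exists_thetaElem_pow_mul_eq [Infinite k] (g g' : Matrix (Fin 2) (Fin 2) C) (hg : g' * g = 1)
    (hg' : g * g' = 1) (t : C ⊗[k] RestrictedEnveloping k p)
    (ht : thetaElem (k := k) p (g * !![0, 1; 0, 0] * g') * t = 0) :
    ∃ s, thetaElem (k := k) p (g * !![0, 1; 0, 0] * g') ^ (p - 1) * s = t := by
  have hE : (sl2E k).1.map (algebraMap k C) = !![0, 1; 0, 0] := by
    ext i j
    fin_cases i <;> fin_cases j <;> simp [sl2E]
  have h1 : conj p g g' hg (1 ⊗ₜ toRestricted k p (sl2E k)) =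
      thetaElem p (g * !![0, 1; 0, 0] * g') := by
    rw [conj_one_tmul, hE]
  rw [← h1] at ht ⊢
  obtain ⟨s, hs⟩ := exists_one_tmul_e_pow_mul_eq p C (conj p g' g hg' t) (by
    rw [← conj_conj p g' g hg' hg (1 ⊗ₜ toRestricted k p (sl2E k)), ← map_mul, ht, map_zero])
  refine ⟨conj p g g' hg s, ?_⟩
  rw [← map_pow, ← map_mul, hs, conj_conj p g g' hg hg']

omit [Fact p.Prime] [CharP k p] in
/-- Every element of `C ⊗ P`, for `P` projective, is a finite combination of its images under
equivariant maps `P → u(sl₂) → P`. -/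
lemma exists_eq_sum_of_projective {P : Type*} [AddCommGroup P] [Module k P]
    [Module (RestrictedEnveloping k p) P] [IsScalarTower k (RestrictedEnveloping k p) P]
    [Module.Projective (RestrictedEnveloping k p) P] (v : C ⊗[k] P) :
    ∃ (α : P → (P →ₗ[RestrictedEnveloping k p] RestrictedEnveloping k p))
      (β : P → (RestrictedEnveloping k p →ₗ[RestrictedEnveloping k p] P)) (s : Finset P),
      v = ∑ i ∈ s, ((β i).restrictScalars k).baseChange C
        (((α i).restrictScalars k).baseChange C v) := by
  classical
  obtain ⟨σ, hσ⟩ := Module.projective_def.1 ‹Module.Projective (RestrictedEnveloping k p) P›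
  refine ⟨fun i ↦ Finsupp.lapply i ∘ₗ σ, fun i ↦ LinearMap.toSpanSingleton _ _ i, ?_⟩
  suffices ∃ s : Finset P, ∀ s', s ⊆ s' → v = ∑ i ∈ s', ((LinearMap.toSpanSingleton
      (RestrictedEnveloping k p) P i).restrictScalars k).baseChange C
        (((Finsupp.lapply i ∘ₗ σ).restrictScalars k).baseChange C v) by
    obtain ⟨s, hs⟩ := this
    exact ⟨s, hs s subset_rfl⟩
  induction v with
  | zero => exact ⟨∅, by simp⟩
  | add v v' h h' =>
    obtain ⟨s, hs⟩ := h
    obtain ⟨s', hs'⟩ := h'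
    refine ⟨s ∪ s', fun t ht ↦ ?_⟩
    conv_lhs => rw [hs t (Finset.union_subset_left ht), hs' t (Finset.union_subset_right ht)]
    simp only [map_add, Finset.sum_add_distrib]
  | tmul c x =>
    refine ⟨(σ x).support, fun s hs ↦ ?_⟩
    have h1 : x = ∑ i ∈ s, σ x i • i := by
      conv_lhs => rw [← hσ x, Finsupp.linearCombination_apply]
      exact Finsupp.sum_of_support_subset _ hs _ (by simp)
    conv_lhs => rw [h1, tmul_sum]
    rfl

variable {P : Type*} [AddCommGroup P] [Module k P] [Module (RestrictedEnveloping k p) P]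
  [IsScalarTower k (RestrictedEnveloping k p) P] [Module.Projective (RestrictedEnveloping k p) P]

/-- A square zero matrix conjugate to `e` acts on `C ⊗ P`, for `P` projective, with all Jordan
blocks of size `p`. -/
lemma exists_extRep_pow_eq [Infinite k] (g g' : Matrix (Fin 2) (Fin 2) C) (hg : g' * g = 1)
    (hg' : g * g' = 1) {j : ℕ} (hj : j ≤ p) (v : C ⊗[k] P)
    (hv : (extRep p C P (thetaElem p (g * !![0, 1; 0, 0] * g')) ^ j) v = 0) :
    ∃ w, (extRep p C P (thetaElem p (g * !![0, 1; 0, 0] * g')) ^ (p - j)) w = v := by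
  refine Module.End.exists_pow_apply_eq_of_ker_le (fun v hv ↦ ?_) hj hv
  obtain ⟨α, β, s, hs⟩ := exists_eq_sum_of_projective (k := k) p v
  have h (i : P) : ∃ w, thetaElem p (g * !![0, 1; 0, 0] * g') ^ (p - 1) * w =
      ((α i).restrictScalars k).baseChange C v := by
    refine exists_thetaElem_pow_mul_eq p g g' hg hg' _ ?_
    rw [← extRep_self, ← extRep_map, hv, map_zero]
  choose w hw using h
  refine ⟨∑ i ∈ s, ((β i).restrictScalars k).baseChange C (w i), ?_⟩
  rw [← map_pow, map_sum]
  conv_rhs => rw [hs]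
  refine Finset.sum_congr rfl fun i _ ↦ ?_
  rw [← hw, ← extRep_self, extRep_map]

end

end Sl2

/-! ### The operator `Θ` on a projective module -/

namespace Sl2
open TensorProduct MvPolynomial ProjModule

section
variable {k : Type u} [Field k] (p : ℕ) {P : Type u} [AddCommGroup P] [Module k P]
  [Module (RestrictedEnveloping k p) P] [IsScalarTower k (RestrictedEnveloping k p) P]

variable (k) in
/-- The generic nilpotent matrix `x e + y f + z h` over the coordinate ring of the nullcone. -/
def nullMatrix : Matrix (Fin 2) (Fin 2) (NullconeRing k) :=
  !![nullconeMk k (X 2), nullconeMk k (X 0); nullconeMk k (X 1), -nullconeMk k (X 2)]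

lemma theta_eq_extRep : theta k p P = extRep p (NullconeRing k) P (thetaElem p (nullMatrix k)) := by
  rw [thetaElem, map_add, map_add, extRep_tmul, extRep_tmul, extRep_tmul]
  rfl

/-- This is the equation of the nullcone. -/
lemma nullMatrix_pow_two : nullMatrix k ^ 2 = 0 := by
  have key {C : Type u} [CommRing C] {x y z : C} (h : x * y + z ^ 2 = 0) :
      (!![z, x; y, -z] : Matrix (Fin 2) (Fin 2) C) ^ 2 = 0 := by
    rw [pow_two]
    ext i j
    fin_cases i <;> fin_cases j <;> simp [Matrix.mul_apply, Fin.sum_univ_two]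
    · linear_combination h
    · ring
    · ring
    · linear_combination h
  exact key (nullcone_relation k)

/-- The generic matrix of the nullcone has square zero, and `p`-th powers in `u(sl₂)` are computed
on matrices. -/
lemma theta_pow_char [Infinite k] [Fact p.Prime] [CharP k p] : theta k p P ^ p = 0 := by
  rw [theta_eq_extRep, ← map_pow, thetaElem_pow p _ rfl]
  obtain ⟨n, hn⟩ := Nat.exists_eq_add_of_le (Fact.out : p.Prime).two_le
  have h3 : nullMatrix k ^ p = 0 := by rw [hn, pow_add, nullMatrix_pow_two, zero_mul]
  have h0 : thetaElem (k := k) p (0 : Matrix (Fin 2) (Fin 2) (NullconeRing k)) = 0 := by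
    simp only [thetaElem, Matrix.zero_apply, zero_tmul, add_zero]
  exact (congrArg (fun N ↦ extRep p (NullconeRing k) P (thetaElem p N)) h3).trans
    ((congrArg (extRep p (NullconeRing k) P) h0).trans (map_zero _))

/-- Over a ring where one of the first two coordinates is invertible, the generic nilpotent matrix
is, up to a unit, conjugate to `e`. -/
lemma exists_conj {C : Type*} [CommRing C] {x y z : C} (h : x * y + z ^ 2 = 0)
    (hu : IsUnit x ∨ IsUnit y) : ∃ (a : C) (g g' : Matrix (Fin 2) (Fin 2) C), IsUnit a ∧
      g' * g = 1 ∧ g * g' = 1 ∧ !![z, x; y, -z] = a • (g * !![0, 1; 0, 0] * g') := by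
  rcases hu with hu | hu
  · obtain ⟨b, hb⟩ := hu.exists_right_inv
    refine ⟨x, !![1, 0; -(z * b), 1], !![1, 0; z * b, 1], hu, ?_, ?_, ?_⟩
    · ext i j; fin_cases i <;> fin_cases j <;> simp
    · ext i j; fin_cases i <;> fin_cases j <;> simp
    · ext i j
      fin_cases i <;> fin_cases j <;> simp
      · linear_combination -z * hb
      · linear_combination b * h - (y - b * z ^ 2) * hb
      · linear_combination -z * hb
  · obtain ⟨b, hb⟩ := hu.exists_right_inv
    refine ⟨y, !![z * b, 1; 1, 0], !![0, 1; 1, -(z * b)], hu, ?_, ?_, ?_⟩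
    · ext i j; fin_cases i <;> fin_cases j <;> simp
    · ext i j; fin_cases i <;> fin_cases j <;> simp
    · ext i j
      fin_cases i <;> fin_cases j <;> simp
      · linear_combination -z * hb
      · linear_combination b * h - (x - b * z ^ 2) * hb
      · linear_combination -z * hb

/-- The coordinates `x` and `y` have no common zero on the projectivized nullcone, since
`z² = -x y`. -/
lemma exists_notMem_of_point (x : ProjectiveSpectrum (nullconeGrading k)) :
    nullconeMk k (X 0) ∉ x.asHomogeneousIdeal.toIdeal ∨
      nullconeMk k (X 1) ∉ x.asHomogeneousIdeal.toIdeal := by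
  by_contra! h
  obtain ⟨h0, h1⟩ := h
  have h2 : nullconeMk k (X 2) ∈ x.asHomogeneousIdeal.toIdeal := by
    refine x.isPrime.mem_of_pow_mem 2 ?_
    rw [eq_neg_of_add_eq_zero_right (nullcone_relation k)]
    exact neg_mem (Ideal.mul_mem_right _ _ h0)
  refine x.not_irrelevant_le ((HomogeneousIdeal.irrelevant_le _).2 fun i hi a ha ↦ ?_)
  obtain ⟨q, hq, rfl⟩ := ha
  have hspan : q ∈ Ideal.span (X '' (Set.univ : Set (Fin 3))) := by
    refine mem_ideal_span_X_image.mpr fun m hm ↦ ?_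
    by_contra! hcon
    have : m = 0 := Finsupp.ext fun i ↦ hcon i (Set.mem_univ i)
    subst this
    have := hq (mem_support_iff.mp hm)
    rw [map_zero] at this
    exact hi.ne this
  have hle : Ideal.span (X '' (Set.univ : Set (Fin 3))) ≤
      x.asHomogeneousIdeal.toIdeal.comap (nullconeMk k) := by
    refine Ideal.span_le.mpr ?_
    rintro _ ⟨i, -, rfl⟩
    fin_cases i
    exacts [h0, h1, h2]
  exact hle hspan

lemma rTensor_smul {A C : Type*} [CommRing A] [Algebra k A] [CommRing C] [Algebra k C]
    (φ : A →ₐ[k] C) {P : Type*} [AddCommGroup P] [Module k P] (a : A) (v : A ⊗[k] P) :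
    LinearMap.rTensor P φ.toLinearMap (a • v) = φ a • LinearMap.rTensor P φ.toLinearMap v := by
  induction v with
  | zero => simp
  | add v v' h h' => simp only [smul_add, map_add, h, h']
  | tmul b v => simp [smul_tmul']

/-- Denominators can be cleared in a localization of `A ⊗ P`. -/
lemma exists_rTensor_eq_smul {A : Type*} [CommRing A] [Algebra k A] (S : Submonoid A)
    {C : Type*} [CommRing C] [Algebra k C] [Algebra A C] [IsScalarTower k A C] [IsLocalization S C]
    {P : Type*} [AddCommGroup P] [Module k P] (t : C ⊗[k] P) :
    ∃ (s : S) (t' : A ⊗[k] P),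
      LinearMap.rTensor P (IsScalarTower.toAlgHom k A C).toLinearMap t' =
        algebraMap A C s • t := by
  induction t with
  | zero => exact ⟨1, 0, by simp⟩
  | tmul c v =>
    obtain ⟨⟨a, s⟩, h⟩ := IsLocalization.surj S c
    refine ⟨s, a ⊗ₜ v, ?_⟩
    rw [LinearMap.rTensor_tmul, smul_tmul', smul_eq_mul, mul_comm, h]
    rfl
  | add t u ht hu =>
    obtain ⟨s, t', ht⟩ := ht
    obtain ⟨r, u', hu⟩ := hu
    refine ⟨s * r, r.1 • t' + s.1 • u', ?_⟩
    rw [map_add, rTensor_smul, rTensor_smul, ht, hu, Submonoid.coe_mul, map_mul, smul_add,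
      smul_smul, smul_smul, IsScalarTower.toAlgHom_apply, IsScalarTower.toAlgHom_apply,
      mul_comm (algebraMap A C r.1)]

variable [Infinite k] [Fact p.Prime] [CharP k p] [Module.Projective (RestrictedEnveloping k p) P]

/-- The matrix with entries `x, y, z` acts on `A ⊗ P`, for `P` projective, with all Jordan blocks
of size `p` locally where `x` or `y` is invertible. -/
lemma exists_smul_mem_range_extRep {A : Type*} [CommRing A] [IsDomain A] [Algebra k A] {x y z : A}
    (h : x * y + z ^ 2 = 0) (I : Ideal A) [I.IsPrime] (hI : x ∉ I ∨ y ∉ I) {j : ℕ} (hj : j ≤ p)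
    (v : A ⊗[k] P) (hv : (extRep p A P (thetaElem p !![z, x; y, -z]) ^ j) v = 0) :
    ∃ c ∉ I, c • v ∈ LinearMap.range (extRep p A P (thetaElem p !![z, x; y, -z]) ^ (p - j)) := by
  let C := Localization.AtPrime I
  let φ : A →ₐ[k] C := IsScalarTower.toAlgHom k A C
  have hφ : Function.Injective φ := IsLocalization.injective C I.primeCompl_le_nonZeroDivisors
  let ψ := LinearMap.rTensor P φ.toLinearMap
  have hψ : Function.Injective ψ := Module.Flat.rTensor_preserves_injective_linearMap _ hφ
  have hunit (a : A) (ha : a ∉ I) : IsUnit (φ a) :=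
    IsLocalization.map_units C (⟨a, ha⟩ : I.primeCompl)
  obtain ⟨a, g, g', ha, hg, hg', hN⟩ := exists_conj (C := C) (x := φ x) (y := φ y) (z := φ z)
    (by rw [← map_mul, ← map_pow, ← map_add, h, map_zero]) (hI.imp (hunit _) (hunit _))
  have hmap : (!![z, x; y, -z] : Matrix (Fin 2) (Fin 2) A).map φ =
      a • (g * !![0, 1; 0, 0] * g') := by
    rw [← hN]
    ext i j
    fin_cases i <;> fin_cases j <;> simp
  have hθ (i : ℕ) (v : A ⊗[k] P) :
      ψ ((extRep p A P (thetaElem p !![z, x; y, -z]) ^ i) v) =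
        a ^ i • (extRep p C P (thetaElem p (g * !![0, 1; 0, 0] * g')) ^ i) (ψ v) := by
    rw [← map_pow]
    refine (extRep_rTensor p _ φ _ v).trans ?_
    rw [map_pow, thetaElem_map, hmap, thetaElem_smul, smul_pow, map_smul, map_pow]
    rfl
  obtain ⟨w, hw⟩ := exists_extRep_pow_eq p g g' hg hg' hj (ψ v) (by
    have h1 := hθ j v
    rw [hv, map_zero] at h1
    exact ((ha.pow j).smul_eq_zero).1 h1.symm)
  obtain ⟨b, hb⟩ := (ha.pow (p - j)).exists_right_inv
  obtain ⟨s, w', hw'⟩ := exists_rTensor_eq_smul I.primeCompl (C := C) (b • w)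
  refine ⟨s, s.2, w', hψ ?_⟩
  have hw2 : ψ w' = algebraMap A C s • b • w := hw'
  rw [hθ, hw2, map_smul, map_smul, hw, smul_comm, smul_smul (a ^ _), hb, one_smul]
  exact (rTensor_smul φ _ _).symm

/-- For `P` projective, the operator `Θ` on `A ⊗ P` has, locally on `Proj A`, all its Jordan blocks
of size `p`. -/
lemma exists_smul_mem_range_theta (x : ProjectiveSpectrum (nullconeGrading k)) {j : ℕ} (hj : j ≤ p)
    (v : NullconeRing k ⊗[k] P) (hv : (theta k p P ^ j) v = 0) :
    ∃ c ∉ x.asHomogeneousIdeal.toIdeal, c • v ∈ LinearMap.range (theta k p P ^ (p - j)) := by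
  have := x.isPrime
  rw [theta_eq_extRep] at hv ⊢
  exact exists_smul_mem_range_extRep p (nullcone_relation k) _ (exists_notMem_of_point x) hj v hv

end

end Sl2

/-! ### Comparison of `ℱ_i(M)` and `ℱ_{p-i}(Ω M)` -/

namespace Sl2
open TensorProduct MvPolynomial ProjModule

section
variable {k : Type u} [Field k] (p : ℕ)
variable {M P : Type u} [AddCommGroup M] [Module k M] [Module (RestrictedEnveloping k p) M]
    [IsScalarTower k (RestrictedEnveloping k p) M]
    [AddCommGroup P] [Module k P] [Module (RestrictedEnveloping k p) P]
    [IsScalarTower k (RestrictedEnveloping k p) P]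

lemma baseChange_theta (φ : P →ₗ[RestrictedEnveloping k p] M) (v : NullconeRing k ⊗[k] P) :
    (φ.restrictScalars k).baseChange (NullconeRing k) (theta k p P v) =
      theta k p M ((φ.restrictScalars k).baseChange (NullconeRing k) v) := by
  rw [theta_eq_extRep, theta_eq_extRep]
  exact extRep_map p _ φ _ v

lemma baseChange_mem (φ : P →ₗ[k] M) {d : ℤ} {m : NullconeRing k ⊗[k] P}
    (hm : m ∈ (GrMod.free (nullconeGrading k) P).piece d) :
    φ.baseChange (NullconeRing k) m ∈ (GrMod.free (nullconeGrading k) M).piece d := by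
  obtain ⟨t, rfl⟩ := hm
  exact ⟨φ.lTensor _ t, by
    change (LinearMap.rTensor M _ ∘ₗ LinearMap.lTensor _ φ) t =
      (LinearMap.lTensor _ φ ∘ₗ LinearMap.rTensor P _) t
    rw [LinearMap.rTensor_comp_lTensor, LinearMap.lTensor_comp_rTensor]⟩

variable [Infinite k] [Fact p.Prime] [CharP k p]

/-- The extension `0 → A ⊗ ker φ → A ⊗ P → A ⊗ M → 0` with its operators `Θ`. -/
def extension (φ : P →ₗ[RestrictedEnveloping k p] M) (hφ : Function.Surjective φ) :
    NilpotentExtension (theta k p (LinearMap.ker φ)) (theta k p P) (theta k p M) p where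
  ι := ((LinearMap.ker φ).subtype.restrictScalars k).baseChange (NullconeRing k)
  π := (φ.restrictScalars k).baseChange (NullconeRing k)
  ι_injective := Module.Flat.lTensor_preserves_injective_linearMap _ Subtype.val_injective
  π_surjective := LinearMap.lTensor_surjective _ hφ
  exact := by
    have h : Function.Exact ((LinearMap.ker φ).subtype.restrictScalars k)
        (φ.restrictScalars k) := fun x ↦ by simp
    ext v
    exact (lTensor_exact (NullconeRing k) h hφ v).symm
  ι_comm := baseChange_theta p (LinearMap.ker φ).subtype
  π_comm := baseChange_theta p φ
  pow_eq_zero := theta_pow_char p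

/-- The comparison on `ℙ(sl₂)`, where it involves a shift by `p - i`. -/
lemma nonempty_grF_iso (φ : P →ₗ[RestrictedEnveloping k p] M) (hφ : IsProjectiveCover φ)
    (i : ℕ) (hi : 1 ≤ i) (hip : i < p) :
    Nonempty (assocSheaf (grF k p M i) ≅
      assocSheaf ((grF k p (LinearMap.ker φ) (p - i)).shift ((p - i : ℕ) : ℤ))) := by
  have := hφ.projective
  have hθ (N : Type u) [AddCommGroup N] [Module k N] [Module (RestrictedEnveloping k p) N]
      [IsScalarTower k (RestrictedEnveloping k p) N] {d : ℤ} {m : NullconeRing k ⊗[k] N}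
      (hm : m ∈ (base k N).piece d) : theta k p N m ∈ (base k N).piece (1 + d) := by
    change _ ∈ (GrMod.free (nullconeGrading k) N).piece (0 + (1 + d))
    rw [add_left_comm]
    exact theta_mem k p N hm
  exact NilpotentExtension.nonempty_iso (L := base k (LinearMap.ker φ)) (V := base k P)
    (W := base k M) (extension p φ hφ.surjective) (baseProjections k (LinearMap.ker φ))
    (baseProjections k P) (baseProjections k M) (hθ _) (hθ _) (hθ _)
    (fun hm ↦ baseChange_mem _ hm) (fun hm ↦ baseChange_mem _ hm)
    (fun x j v hj hv ↦ exists_smul_mem_range_theta p x hj v hv) hi hip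

end

end Sl2

end

theorem mainTheorem12 {k : Type u} [Field k] [IsAlgClosed k] (p : ℕ) [Fact p.Prime] [CharP k p]
    (M P : Type u)
    [AddCommGroup M] [Module k M] [Module (Sl2.RestrictedEnveloping k p) M]
    [IsScalarTower k (Sl2.RestrictedEnveloping k p) M]
    [AddCommGroup P] [Module k P] [Module (Sl2.RestrictedEnveloping k p) P]
    [IsScalarTower k (Sl2.RestrictedEnveloping k p) P]
    (φ : P →ₗ[Sl2.RestrictedEnveloping k p] M) (hφ : Sl2.IsProjectiveCover φ)
    (i : ℕ) (hi : 1 ≤ i) (hip : i < p) :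
    Nonempty (Sl2.sheafFP1 k p M i ≅
      ProjModule.twist (Sl2.sheafFP1 k p (LinearMap.ker φ) (p - i))
        (2 * (p : ℤ) - 2 * (i : ℤ))) := by
  have : Infinite k := IsAlgClosed.instInfinite
  obtain ⟨e₁⟩ := Sl2.nonempty_sheafF_iso k p M i
  obtain ⟨e₂⟩ := Sl2.nonempty_grF_iso p φ hφ i hi hip
  obtain ⟨e₃⟩ := Sl2.nonempty_pullback_shift_iso k (Sl2.grF k p (LinearMap.ker φ) (p - i)) (p - i)
  obtain ⟨e₄⟩ := Sl2.nonempty_sheafF_iso k p (LinearMap.ker φ) (p - i)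
  have hn : ((2 * (p - i) : ℕ) : ℤ) = 2 * (p : ℤ) - 2 * (i : ℤ) := by
    push_cast [Nat.cast_sub hip.le]
    ring
  let F := AlgebraicGeometry.Scheme.Modules.pullback (Sl2.iota k)
  exact hn ▸ ⟨F.mapIso e₁ ≪≫ F.mapIso e₂ ≪≫ e₃ ≪≫
    ProjModule.tensorSheafIso (F.mapIso e₄.symm) _⟩
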